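/- Let $n\ge 1$ and $s>0$. For $u\in L^2(\mathbb R^n)$ and $v\in L^2_{\mathrm{loc}}(\mathbb R^n)$ put $$\|u\|_B=\sum_{j>0}R_j^{1/2}\|u\|_{L^2(X_j)},\qquad \|v\|_{B^*}=\sup_{j>0}R_j^{-1/2}\|v\|_{L^2(X_j)},$$ where $R_0=0$, $R_j=2^{j-1}$ for $j>0$ and $X_j=\{x\in\mathbb R^n: R_{j-1}<|x|<R_j\}$. Let $B$ and $B^*$ be the spaces where these norms are finite, paired by $\langle v,u\rangle=\int v\bar u\,dx$. Let $B_s^*$ be the space of tempered distributions $u$ with $\|u\|_{B_s^*}=\|(I-\Delta)^{s/2}u\|_{B^*}<\infty$. Let $\mathbb C^\pm=\{z\in\mathbb C:\pm\mathrm{Im}\,z\ge 0\}$, write $\langle\xi\rangle=(1+|\xi|^2)^{1/2}$, let $\mathscr F f=\hat f$ be the Fourier transform, and let $\mathscr F^{-1}C_c^\infty$ be the set of functions $f$ with $\hat f\in C_c^\infty(\mathbb R^n)$. Let $r\in C^1(\mathbb R^n)$ (complex valued) satisfy $$\sup_{\xi}\left|\frac{r(\xi)}{\langle\xi\rangle^s}\right|+\sup_{\xi}\left|\nabla\frac{r(\xi)}{\langle\xi\rangle^s}\right|<\infty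 .$$ For $z\in\mathbb C\setminus\mathbb R$ and $f\in L^2$ let $r(D)R_0(z)f=\mathscr F^{-1}\big(r(\xi)(|\xi|^s-z)^{-1}\hat f\big)$, so that $R_0(z)=((-\Delta)^{s/2}-z)^{-1}$. For $z=\lambda\in\mathbb R\setminus\{0\}$, seen as a point of $\mathbb C^\pm$, let $r(D)R_0(\lambda\pm i0)f$ be the limit of $r(D)R_0(\lambda\pm i\varepsilon)f$ in $\mathscr S'$ as $\varepsilon\to0+$. Then the following hold for each of the two signs. (a) Let $K\subset\mathbb C^\pm$ be closed with $0\notin K$ and $\mathrm{Re}\,K$ bounded. Then there is a constant $C_K$, depending on $n,s,r,K$ but not on $f$ and $z$, such that for all $f\in\mathscr F^{-1}C_c^\infty$ and $z\in K$ (boundary values at real $z$ included) $r(D)R_0(z)f$ exists, lies in $B^*$ and satisfies $$\|r(D)R_0(z)f\|_{B^*}\le C_K\|f\|_B .$$ (b) There is exactly one family of bounded linear operators $T_z:B\to B^*$, $z\in\mathbb C^\pm\setminus\{0\}$, such that $T_zf=r(D)R_0(z)f$ for all $f\in\mathscr F^{-1}C_c^\infty$ and all $z$, and such that $z\mapsto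 T_zf$ is weak* continuous on $\mathbb C^\pm\setminus\{0\}$ for all $f\in B$, that is, $z\mapsto\langle T_zf,v\rangle$ is continuous for every $v\in B$. Moreover $T_zf=r(D)R_0(z)f$ for all $f\in B$, and $\|T_zf\|_{B^*}\le C_K\|f\|_B$ for all $f\in B$ and $z\in K$, with $K$ as in (a). (c) In particular, for every $z\in\mathbb C^\pm\setminus\{0\}$, the extended operator $R_0(z)$ (the case $r\equiv1$ of (b)), and hence each $R_0(\lambda\pm i0)$ with $\lambda\in\mathbb R\setminus\{0\}$, maps $B$ boundedly into $B_s^*$. -/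

import Mathlib

open MeasureTheory Filter Topology
open scoped NNReal ENNReal SchwartzMap FourierTransform ComplexConjugate

namespace FracLAP

noncomputable section

/-- `ℝⁿ` with its Euclidean norm. -/
abbrev E (n : ℕ) : Type := EuclideanSpace ℝ (Fin n)

/-! ### The spaces `B`, `B^*` and `B_s^*` -/

/-- The radii `R_0 = 0` and `R_j = 2^(j-1)` for `j > 0`. -/
def radius (j : ℕ) : ℝ := if j = 0 then 0 else 2 ^ (j - 1)

/-- The annulus `X_j = {x : R_{j-1} < |x| < R_j}`, used for `j > 0` only. -/
def annulus (n j : ℕ) : Set (E n) := {x | radius (j - 1) < ‖x‖ ∧ ‖x‖ < radius j}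

/-- `‖u‖_B = ∑_{j>0} R_j^{1/2} ‖u‖_{L²(X_j)}`; the summation index is `j = k + 1`. -/
def bNorm {n : ℕ} (u : E n →ₘ[volume] ℂ) : ℝ≥0∞ :=
  ∑' k : ℕ, ENNReal.ofReal (radius (k + 1) ^ (1 / 2 : ℝ)) *
    eLpNorm u 2 (volume.restrict (annulus n (k + 1)))

/-- `‖v‖_{B^*} = sup_{j>0} R_j^{-1/2} ‖v‖_{L²(X_j)}`; the index is `j = k + 1`. -/
def bStarNorm {n : ℕ} (v : E n →ₘ[volume] ℂ) : ℝ≥0∞ :=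
  ⨆ k : ℕ, ENNReal.ofReal (radius (k + 1) ^ (-(1 / 2) : ℝ)) *
    eLpNorm v 2 (volume.restrict (annulus n (k + 1)))

lemma eLpNorm_aeeq_add_le {n : ℕ} (u v : E n →ₘ[volume] ℂ) (S : Set (E n)) :
    eLpNorm (u + v : E n →ₘ[volume] ℂ) 2 (volume.restrict S)
      ≤ eLpNorm u 2 (volume.restrict S) + eLpNorm v 2 (volume.restrict S) := by
  rw [eLpNorm_congr_ae (ae_restrict_of_ae (AEEqFun.coeFn_add u v))]
  exact eLpNorm_add_le u.aestronglyMeasurable.restrict v.aestronglyMeasurable.restrict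
    (by norm_num)

lemma eLpNorm_aeeq_smul {n : ℕ} (c : ℂ) (u : E n →ₘ[volume] ℂ) (S : Set (E n)) :
    eLpNorm (c • u : E n →ₘ[volume] ℂ) 2 (volume.restrict S)
      = ‖c‖ₑ * eLpNorm u 2 (volume.restrict S) := by
  rw [eLpNorm_congr_ae (ae_restrict_of_ae (AEEqFun.coeFn_smul c u))]
  exact eLpNorm_const_smul c _ _ _

lemma eLpNorm_aeeq_zero {n : ℕ} (S : Set (E n)) :
    eLpNorm (0 : E n →ₘ[volume] ℂ) 2 (volume.restrict S) = 0 := by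
  rw [eLpNorm_congr_ae (ae_restrict_of_ae AEEqFun.coeFn_zero), eLpNorm_zero]

lemma bNorm_zero {n : ℕ} : bNorm (0 : E n →ₘ[volume] ℂ) = 0 := by
  simp [bNorm, eLpNorm_aeeq_zero]

lemma bNorm_add_le {n : ℕ} (u v : E n →ₘ[volume] ℂ) : bNorm (u + v) ≤ bNorm u + bNorm v := by
  unfold bNorm
  rw [← ENNReal.tsum_add]
  refine ENNReal.tsum_le_tsum fun k => ?_
  rw [← mul_add]
  gcongr
  exact eLpNorm_aeeq_add_le u v _

lemma bNorm_smul {n : ℕ} (c : ℂ) (u : E n →ₘ[volume] ℂ) : bNorm (c • u) = ‖c‖ₑ * bNorm u := by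
  unfold bNorm
  rw [← ENNReal.tsum_mul_left]
  refine tsum_congr fun k => ?_
  rw [eLpNorm_aeeq_smul, mul_left_comm]

lemma bStarNorm_zero {n : ℕ} : bStarNorm (0 : E n →ₘ[volume] ℂ) = 0 := by
  simp [bStarNorm, eLpNorm_aeeq_zero]

lemma bStarNorm_add_le {n : ℕ} (u v : E n →ₘ[volume] ℂ) :
    bStarNorm (u + v) ≤ bStarNorm u + bStarNorm v := by
  refine iSup_le fun k => ?_
  refine (mul_le_mul_right (eLpNorm_aeeq_add_le u v _) _).trans ?_
  rw [mul_add]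
  exact add_le_add
    (le_iSup (fun k : ℕ => ENNReal.ofReal (radius (k + 1) ^ (-(1 / 2) : ℝ)) *
      eLpNorm u 2 (volume.restrict (annulus n (k + 1)))) k)
    (le_iSup (fun k : ℕ => ENNReal.ofReal (radius (k + 1) ^ (-(1 / 2) : ℝ)) *
      eLpNorm v 2 (volume.restrict (annulus n (k + 1)))) k)

lemma bStarNorm_smul {n : ℕ} (c : ℂ) (u : E n →ₘ[volume] ℂ) :
    bStarNorm (c • u) = ‖c‖ₑ * bStarNorm u := by
  unfold bStarNorm
  rw [ENNReal.mul_iSup]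
  refine iSup_congr fun k => ?_
  rw [eLpNorm_aeeq_smul, mul_left_comm]

/-- The space `B` of all `u ∈ L²(ℝⁿ)` with `‖u‖_B < ∞`. Its norm is `bNorm`; the `L²` norm that
the subspace inherits as a subtype is never used. -/
def BSpace (n : ℕ) : Submodule ℂ (Lp ℂ 2 (volume : Measure (E n))) where
  carrier := {u | bNorm (u : E n →ₘ[volume] ℂ) < ⊤}
  zero_mem' := by
    change bNorm (0 : E n →ₘ[volume] ℂ) < ⊤
    simp [bNorm_zero]
  add_mem' := by
    intro u v hu hv
    exact (bNorm_add_le (u : E n →ₘ[volume] ℂ) v).trans_lt (ENNReal.add_lt_top.2 ⟨hu, hv⟩)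
  smul_mem' := by
    intro c u hu
    change bNorm (c • (u : E n →ₘ[volume] ℂ)) < ⊤
    rw [bNorm_smul]
    exact ENNReal.mul_lt_top enorm_lt_top hu

/-- The space `B^*` of all `v ∈ L²_loc(ℝⁿ)` with `‖v‖_{B^*} < ∞`. Its norm is `bStarNorm`. -/
def BStar (n : ℕ) : Submodule ℂ (E n →ₘ[(volume : Measure (E n))] ℂ) where
  carrier := {v | (∀ S : Set (E n), IsCompact S → MemLp v 2 (volume.restrict S)) ∧
    bStarNorm v < ⊤}
  zero_mem' := by
    refine ⟨fun S _ => ⟨(0 : E n →ₘ[volume] ℂ).aestronglyMeasurable.restrict, ?_⟩, ?_⟩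
    · rw [eLpNorm_aeeq_zero]; simp
    · simp [bStarNorm_zero]
  add_mem' := by
    intro u v hu hv
    refine ⟨fun S hS => ⟨(u + v).aestronglyMeasurable.restrict, ?_⟩,
      (bStarNorm_add_le u v).trans_lt (ENNReal.add_lt_top.2 ⟨hu.2, hv.2⟩)⟩
    exact (eLpNorm_aeeq_add_le u v S).trans_lt
      (ENNReal.add_lt_top.2 ⟨(hu.1 S hS).2, (hv.1 S hS).2⟩)
  smul_mem' := by
    intro c u hu
    refine ⟨fun S hS => ⟨(c • u).aestronglyMeasurable.restrict, ?_⟩, ?_⟩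
    · rw [eLpNorm_aeeq_smul]
      exact ENNReal.mul_lt_top enorm_lt_top (hu.1 S hS).2
    · rw [bStarNorm_smul]
      exact ENNReal.mul_lt_top enorm_lt_top hu.2

/-- The duality pairing `⟨v, u⟩ = ∫ v ū dx` of `v ∈ B^*` and `u ∈ B`. -/
def pairing {n : ℕ} (v : BStar n) (u : BSpace n) : ℂ :=
  ∫ x, (v : E n →ₘ[volume] ℂ) x * conj ((u : Lp ℂ 2 (volume : Measure (E n))) x)

/-- `⟨ξ⟩^τ = (1 + |ξ|²)^{τ/2}`. -/
def japanese {n : ℕ} (τ : ℝ) (ξ : E n) : ℝ := (1 + ‖ξ‖ ^ 2) ^ (τ / 2)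

/-- `J_τ = (I - Δ)^{τ/2}` on `𝓢'`, the Fourier multiplier with the symbol `⟨ξ⟩^τ`. The Fourier
transform of Mathlib has the kernel `exp(-2πi x·ξ)`, hence `a(D) u = 𝓕⁻¹ (a(2π ·) 𝓕 u)`. -/
def bessel (n : ℕ) (τ : ℝ) : 𝓢'(E n, ℂ) →L[ℂ] 𝓢'(E n, ℂ) :=
  TemperedDistribution.fourierMultiplierCLM ℂ
    (fun ξ : E n => (japanese τ ((2 * Real.pi) • ξ) : ℂ))

/-- The tempered distribution `u` is given by the function `v`. -/
def IsGivenBy {n : ℕ} (u : 𝓢'(E n, ℂ)) (v : E n →ₘ[volume] ℂ) : Prop :=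
  ∀ φ : 𝓢(E n, ℂ), Integrable (fun x => φ x * v x) ∧ u φ = ∫ x, φ x * v x

/-- `u ∈ 𝓢'` belongs to `B_s^*` with `‖u‖_{B_s^*} = ‖J_s u‖_{B^*} ≤ M`. -/
def BStarSNormLE {n : ℕ} (s : ℝ) (u : 𝓢'(E n, ℂ)) (M : ℝ≥0∞) : Prop :=
  ∃ h : BStar n, IsGivenBy (bessel n s u) h ∧ bStarNorm (h : E n →ₘ[volume] ℂ) ≤ M

/-! ### Multipliers and the free resolvent -/

open Classical in
/-- The operator `a(D)` on `L²`, that is `u ↦ 𝓕⁻¹ (a(2π ·) 𝓕 u)`, on the domain of all `u ∈ L²`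
for which `a(2π ·) 𝓕 u` is in `L²` (everything, if `a` is bounded and measurable); elsewhere the
value is `0`. -/
def multL2 {n : ℕ} (a : E n → ℂ) (u : Lp ℂ 2 (volume : Measure (E n))) :
    Lp ℂ 2 (volume : Measure (E n)) :=
  if h : MemLp (fun ξ : E n => a ((2 * Real.pi) • ξ) * (𝓕 u) ξ) 2 volume
    then 𝓕⁻ (h.toLp _) else 0

/-- The symbol `r(ξ) (|ξ|^s - z)⁻¹` of `r(D) R_0(z)`, where `R_0(z) = ((-Δ)^{s/2} - z)⁻¹`. -/
def resolventSymbol {n : ℕ} (s : ℝ) (r : E n → ℂ) (z : ℂ) (ξ : E n) : ℂ :=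
  r ξ * (((‖ξ‖ ^ s : ℝ) : ℂ) - z)⁻¹

/-- `r ∈ C¹(ℝⁿ)` such that `r / ⟨ξ⟩^s` and its gradient are bounded. -/
def IsMultiplierOfOrder {n : ℕ} (s : ℝ) (r : E n → ℂ) : Prop :=
  ContDiff ℝ 1 r ∧ (∃ M : ℝ, ∀ ξ, ‖r ξ / (japanese s ξ : ℂ)‖ ≤ M) ∧
    ∃ M : ℝ, ∀ ξ, ‖fderiv ℝ (fun η => r η / (japanese s η : ℂ)) ξ‖ ≤ M

/-- `ℂ^+ = {Im z ≥ 0}` for `σ = 1` and `ℂ^- = {Im z ≤ 0}` for `σ = -1`. -/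
def halfPlane (σ : ℝ) : Set ℂ := {z | 0 ≤ σ * z.im}

/-- `ℂ^± \ {0}`. -/
def puncturedHalfPlane (σ : ℝ) : Set ℂ := {z | z ∈ halfPlane σ ∧ z ≠ 0}

/-- `K` is a closed subset of `ℂ^±` with `0 ∉ K` and bounded real part. -/
def IsAdmissible (σ : ℝ) (K : Set ℂ) : Prop :=
  IsClosed K ∧ K ⊆ halfPlane σ ∧ (0 : ℂ) ∉ K ∧ Bornology.IsBounded (Complex.re '' K)

/-- `f ∈ 𝓕⁻¹ C_c^∞`, that is, the Fourier transform of `f` is smooth with compact support. -/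
def IsBandLimited {n : ℕ} (f : Lp ℂ 2 (volume : Measure (E n))) : Prop :=
  ∃ ψ : E n → ℂ, ContDiff ℝ ((⊤ : ℕ∞) : WithTop ℕ∞) ψ ∧ HasCompactSupport ψ ∧
    ((𝓕 f : Lp ℂ 2 (volume : Measure (E n))) : E n → ℂ) =ᵐ[volume] ψ

/-- `g = r(D) R_0(z) f`. For `z ∉ ℝ` this is the `L²` function with the Fourier transform
`r(ξ) (|ξ|^s - z)⁻¹ f̂(ξ)`. For `z = λ ∈ ℝ` it is the boundary value `r(D) R_0(λ ± i0) f` from the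
half plane `ℂ^±`, that is, the limit in `𝓢'` of `r(D) R_0(λ ± iε) f` as `ε → 0+`. -/
def IsResolventValue {n : ℕ} (σ s : ℝ) (r : E n → ℂ) (z : ℂ)
    (f : Lp ℂ 2 (volume : Measure (E n))) (g : E n →ₘ[volume] ℂ) : Prop :=
  (z.im ≠ 0 → g = (multL2 (resolventSymbol s r z) f : E n →ₘ[volume] ℂ)) ∧
  (z.im = 0 → ∀ φ : 𝓢(E n, ℂ),
    Tendsto (fun ε : ℝ =>
        ∫ x, φ x * multL2 (resolventSymbol s r (z + σ * ε * Complex.I)) f x)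
      (𝓝[>] 0) (𝓝 (∫ x, φ x * g x)))

/-- The family `T z : B → B^*`, `z ∈ ℂ^± \ {0}`, of bounded linear operators extends the maps
`z ↦ r(D) R_0(z) f`, given for `f ∈ 𝓕⁻¹ C_c^∞`, to weak* continuous maps for all `f ∈ B`. -/
structure IsExtension {n : ℕ} (σ s : ℝ) (r : E n → ℂ)
    (T : puncturedHalfPlane σ → (BSpace n →ₗ[ℂ] BStar n)) : Prop where
  agrees : ∀ (z : puncturedHalfPlane σ) (f : BSpace n),
    IsBandLimited (f : Lp ℂ 2 (volume : Measure (E n))) →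
      IsResolventValue σ s r z f (T z f : E n →ₘ[volume] ℂ)
  bounded : ∀ z : puncturedHalfPlane σ, ∃ C : ℝ≥0, ∀ f : BSpace n,
    bStarNorm (T z f : E n →ₘ[volume] ℂ) ≤ C * bNorm (f : E n →ₘ[volume] ℂ)
  weakStar : ∀ f v : BSpace n, Continuous fun z : puncturedHalfPlane σ => pairing (T z f) v

end

end FracLAP

open FracLAP

namespace FracLAP

/-! ### Cauchy integrals on an interval -/

section Interval

variable {a b : ℝ} {A A' G G' : ℝ → ℂ}

lemma integral_norm_sq_mono {u v : ℝ} (hA : ContinuousOn A (Set.Icc a b)) (hau : a ≤ u)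
    (huv : u ≤ v) (hvb : v ≤ b) :
    ∫ t in u..v, ‖A t‖ ^ 2 ≤ ∫ t in a..b, ‖A t‖ ^ 2 := by
  refine intervalIntegral.integral_mono_interval hau huv hvb
    (ae_of_all _ fun t => by positivity) ?_
  exact ContinuousOn.intervalIntegrable_of_Icc (hau.trans (huv.trans hvb)) (hA.norm.pow 2)

lemma sq_norm_sub_le {u v : ℝ} (hd : ∀ t ∈ Set.Icc a b, HasDerivAt A (A' t) t)
    (hA' : ContinuousOn A' (Set.Icc a b)) (hau : a ≤ u) (huv : u ≤ v) (hvb : v ≤ b) :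
    ‖A v - A u‖ ^ 2 ≤ (v - u) * ∫ t in a..b, ‖A' t‖ ^ 2 := by
  have hsub : Set.Icc u v ⊆ Set.Icc a b := Set.Icc_subset_Icc hau hvb
  have hc : ContinuousOn A' (Set.Icc u v) := hA'.mono hsub
  have hFTC : ∫ t in u..v, A' t = A v - A u :=
    intervalIntegral.integral_eq_sub_of_hasDerivAt
      (fun t ht => hd t (hsub (by rwa [Set.uIcc_of_le huv] at ht)))
      (hc.intervalIntegrable_of_Icc huv)
  rcases huv.eq_or_lt with rfl | hlt
  · simp
  set I := ∫ t in u..v, ‖A' t‖ with hI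
  have h1 : ‖A v - A u‖ ≤ I := by
    rw [← hFTC]; exact intervalIntegral.norm_integral_le_integral_norm huv
  have hpos : 0 < v - u := sub_pos.2 hlt
  have i1 : IntervalIntegrable (fun t => ‖A' t‖) volume u v :=
    (hc.norm).intervalIntegrable_of_Icc huv
  have i2 : IntervalIntegrable (fun t => ‖A' t‖ ^ 2) volume u v :=
    (hc.norm.pow 2).intervalIntegrable_of_Icc huv
  have h2 : 0 ≤ ∫ t in u..v, (‖A' t‖ - I / (v - u)) ^ 2 :=
    intervalIntegral.integral_nonneg huv fun t _ => sq_nonneg _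
  have h3 : ∫ t in u..v, (‖A' t‖ - I / (v - u)) ^ 2
      = (∫ t in u..v, ‖A' t‖ ^ 2) - I ^ 2 / (v - u) := by
    have : ∀ t, (‖A' t‖ - I / (v - u)) ^ 2
        = ‖A' t‖ ^ 2 - (2 * (I / (v - u))) * ‖A' t‖ + (I / (v - u)) ^ 2 := fun t => by ring
    simp_rw [this]
    rw [intervalIntegral.integral_add (i2.sub (i1.const_mul _)) (by simp),
      intervalIntegral.integral_sub i2 (i1.const_mul _), intervalIntegral.integral_const_mul,
      intervalIntegral.integral_const, ← hI, smul_eq_mul]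
    field_simp
    ring
  have h4 : I ^ 2 / (v - u) ≤ ∫ t in a..b, ‖A' t‖ ^ 2 := by
    have := integral_norm_sq_mono hA' hau huv hvb
    linarith [h3 ▸ h2]
  calc ‖A v - A u‖ ^ 2 ≤ I ^ 2 := by gcongr
    _ = (v - u) * (I ^ 2 / (v - u)) := by field_simp
    _ ≤ _ := by gcongr

/-- The weighted energy `R ∫ |A|² + R⁻¹ ∫ |A'|²` on an interval. -/
noncomputable def energy (a b R : ℝ) (A A' : ℝ → ℂ) : ℝ :=
  R * (∫ t in a..b, ‖A t‖ ^ 2) + R⁻¹ * ∫ t in a..b, ‖A' t‖ ^ 2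

lemma energy_nonneg {R : ℝ} (hab : a ≤ b) (hR : 0 ≤ R) : 0 ≤ energy a b R A A' := by
  have h1 : 0 ≤ ∫ t in a..b, ‖A t‖ ^ 2 :=
    intervalIntegral.integral_nonneg hab fun t _ => by positivity
  have h2 : 0 ≤ ∫ t in a..b, ‖A' t‖ ^ 2 :=
    intervalIntegral.integral_nonneg hab fun t _ => by positivity
  unfold energy; positivity

lemma integral_sq_le_energy {R : ℝ} (hab : a ≤ b) (hR : 0 < R) :
    R * ∫ t in a..b, ‖A t‖ ^ 2 ≤ energy a b R A A' := by
  have h2 : 0 ≤ ∫ t in a..b, ‖A' t‖ ^ 2 :=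
    intervalIntegral.integral_nonneg hab fun t _ => by positivity
  unfold energy
  have := mul_nonneg (inv_nonneg.2 hR.le) h2
  linarith

lemma integral_deriv_sq_le_energy {R : ℝ} (hab : a ≤ b) (hR : 0 < R) :
    ∫ t in a..b, ‖A' t‖ ^ 2 ≤ R * energy a b R A A' := by
  have h1 : 0 ≤ ∫ t in a..b, ‖A t‖ ^ 2 :=
    intervalIntegral.integral_nonneg hab fun t _ => by positivity
  have : R * energy a b R A A' = R ^ 2 * (∫ t in a..b, ‖A t‖ ^ 2)
      + ∫ t in a..b, ‖A' t‖ ^ 2 := by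
    unfold energy; field_simp
  rw [this]
  have := mul_nonneg (sq_nonneg R) h1
  linarith

/-- A one dimensional Sobolev inequality. -/
lemma sq_norm_le_energy {R t : ℝ} (hab : a < b) (hR : 1 ≤ R)
    (hd : ∀ t ∈ Set.Icc a b, HasDerivAt A (A' t) t) (hA' : ContinuousOn A' (Set.Icc a b))
    (ht : t ∈ Set.Icc a b) :
    ‖A t‖ ^ 2 ≤ (1 / (b - a) + 2) * energy a b R A A' := by
  have hA : ContinuousOn A (Set.Icc a b) := fun t ht => (hd t ht).continuousAt.continuousWithinAt
  have hR0 : 0 < R := by linarith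
  have hpos : 0 < b - a := sub_pos.2 hab
  set N := energy a b R A A' with hN
  have hN0 : 0 ≤ N := energy_nonneg hab.le hR0.le
  have j1 : IntervalIntegrable (fun t => ‖A t‖ ^ 2) volume a b :=
    (hA.norm.pow 2).intervalIntegrable_of_Icc hab.le
  have j2 : IntervalIntegrable (fun t => ‖A' t‖ ^ 2) volume a b :=
    (hA'.norm.pow 2).intervalIntegrable_of_Icc hab.le
  -- comparison of two values by the fundamental theorem of calculus for `|A|²`
  have key : ∀ u ∈ Set.Icc a b, ∀ v ∈ Set.Icc a b, u ≤ v →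
      |‖A v‖ ^ 2 - ‖A u‖ ^ 2| ≤ N := by
    intro u hu v hv huv
    have hsub : Set.Icc u v ⊆ Set.Icc a b := Set.Icc_subset_Icc hu.1 hv.2
    have hder : ∀ x ∈ Set.uIcc u v,
        HasDerivAt (fun x => ‖A x‖ ^ 2) (2 * inner ℝ (A x) (A' x)) x := by
      intro x hx
      rw [Set.uIcc_of_le huv] at hx
      exact (hd x (hsub hx)).norm_sq
    have hcont : ContinuousOn (fun x => 2 * inner ℝ (A x) (A' x)) (Set.Icc u v) :=
      continuousOn_const.mul ((hA.mono hsub).inner (𝕜 := ℝ) (hA'.mono hsub))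
    rw [← intervalIntegral.integral_eq_sub_of_hasDerivAt hder
      (hcont.intervalIntegrable_of_Icc huv)]
    have k1 : IntervalIntegrable (fun t => ‖A t‖ ^ 2) volume u v :=
      ((hA.mono hsub).norm.pow 2).intervalIntegrable_of_Icc huv
    have k2 : IntervalIntegrable (fun t => ‖A' t‖ ^ 2) volume u v :=
      ((hA'.mono hsub).norm.pow 2).intervalIntegrable_of_Icc huv
    calc |∫ x in u..v, 2 * inner ℝ (A x) (A' x)|
        ≤ ∫ x in u..v, (R * ‖A x‖ ^ 2 + R⁻¹ * ‖A' x‖ ^ 2) := by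
          rw [← Real.norm_eq_abs]
          refine intervalIntegral.norm_integral_le_of_norm_le huv (ae_of_all _ fun x _ => ?_)
            ((k1.const_mul _).add (k2.const_mul _))
          have h1 : ‖inner ℝ (A x) (A' x)‖ ≤ ‖A x‖ * ‖A' x‖ := norm_inner_le_norm _ _
          rw [norm_mul, Real.norm_ofNat]
          have h2 : 0 ≤ R⁻¹ * (R * ‖A x‖ - ‖A' x‖) ^ 2 := by positivity
          have h3 : R⁻¹ * (R * ‖A x‖ - ‖A' x‖) ^ 2
              = R * ‖A x‖ ^ 2 - 2 * (‖A x‖ * ‖A' x‖) + R⁻¹ * ‖A' x‖ ^ 2 := by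
            field_simp; ring
          linarith
      _ = R * (∫ x in u..v, ‖A x‖ ^ 2) + R⁻¹ * ∫ x in u..v, ‖A' x‖ ^ 2 := by
          rw [intervalIntegral.integral_add (k1.const_mul _) (k2.const_mul _),
            intervalIntegral.integral_const_mul, intervalIntegral.integral_const_mul]
      _ ≤ N := by
          have := integral_norm_sq_mono hA hu.1 huv hv.2
          have := integral_norm_sq_mono hA' hu.1 huv hv.2
          rw [hN, energy]
          gcongr
  have key' : ∀ u ∈ Set.Icc a b, ‖A t‖ ^ 2 ≤ ‖A u‖ ^ 2 + N := by
    intro u hu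
    rcases le_total u t with h | h
    · linarith [(abs_le.1 (key u hu t ht h)).2]
    · linarith [(abs_le.1 (key t ht u hu h)).1]
  have hint : ∫ u in a..b, ‖A t‖ ^ 2 ≤ ∫ u in a..b, (‖A u‖ ^ 2 + N) :=
    intervalIntegral.integral_mono_on hab.le (by simp) (j1.add (by simp)) key'
  rw [intervalIntegral.integral_const, intervalIntegral.integral_add j1 (by simp),
    intervalIntegral.integral_const, smul_eq_mul, smul_eq_mul] at hint
  have h5 : ∫ u in a..b, ‖A u‖ ^ 2 ≤ N := by
    have := integral_sq_le_energy (A := A) (A' := A') hab.le hR0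
    have h0 : 0 ≤ ∫ t in a..b, ‖A t‖ ^ 2 :=
      intervalIntegral.integral_nonneg hab.le fun t _ => by positivity
    nlinarith
  have h6 : (b - a) * ‖A t‖ ^ 2 ≤ (b - a) * ((1 / (b - a) + 1) * N) := by
    have : (b - a) * ((1 / (b - a) + 1) * N) = N + (b - a) * N := by field_simp
    linarith
  have h7 := le_of_mul_le_mul_left h6 hpos
  nlinarith

/-- The symmetric Cauchy integral of a constant is bounded. -/
lemma norm_integral_inv_sub_le {l y δ : ℝ} (hy : y ≠ 0) :
    ‖∫ t in (l - δ)..(l + δ), ((t : ℂ) - (l + y * Complex.I))⁻¹‖ ≤ 2 * Real.pi := by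
  have him : ∀ t : ℝ, ((t : ℂ) - (l + y * Complex.I)).im = -y := by intro t; simp
  have hne : ∀ t : ℝ, ((t : ℂ) - (l + y * Complex.I)) ≠ 0 := by
    intro t h
    have := him t
    rw [h] at this
    exact hy (by simpa using this.symm)
  have hder : ∀ t ∈ Set.uIcc (l - δ) (l + δ),
      HasDerivAt (fun t : ℝ => Complex.log ((t : ℂ) - (l + y * Complex.I)))
        (((t : ℂ) - (l + y * Complex.I))⁻¹) t := by
    intro t _
    have h1 : HasDerivAt (fun t : ℝ => (t : ℂ) - (l + y * Complex.I)) 1 t :=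
      (Complex.ofRealCLM.hasDerivAt (x := t)).sub_const _
    have := h1.clog_real (Or.inr (by rw [him]; simpa using hy))
    simpa [one_div] using this
  have hcont : Continuous fun t : ℝ => ((t : ℂ) - (l + y * Complex.I))⁻¹ :=
    (Complex.continuous_ofReal.sub continuous_const).inv₀ hne
  rw [intervalIntegral.integral_eq_sub_of_hasDerivAt hder (hcont.intervalIntegrable _ _)]
  have hnorm : ‖((l + δ : ℝ) : ℂ) - (l + y * Complex.I)‖
      = ‖((l - δ : ℝ) : ℂ) - (l + y * Complex.I)‖ := by
    rw [← sq_eq_sq₀ (norm_nonneg _) (norm_nonneg _), ← Complex.normSq_eq_norm_sq,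
      ← Complex.normSq_eq_norm_sq, Complex.normSq_apply, Complex.normSq_apply]
    simp
  have heq : Complex.log (((l + δ : ℝ) : ℂ) - (l + y * Complex.I))
      - Complex.log (((l - δ : ℝ) : ℂ) - (l + y * Complex.I))
      = ((Complex.arg (((l + δ : ℝ) : ℂ) - (l + y * Complex.I))
        - Complex.arg (((l - δ : ℝ) : ℂ) - (l + y * Complex.I)) : ℝ) : ℂ) * Complex.I := by
    unfold Complex.log
    rw [hnorm]
    push_cast
    ring
  rw [heq, norm_mul, Complex.norm_I, mul_one, Complex.norm_real]
  refine (norm_sub_le _ _).trans ?_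
  have h1 := Complex.abs_arg_le_pi (((l + δ : ℝ) : ℂ) - (l + y * Complex.I))
  have h2 := Complex.abs_arg_le_pi (((l - δ : ℝ) : ℂ) - (l + y * Complex.I))
  rw [Real.norm_eq_abs, Real.norm_eq_abs]
  linarith

lemma abs_sub_le_norm_sub (t l y : ℝ) : |t - l| ≤ ‖(t : ℂ) - (l + y * Complex.I)‖ := by
  have := Complex.abs_re_le_norm ((t : ℂ) - (l + y * Complex.I))
  simpa using this

lemma integral_abs_rpow_neg_half {l δ : ℝ} (hδ : 0 ≤ δ) :
    IntervalIntegrable (fun t : ℝ => |t - l| ^ (-(1 / 2) : ℝ)) volume (l - δ) (l + δ) ∧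
      ∫ t in (l - δ)..(l + δ), |t - l| ^ (-(1 / 2) : ℝ) = 4 * Real.sqrt δ := by
  have hr : IntervalIntegrable (fun x : ℝ => |x| ^ (-(1 / 2) : ℝ)) volume 0 δ ∧
      ∫ x in (0 : ℝ)..δ, |x| ^ (-(1 / 2) : ℝ) = 2 * Real.sqrt δ := by
    have hcongr : ∀ x ∈ Set.uIoc 0 δ, x ^ (-(1 / 2) : ℝ) = |x| ^ (-(1 / 2) : ℝ) := by
      intro x hx
      rw [Set.uIoc_of_le hδ] at hx
      rw [abs_of_pos hx.1]
    refine ⟨(intervalIntegral.intervalIntegrable_rpow' (by norm_num)).congr hcongr, ?_⟩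
    rw [← intervalIntegral.integral_congr_ae (ae_of_all _ hcongr), integral_rpow (Or.inl (by norm_num))]
    rw [Real.sqrt_eq_rpow]
    norm_num
    ring
  have hl : IntervalIntegrable (fun x : ℝ => |x| ^ (-(1 / 2) : ℝ)) volume (-δ) 0 ∧
      ∫ x in (-δ)..0, |x| ^ (-(1 / 2) : ℝ) = 2 * Real.sqrt δ := by
    constructor
    · have := (IntervalIntegrable.comp_sub_left hr.1 0).symm
      simpa using this
    · rw [← hr.2]
      have := intervalIntegral.integral_comp_neg (a := 0) (b := δ)
        (fun x : ℝ => |x| ^ (-(1 / 2) : ℝ))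
      simpa using this.symm
  have h2 := hl.1.trans hr.1
  constructor
  · have := h2.comp_sub_right l
    simpa [sub_eq_add_neg, add_comm] using this
  · have := intervalIntegral.integral_comp_sub_right (a := l - δ) (b := l + δ)
      (fun x : ℝ => |x| ^ (-(1 / 2) : ℝ)) l
    rw [this]
    have e1 : l - δ - l = -δ := by ring
    have e2 : l + δ - l = δ := by ring
    rw [e1, e2, ← intervalIntegral.integral_add_adjacent_intervals hl.1 hr.1, hl.2, hr.2]
    ring

lemma integral_sub_sq_inv_right_le {l δ : ℝ} (hδ : 0 < δ) (hb : l + δ ≤ b) :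
    IntervalIntegrable (fun t : ℝ => (|t - l| ^ 2)⁻¹) volume (l + δ) b ∧
      ∫ t in (l + δ)..b, (|t - l| ^ 2)⁻¹ ≤ δ⁻¹ := by
  have hne : ∀ t ∈ Set.uIcc (l + δ) b, t - l ≠ 0 := by
    intro t ht
    rw [Set.uIcc_of_le hb] at ht
    have := ht.1
    have h : 0 < t - l := by linarith
    exact h.ne'
  have hc : ContinuousOn (fun t : ℝ => (|t - l| ^ 2)⁻¹) (Set.uIcc (l + δ) b) := by
    refine ContinuousOn.inv₀ (by fun_prop) fun t ht => ?_
    simpa using hne t ht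
  refine ⟨hc.intervalIntegrable, ?_⟩
  have hder : ∀ t ∈ Set.uIcc (l + δ) b,
      HasDerivAt (fun t : ℝ => -(t - l)⁻¹) ((|t - l| ^ 2)⁻¹) t := by
    intro t ht
    have := (((hasDerivAt_id t).sub_const l).inv (hne t ht)).neg
    have e : (|t - l| ^ 2)⁻¹ = -(-1 / (id t - l) ^ 2) := by
      rw [sq_abs, neg_div, neg_neg, one_div]; rfl
    rw [e]
    exact this
  rw [intervalIntegral.integral_eq_sub_of_hasDerivAt hder hc.intervalIntegrable]
  have : 0 ≤ (b - l)⁻¹ := inv_nonneg.2 (by linarith)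
  simp
  linarith

lemma integral_sub_sq_inv_left_le {l δ : ℝ} (hδ : 0 < δ) (ha : a ≤ l - δ) :
    IntervalIntegrable (fun t : ℝ => (|t - l| ^ 2)⁻¹) volume a (l - δ) ∧
      ∫ t in a..(l - δ), (|t - l| ^ 2)⁻¹ ≤ δ⁻¹ := by
  have hne : ∀ t ∈ Set.uIcc a (l - δ), t - l ≠ 0 := by
    intro t ht
    rw [Set.uIcc_of_le ha] at ht
    have := ht.2
    have h : t - l < 0 := by linarith
    exact h.ne
  have hc : ContinuousOn (fun t : ℝ => (|t - l| ^ 2)⁻¹) (Set.uIcc a (l - δ)) := by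
    refine ContinuousOn.inv₀ (by fun_prop) fun t ht => ?_
    simpa using hne t ht
  refine ⟨hc.intervalIntegrable, ?_⟩
  have hder : ∀ t ∈ Set.uIcc a (l - δ),
      HasDerivAt (fun t : ℝ => -(t - l)⁻¹) ((|t - l| ^ 2)⁻¹) t := by
    intro t ht
    have := (((hasDerivAt_id t).sub_const l).inv (hne t ht)).neg
    have e : (|t - l| ^ 2)⁻¹ = -(-1 / (id t - l) ^ 2) := by
      rw [sq_abs, neg_div, neg_neg, one_div]; rfl
    rw [e]
    exact this
  rw [intervalIntegral.integral_eq_sub_of_hasDerivAt hder hc.intervalIntegrable]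
  have h0 : (a - l)⁻¹ ≤ 0 := inv_nonpos.2 (by linarith)
  have h1 : (l - δ - l)⁻¹ = -δ⁻¹ := by rw [neg_inv]; congr 1; ring
  rw [h1]
  linarith

/-- Estimate of a Cauchy integral away from its singularity. -/
lemma norm_integral_mul_inv_sub_le {u v l y R D S : ℝ} (huv : u ≤ v) (hR : 0 < R)
    (hA : ContinuousOn A (Set.Icc u v)) (hG : ∀ t ∈ Set.Icc u v, ‖G t‖ ^ 2 ≤ S)
    (hS : 0 ≤ S) (hne : ∀ t ∈ Set.Icc u v, t ≠ l)
    (hi : IntervalIntegrable (fun t : ℝ => (|t - l| ^ 2)⁻¹) volume u v)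
    (hD : ∫ t in u..v, (|t - l| ^ 2)⁻¹ ≤ D) :
    ‖∫ t in u..v, A t * G t * ((t : ℂ) - (l + y * Complex.I))⁻¹‖
      ≤ R * (∫ t in u..v, ‖A t‖ ^ 2) + R⁻¹ * S * D := by
  have i1 : IntervalIntegrable (fun t => ‖A t‖ ^ 2) volume u v :=
    (hA.norm.pow 2).intervalIntegrable_of_Icc huv
  calc _ ≤ ∫ t in u..v, (R * ‖A t‖ ^ 2 + R⁻¹ * S * (|t - l| ^ 2)⁻¹) := by
        refine intervalIntegral.norm_integral_le_of_norm_le huv (ae_of_all _ fun t ht => ?_)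
          ((i1.const_mul _).add (hi.const_mul _))
        have ht' : t ∈ Set.Icc u v := Set.Ioc_subset_Icc_self ht
        have hpos : 0 < |t - l| := abs_pos.2 (sub_ne_zero.2 (hne t ht'))
        rw [norm_mul, norm_mul, norm_inv]
        have h1 : ‖(t : ℂ) - (l + y * Complex.I)‖⁻¹ ≤ |t - l|⁻¹ :=
          inv_anti₀ hpos (abs_sub_le_norm_sub t l y)
        have h2 : ‖A t‖ * ‖G t‖ * ‖(t : ℂ) - (l + y * Complex.I)‖⁻¹
            ≤ ‖A t‖ * (‖G t‖ * |t - l|⁻¹) := by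
          rw [mul_assoc]; gcongr
        have h3 : (‖G t‖ * |t - l|⁻¹) ^ 2 ≤ S * (|t - l| ^ 2)⁻¹ := by
          rw [mul_pow, inv_pow]
          gcongr
          exact hG t ht'
        set g := ‖G t‖ * |t - l|⁻¹
        have hg0 : 0 ≤ g := by positivity
        have h4 : 0 ≤ R⁻¹ * ((R * ‖A t‖ - g) ^ 2 + R ^ 2 * ‖A t‖ ^ 2 + g ^ 2) := by positivity
        have h5 : R⁻¹ * ((R * ‖A t‖ - g) ^ 2 + R ^ 2 * ‖A t‖ ^ 2 + g ^ 2)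
            = 2 * (R * ‖A t‖ ^ 2 + R⁻¹ * g ^ 2 - ‖A t‖ * g) := by
          field_simp; ring
        have h6 : R⁻¹ * g ^ 2 ≤ R⁻¹ * (S * (|t - l| ^ 2)⁻¹) := by gcongr
        rw [mul_assoc R⁻¹ S]
        linarith
    _ = R * (∫ t in u..v, ‖A t‖ ^ 2) + R⁻¹ * S * ∫ t in u..v, (|t - l| ^ 2)⁻¹ := by
        rw [intervalIntegral.integral_add (i1.const_mul _) (hi.const_mul _),
          intervalIntegral.integral_const_mul, intervalIntegral.integral_const_mul]
    _ ≤ _ := by gcongr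

lemma norm_cauchy_integral_le_of_le {l y d R R' : ℝ} (hy : y ≠ 0) (hd0 : 0 < d)
    (ha : a ≤ l - d) (hb : l + d ≤ b) (hR' : 1 ≤ R') (hRR : R' ≤ R)
    (hA : ∀ t ∈ Set.Icc a b, HasDerivAt A (A' t) t) (hA' : ContinuousOn A' (Set.Icc a b))
    (hG : ∀ t ∈ Set.Icc a b, HasDerivAt G (G' t) t) (hG' : ContinuousOn G' (Set.Icc a b)) :
    ‖∫ t in a..b, A t * G t * ((t : ℂ) - (l + y * Complex.I))⁻¹‖
      ≤ (2 + 2 * (1 / (b - a) + 2) * d⁻¹ + 8 * (1 + d) * (1 / (b - a) + 3)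
        + 2 * Real.pi * (1 / (b - a) + 2))
        * (energy a b R A A' + energy a b R' G G') := by
  have hab : a < b := by linarith
  have hR : 1 ≤ R := hR'.trans hRR
  have hR0 : 0 < R := by linarith
  have hR'0 : 0 < R' := by linarith
  have hAc : ContinuousOn A (Set.Icc a b) := fun t ht => (hA t ht).continuousAt.continuousWithinAt
  have hGc : ContinuousOn G (Set.Icc a b) := fun t ht => (hG t ht).continuousAt.continuousWithinAt
  set S := 1 / (b - a) + 2 with hS
  have hS0 : 0 ≤ S := by
    have : 0 < b - a := sub_pos.2 hab
    positivity
  set P := energy a b R A A' with hP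
  set Q := energy a b R' G G' with hQ
  have hP0 : 0 ≤ P := energy_nonneg hab.le hR0.le
  have hQ0 : 0 ≤ Q := energy_nonneg hab.le hR'0.le
  set δ := d / R with hδ
  have hδ0 : 0 < δ := by positivity
  have hδd : δ ≤ d := div_le_self hd0.le hR
  have supA : ∀ t ∈ Set.Icc a b, ‖A t‖ ^ 2 ≤ S * P := fun t ht =>
    sq_norm_le_energy hab hR hA hA' ht
  have supG : ∀ t ∈ Set.Icc a b, ‖G t‖ ^ 2 ≤ S * Q := fun t ht =>
    sq_norm_le_energy hab hR' hG hG' ht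
  have hl : l ∈ Set.Icc a b := ⟨by linarith, by linarith⟩
  have hzim : ∀ t : ℝ, (t : ℂ) - (l + y * Complex.I) ≠ 0 := by
    intro t h
    have : ((t : ℂ) - (l + y * Complex.I)).im = -y := by simp
    rw [h] at this
    exact hy (by simpa using this.symm)
  have hinv : Continuous fun t : ℝ => ((t : ℂ) - (l + y * Complex.I))⁻¹ :=
    (Complex.continuous_ofReal.sub continuous_const).inv₀ hzim
  have hcont : ContinuousOn (fun t : ℝ => A t * G t * ((t : ℂ) - (l + y * Complex.I))⁻¹)
      (Set.Icc a b) := (hAc.mul hGc).mul hinv.continuousOn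
  have hii : ∀ u v, a ≤ u → u ≤ v → v ≤ b → IntervalIntegrable
      (fun t : ℝ => A t * G t * ((t : ℂ) - (l + y * Complex.I))⁻¹) volume u v :=
    fun u v h1 h2 h3 => (hcont.mono (Set.Icc_subset_Icc h1 h3)).intervalIntegrable_of_Icc h2
  have hsplit : ∫ t in a..b, A t * G t * ((t : ℂ) - (l + y * Complex.I))⁻¹
      = (∫ t in a..(l - δ), A t * G t * ((t : ℂ) - (l + y * Complex.I))⁻¹)
        + (∫ t in (l - δ)..(l + δ), A t * G t * ((t : ℂ) - (l + y * Complex.I))⁻¹)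
        + ∫ t in (l + δ)..b, A t * G t * ((t : ℂ) - (l + y * Complex.I))⁻¹ := by
    rw [intervalIntegral.integral_add_adjacent_intervals
        (hii a (l - δ) le_rfl (by linarith) (by linarith))
        (hii (l - δ) (l + δ) (by linarith) (by linarith) (by linarith)),
      intervalIntegral.integral_add_adjacent_intervals
        (hii a (l + δ) le_rfl (by linarith) (by linarith))
        (hii (l + δ) b (by linarith) (by linarith) le_rfl)]
  have hRδ : R⁻¹ * (S * Q) * δ⁻¹ = S * Q * d⁻¹ := by
    rw [hδ]; field_simp
  have far1 : ‖∫ t in a..(l - δ), A t * G t * ((t : ℂ) - (l + y * Complex.I))⁻¹‖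
      ≤ P + S * Q * d⁻¹ := by
    have h := integral_sub_sq_inv_left_le (a := a) (l := l) hδ0 (by linarith)
    have hsub : Set.Icc a (l - δ) ⊆ Set.Icc a b := Set.Icc_subset_Icc le_rfl (by linarith)
    refine (norm_integral_mul_inv_sub_le (by linarith) hR0 (hAc.mono hsub)
      (fun t ht => supG t (hsub ht)) (by positivity)
      (fun t ht => by have := ht.2; intro h; linarith) h.1 h.2).trans ?_
    rw [hRδ]
    gcongr
    refine le_trans ?_ (integral_sq_le_energy hab.le hR0)
    gcongr
    exact integral_norm_sq_mono hAc le_rfl (by linarith) (by linarith)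
  have far2 : ‖∫ t in (l + δ)..b, A t * G t * ((t : ℂ) - (l + y * Complex.I))⁻¹‖
      ≤ P + S * Q * d⁻¹ := by
    have h := integral_sub_sq_inv_right_le (b := b) (l := l) hδ0 (by linarith)
    have hsub : Set.Icc (l + δ) b ⊆ Set.Icc a b := Set.Icc_subset_Icc (by linarith) le_rfl
    refine (norm_integral_mul_inv_sub_le (by linarith) hR0 (hAc.mono hsub)
      (fun t ht => supG t (hsub ht)) (by positivity)
      (fun t ht => by have := ht.1; intro h; linarith) h.1 h.2).trans ?_
    rw [hRδ]
    gcongr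
    refine le_trans ?_ (integral_sq_le_energy hab.le hR0)
    gcongr
    exact integral_norm_sq_mono hAc (by linarith) (by linarith) le_rfl
  -- Hölder continuity at the singularity
  have holA : ∀ t ∈ Set.Icc a b, ‖A t - A l‖ ^ 2 ≤ |t - l| * (R * P) := by
    intro t ht
    have hE := integral_deriv_sq_le_energy (A := A) (A' := A') hab.le hR0
    rcases le_total l t with h | h
    · rw [abs_of_nonneg (sub_nonneg.2 h)]
      exact (sq_norm_sub_le hA hA' hl.1 h ht.2).trans
        (mul_le_mul_of_nonneg_left hE (sub_nonneg.2 h))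
    · rw [abs_of_nonpos (sub_nonpos.2 h), norm_sub_rev, neg_sub]
      exact (sq_norm_sub_le hA hA' ht.1 h hl.2).trans
        (mul_le_mul_of_nonneg_left hE (sub_nonneg.2 h))
  have holG : ∀ t ∈ Set.Icc a b, ‖G t - G l‖ ^ 2 ≤ |t - l| * (R * Q) := by
    intro t ht
    have hE : ∫ t in a..b, ‖G' t‖ ^ 2 ≤ R * Q :=
      (integral_deriv_sq_le_energy (A := G) (A' := G') hab.le hR'0).trans (by gcongr)
    rcases le_total l t with h | h
    · rw [abs_of_nonneg (sub_nonneg.2 h)]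
      exact (sq_norm_sub_le hG hG' hl.1 h ht.2).trans
        (mul_le_mul_of_nonneg_left hE (sub_nonneg.2 h))
    · rw [abs_of_nonpos (sub_nonpos.2 h), norm_sub_rev, neg_sub]
      exact (sq_norm_sub_le hG hG' ht.1 h hl.2).trans
        (mul_le_mul_of_nonneg_left hE (sub_nonneg.2 h))
  have prodsq : ∀ {x z p q : ℝ}, 0 ≤ x → 0 ≤ z → x ^ 2 ≤ p → z ^ 2 ≤ q →
      x * z ≤ Real.sqrt p * Real.sqrt q := by
    intro x z p q hx hz hp hq
    exact mul_le_mul (Real.le_sqrt_of_sq_le hp) (Real.le_sqrt_of_sq_le hq) hz (Real.sqrt_nonneg _)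
  have hsqPQ : Real.sqrt P * Real.sqrt Q ≤ P + Q := by
    have h1 := Real.sq_sqrt hP0
    have h2 := Real.sq_sqrt hQ0
    nlinarith [sq_nonneg (Real.sqrt P - Real.sqrt Q)]
  have hSle : Real.sqrt S ≤ 1 / (b - a) + 3 := by
    have h1 := Real.sq_sqrt hS0
    have h2 : S ≤ (1 / (b - a) + 3) ^ 2 := by
      have : 0 ≤ 1 / (b - a) := by
        have : 0 < b - a := sub_pos.2 hab
        positivity
      nlinarith
    exact Real.sqrt_le_iff.2 ⟨by linarith, h2⟩
  have hsub : Set.Icc (l - δ) (l + δ) ⊆ Set.Icc a b :=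
    Set.Icc_subset_Icc (by linarith) (by linarith)
  have near : ‖∫ t in (l - δ)..(l + δ), A t * G t * ((t : ℂ) - (l + y * Complex.I))⁻¹‖
      ≤ 8 * (1 + d) * (1 / (b - a) + 3) * (P + Q) + 2 * Real.pi * S * (P + Q) := by
    have e1 : ∫ t in (l - δ)..(l + δ), A t * G t * ((t : ℂ) - (l + y * Complex.I))⁻¹
        = (∫ t in (l - δ)..(l + δ), (A t * G t - A l * G l)
            * ((t : ℂ) - (l + y * Complex.I))⁻¹)
          + A l * G l * ∫ t in (l - δ)..(l + δ), ((t : ℂ) - (l + y * Complex.I))⁻¹ := by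
      rw [← intervalIntegral.integral_const_mul, ← intervalIntegral.integral_add]
      · refine intervalIntegral.integral_congr fun t _ => ?_
        ring
      · refine ContinuousOn.intervalIntegrable_of_Icc (by linarith) ?_
        exact (((hAc.mul hGc).mono hsub).sub continuousOn_const).mul hinv.continuousOn
      · exact (continuous_const.mul hinv).intervalIntegrable _ _
    rw [e1]
    refine (norm_add_le _ _).trans (add_le_add ?_ ?_)
    · have hK := integral_abs_rpow_neg_half (l := l) hδ0.le
      have hbound : ∀ t ∈ Set.Ioc (l - δ) (l + δ),
          ‖(A t * G t - A l * G l) * ((t : ℂ) - (l + y * Complex.I))⁻¹‖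
            ≤ (2 * Real.sqrt R * Real.sqrt S * (Real.sqrt P * Real.sqrt Q))
              * |t - l| ^ (-(1 / 2) : ℝ) := by
        intro t ht
        have ht' := hsub (Set.Ioc_subset_Icc_self ht)
        rcases eq_or_ne t l with rfl | hne
        · simp only [sub_self, zero_mul, norm_zero]
          positivity
        have hpos : 0 < |t - l| := abs_pos.2 (sub_ne_zero.2 hne)
        have h1 : ‖A t * G t - A l * G l‖
            ≤ 2 * (Real.sqrt R * Real.sqrt S * (Real.sqrt P * Real.sqrt Q)
              * Real.sqrt |t - l|) := by
          have e : A t * G t - A l * G l = (A t - A l) * G t + A l * (G t - G l) := by ring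
          rw [e]
          refine (norm_add_le _ _).trans ?_
          rw [norm_mul, norm_mul]
          have k1 := prodsq (norm_nonneg _) (norm_nonneg _) (holA t ht') (supG t ht')
          have k2 := prodsq (norm_nonneg _) (norm_nonneg _) (supA l hl) (holG t ht')
          rw [Real.sqrt_mul hpos.le, Real.sqrt_mul hR0.le, Real.sqrt_mul hS0] at k1 k2
          calc _ ≤ _ := add_le_add k1 k2
            _ = _ := by ring
        rw [norm_mul, norm_inv]
        have h2 : ‖(t : ℂ) - (l + y * Complex.I)‖⁻¹ ≤ |t - l|⁻¹ :=
          inv_anti₀ hpos (abs_sub_le_norm_sub t l y)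
        have h3 : Real.sqrt |t - l| * |t - l|⁻¹ = |t - l| ^ (-(1 / 2) : ℝ) := by
          rw [Real.sqrt_eq_rpow, ← Real.rpow_neg_one, ← Real.rpow_add hpos]
          norm_num
        rw [← h3]
        calc _ ≤ 2 * (Real.sqrt R * Real.sqrt S * (Real.sqrt P * Real.sqrt Q)
              * Real.sqrt |t - l|) * |t - l|⁻¹ := by gcongr
          _ = _ := by ring
      refine (intervalIntegral.norm_integral_le_of_norm_le (by linarith)
        (ae_of_all _ hbound) (hK.1.const_mul _)).trans ?_
      rw [intervalIntegral.integral_const_mul, hK.2]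
      have h4 : Real.sqrt R * Real.sqrt δ = Real.sqrt d := by
        rw [← Real.sqrt_mul hR0.le, hδ]
        congr 1
        field_simp
      have h5 : Real.sqrt d ≤ 1 + d := by
        refine Real.sqrt_le_iff.2 ⟨by linarith, by nlinarith⟩
      calc _ = 8 * (Real.sqrt R * Real.sqrt δ) * Real.sqrt S * (Real.sqrt P * Real.sqrt Q) := by
            ring
        _ ≤ _ := by rw [h4]; gcongr
    · rw [norm_mul, norm_mul]
      have k := prodsq (norm_nonneg _) (norm_nonneg _) (supA l hl) (supG l hl)
      rw [Real.sqrt_mul hS0, Real.sqrt_mul hS0] at k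
      have k' : ‖A l‖ * ‖G l‖ ≤ S * (P + Q) := by
        calc _ ≤ _ := k
          _ = (Real.sqrt S * Real.sqrt S) * (Real.sqrt P * Real.sqrt Q) := by ring
          _ ≤ S * (P + Q) := by rw [Real.mul_self_sqrt hS0]; gcongr
      calc _ ≤ (S * (P + Q)) * (2 * Real.pi) := by
            gcongr
            exact norm_integral_inv_sub_le hy
        _ = _ := by ring
  rw [hsplit]
  refine (norm_add₃_le).trans ?_
  have hd1 : 0 ≤ S * d⁻¹ * P := by positivity
  nlinarith [far1, far2, near]

lemma norm_cauchy_integral_le {l y d R R' : ℝ} (hy : y ≠ 0) (hd0 : 0 < d)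
    (ha : a ≤ l - d) (hb : l + d ≤ b) (hR : 1 ≤ R) (hR' : 1 ≤ R')
    (hA : ∀ t ∈ Set.Icc a b, HasDerivAt A (A' t) t) (hA' : ContinuousOn A' (Set.Icc a b))
    (hG : ∀ t ∈ Set.Icc a b, HasDerivAt G (G' t) t) (hG' : ContinuousOn G' (Set.Icc a b)) :
    ‖∫ t in a..b, A t * G t * ((t : ℂ) - (l + y * Complex.I))⁻¹‖
      ≤ (2 + 2 * (1 / (b - a) + 2) * d⁻¹ + 8 * (1 + d) * (1 / (b - a) + 3)
        + 2 * Real.pi * (1 / (b - a) + 2))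
        * (energy a b R A A' + energy a b R' G G') := by
  rcases le_total R' R with h | h
  · exact norm_cauchy_integral_le_of_le hy hd0 ha hb hR' h hA hA' hG hG'
  · have := norm_cauchy_integral_le_of_le hy hd0 ha hb hR h hG hG' hA hA'
    rw [add_comm (energy a b R' G G')] at this
    simpa only [mul_comm (G _)] using this

end Interval

/-! ### Boundary values of Cauchy integrals -/

/-- The open half plane `± Im z > 0`. -/
def openHalfPlane (σ : ℝ) : Set ℂ := {z | 0 < σ * z.im}

section Boundary

variable {σ a b : ℝ} {F F' : ℝ → ℂ}

/-- A primitive of `(t - z)⁻¹`, continuous up to the boundary of the half plane `± Im z > 0`. -/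
noncomputable def logKernel (σ t : ℝ) (z : ℂ) : ℂ := Complex.log (σ * Complex.I * (t - z))

lemma logKernel_arg (σ t : ℝ) (z : ℂ) :
    (σ * Complex.I * (t - z) : ℂ) = ⟨σ * z.im, σ * (t - z.re)⟩ := by
  apply Complex.ext <;> simp

lemma mem_slitPlane_of_mem_openHalfPlane {z : ℂ} (hz : z ∈ openHalfPlane σ) (t : ℝ) :
    (σ * Complex.I * (t - z) : ℂ) ∈ Complex.slitPlane := by
  rw [logKernel_arg]
  exact Or.inl hz

lemma ofReal_sub_ne_zero {z : ℂ} (hz : z ∈ openHalfPlane σ) (t : ℝ) : (t : ℂ) - z ≠ 0 := by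
  intro h
  have := mem_slitPlane_of_mem_openHalfPlane hz t
  rw [h, mul_zero] at this
  exact Complex.zero_notMem_slitPlane this

lemma hasDerivAt_logKernel (hσ : σ ≠ 0) {z : ℂ} (hz : z ∈ openHalfPlane σ) (t : ℝ) :
    HasDerivAt (fun t => logKernel σ t z) (((t : ℂ) - z)⁻¹) t := by
  have h1 : HasDerivAt (fun t : ℝ => (σ * Complex.I * ((t : ℂ) - z) : ℂ)) (σ * Complex.I * 1) t :=
    ((Complex.ofRealCLM.hasDerivAt (x := t)).sub_const _).const_mul _
  have h2 := h1.clog_real (mem_slitPlane_of_mem_openHalfPlane hz t)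
  have hne := ofReal_sub_ne_zero hz t
  have hσ' : (σ : ℂ) ≠ 0 := by exact_mod_cast hσ
  have e : (σ * Complex.I * 1 / (σ * Complex.I * ((t : ℂ) - z)) : ℂ) = ((t : ℂ) - z)⁻¹ := by
    have := Complex.I_ne_zero
    field_simp
  rw [e] at h2
  exact h2

lemma integral_cauchy_eq (hσ : σ ≠ 0) (hab : a ≤ b) {z : ℂ} (hz : z ∈ openHalfPlane σ)
    (hF : ∀ t ∈ Set.Icc a b, HasDerivAt F (F' t) t) (hF' : ContinuousOn F' (Set.Icc a b)) :
    ∫ t in a..b, F t * ((t : ℂ) - z)⁻¹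
      = F b * logKernel σ b z - F a * logKernel σ a z
        - ∫ τ : ℝ, (Set.Ioc a b).indicator F' (τ + z.re)
          * Complex.log (σ * Complex.I * (τ - z.im * Complex.I)) := by
  have hinv : Continuous fun t : ℝ => ((t : ℂ) - z)⁻¹ :=
    (Complex.continuous_ofReal.sub continuous_const).inv₀ (ofReal_sub_ne_zero hz)
  rw [intervalIntegral.integral_mul_deriv_eq_deriv_mul
    (fun t ht => hF t (by rwa [Set.uIcc_of_le hab] at ht))
    (fun t _ => hasDerivAt_logKernel hσ hz t)
    (hF'.intervalIntegrable_of_Icc hab) (hinv.intervalIntegrable _ _)]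
  congr 1
  rw [intervalIntegral.integral_of_le hab, ← integral_indicator measurableSet_Ioc,
    ← integral_add_right_eq_self _ z.re]
  congr 1
  ext τ
  have e : (σ * Complex.I * (τ - z.im * Complex.I) : ℂ)
      = σ * Complex.I * (((τ + z.re : ℝ) : ℂ) - z) := by
    congr 1
    apply Complex.ext <;> simp
  rw [e]
  by_cases h : τ + z.re ∈ Set.Ioc a b
  · simp [h, logKernel]
  · simp [h]

/-- An integrable majorant of the logarithmic kernel. -/
noncomputable def logMajorant (K : ℝ) (τ : ℝ) : ℝ :=
  (Set.Icc (-K) K).indicator (fun τ => |Real.log τ| + K + Real.pi) τ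

lemma integrable_logMajorant (K : ℝ) : Integrable (logMajorant K) := by
  unfold logMajorant
  rw [integrable_indicator_iff measurableSet_Icc]
  rcases le_total (-K) K with h | h
  · rw [← intervalIntegrable_iff_integrableOn_Icc_of_le h]
    have := (intervalIntegral.intervalIntegrable_log' (a := -K) (b := K)).norm
    simp only [Real.norm_eq_abs] at this
    exact (this.add (by simp)).add (by simp)
  · rcases h.eq_or_lt with h | h
    · rw [← h, Set.Icc_self]
      simp
    · rw [Set.Icc_eq_empty (not_le.2 h)]
      simp

lemma logMajorant_nonneg {K : ℝ} (hK : 0 ≤ K) (τ : ℝ) : 0 ≤ logMajorant K τ :=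
  Set.indicator_nonneg (fun τ _ => by have := Real.pi_pos; positivity) τ

lemma norm_log_le_logMajorant (hσ : |σ| = 1) (z₀ : ℂ) :
    ∃ K : ℝ, 0 ≤ K ∧ ∀ z : ℂ, ‖z - z₀‖ ≤ 1 → ∀ τ : ℝ, τ ≠ 0 → τ + z.re ∈ Set.Ioc a b →
      ‖Complex.log (σ * Complex.I * (τ - z.im * Complex.I))‖ ≤ logMajorant K τ := by
  refine ⟨|a| + |b| + 2 * ‖z₀‖ + 2, by positivity, fun z hz τ hτ hmem => ?_⟩
  set K := |a| + |b| + 2 * ‖z₀‖ + 2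
  have hz1 : ‖z‖ ≤ ‖z₀‖ + 1 := by
    have : ‖z‖ ≤ ‖z - z₀‖ + ‖z₀‖ := by simpa using norm_add_le (z - z₀) z₀
    linarith
  have hre := (Complex.abs_re_le_norm z).trans hz1
  have him := (Complex.abs_im_le_norm z).trans hz1
  have hτK : |τ| ≤ |a| + |b| + (‖z₀‖ + 1) := by
    rw [abs_le] at hre ⊢
    have h1 := neg_abs_le a
    have h2 := le_abs_self b
    have h3 := abs_nonneg a
    have h4 := abs_nonneg b
    have h5 := hmem.1
    have h6 := hmem.2
    constructor <;> linarith
  set w : ℂ := σ * Complex.I * (τ - z.im * Complex.I)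
  have hw : ‖w‖ = ‖(τ : ℂ) - z.im * Complex.I‖ := by
    simp only [w, norm_mul, Complex.norm_real, Complex.norm_I, Real.norm_eq_abs, hσ, one_mul]
  have hwK : ‖w‖ ≤ K := by
    rw [hw]
    refine (norm_sub_le _ _).trans ?_
    rw [norm_mul, Complex.norm_I, Complex.norm_real, Complex.norm_real, mul_one,
      Real.norm_eq_abs, Real.norm_eq_abs]
    linarith
  have hwτ : |τ| ≤ ‖w‖ := by
    rw [hw]
    have := Complex.abs_re_le_norm ((τ : ℂ) - z.im * Complex.I)
    simpa using this
  have hτ0 : 0 < |τ| := abs_pos.2 hτ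
  have hlog : |Real.log ‖w‖| ≤ |Real.log τ| + K := by
    rw [abs_le]
    constructor
    · have h1 : Real.log τ ≤ Real.log ‖w‖ := by
        rw [← Real.log_abs]
        exact Real.log_le_log hτ0 hwτ
      have h2 := neg_abs_le (Real.log τ)
      have : 0 ≤ K := by positivity
      linarith
    · have h1 : Real.log ‖w‖ ≤ ‖w‖ := Real.log_le_self (norm_nonneg _)
      have := abs_nonneg (Real.log τ)
      linarith
  have hmemK : τ ∈ Set.Icc (-K) K := abs_le.1 (by linarith [norm_nonneg z₀])
  unfold logMajorant
  rw [Set.indicator_of_mem hmemK]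
  have h1 : ‖Complex.log w‖ ≤ |Real.log ‖w‖| + |Complex.arg w| := by
    clear_value w
    unfold Complex.log
    refine (norm_add_le _ _).trans ?_
    rw [norm_mul, Complex.norm_I, mul_one, Complex.norm_real, Complex.norm_real]
    rfl
  linarith [Complex.abs_arg_le_pi w]

lemma continuousAt_logKernel (hσ : σ ≠ 0) {z₀ : ℂ} (hz₀ : 0 ≤ σ * z₀.im) {t : ℝ}
    (ht : z₀ ≠ t) : ContinuousAt (logKernel σ t) z₀ := by
  unfold logKernel
  refine ContinuousAt.clog (by fun_prop) ?_
  rw [logKernel_arg]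
  by_cases h : σ * z₀.im = 0
  · right
    change σ * (t - z₀.re) ≠ 0
    refine mul_ne_zero hσ fun h' => ht ?_
    apply Complex.ext
    · simp; linarith
    · simpa [hσ] using h
  · left
    exact lt_of_le_of_ne hz₀ (Ne.symm h)

lemma continuousAt_log_shift (hσ : σ ≠ 0) {y₀ τ : ℝ} (hτ : τ ≠ 0) :
    ContinuousAt (fun y : ℝ => Complex.log (σ * Complex.I * (τ - y * Complex.I))) y₀ := by
  refine ContinuousAt.clog (by fun_prop) ?_
  have e : (σ * Complex.I * (τ - y₀ * Complex.I) : ℂ) = ⟨σ * y₀, σ * τ⟩ := by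
    apply Complex.ext <;> simp
  rw [e]
  exact Or.inr (mul_ne_zero hσ hτ)

lemma continuousAt_indicator_Ioc (hF' : ContinuousOn F' (Set.Icc a b)) {t : ℝ} (hta : t ≠ a)
    (htb : t ≠ b) : ContinuousAt ((Set.Ioc a b).indicator F') t := by
  by_cases h : t ∈ Set.Icc a b
  · have h' : Set.Ioo a b ∈ 𝓝 t :=
      Ioo_mem_nhds (lt_of_le_of_ne h.1 (Ne.symm hta)) (lt_of_le_of_ne h.2 htb)
    refine (hF'.continuousAt (mem_of_superset h' Set.Ioo_subset_Icc_self)).congr ?_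
    filter_upwards [h'] with x hx
    rw [Set.indicator_of_mem (Set.Ioo_subset_Ioc_self hx)]
  · refine (continuousAt_const (y := (0 : ℂ))).congr ?_
    filter_upwards [isClosed_Icc.isOpen_compl.mem_nhds h] with x hx
    rw [Set.indicator_of_notMem fun hx' => hx (Set.Ioc_subset_Icc_self hx')]

lemma aestronglyMeasurable_shift (hF' : ContinuousOn F' (Set.Icc a b)) (z : ℂ) :
    AEStronglyMeasurable (fun τ : ℝ => (Set.Ioc a b).indicator F' (τ + z.re)
      * Complex.log (σ * Complex.I * (τ - z.im * Complex.I))) := by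
  refine AEStronglyMeasurable.mul ?_ ?_
  · have : AEStronglyMeasurable ((Set.Ioc a b).indicator F') :=
      (aestronglyMeasurable_indicator_iff measurableSet_Ioc).2
        ((hF'.mono Set.Ioc_subset_Icc_self).aestronglyMeasurable measurableSet_Ioc)
    exact this.comp_measurePreserving (measurePreserving_add_right volume z.re)
  · exact (Complex.measurable_log.comp (by fun_prop)).aestronglyMeasurable

lemma tendsto_cauchy_integral (hσ : |σ| = 1) (hab : a ≤ b) {z₀ : ℂ} (hz₀ : 0 ≤ σ * z₀.im)
    (hza : z₀ ≠ a) (hzb : z₀ ≠ b)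
    (hF : ∀ t ∈ Set.Icc a b, HasDerivAt F (F' t) t) (hF' : ContinuousOn F' (Set.Icc a b)) :
    ∃ l, Tendsto (fun z : ℂ => ∫ t in a..b, F t * ((t : ℂ) - z)⁻¹)
      (𝓝[openHalfPlane σ] z₀) (𝓝 l) := by
  have hσ0 : σ ≠ 0 := by rintro rfl; simp at hσ
  obtain ⟨B, hB⟩ := isCompact_Icc.exists_bound_of_continuousOn hF'
  obtain ⟨K, hK0, hK⟩ := norm_log_le_logMajorant (a := a) (b := b) hσ z₀
  have hball : ∀ᶠ z in 𝓝 z₀, ‖z - z₀‖ ≤ 1 := by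
    filter_upwards [Metric.closedBall_mem_nhds z₀ one_pos] with z hz
    simpa [dist_eq_norm] using hz
  have hlim : Tendsto (fun z : ℂ => ∫ τ : ℝ, (Set.Ioc a b).indicator F' (τ + z.re)
      * Complex.log (σ * Complex.I * (τ - z.im * Complex.I))) (𝓝 z₀)
      (𝓝 (∫ τ : ℝ, (Set.Ioc a b).indicator F' (τ + z₀.re)
      * Complex.log (σ * Complex.I * (τ - z₀.im * Complex.I)))) := by
    refine tendsto_integral_filter_of_dominated_convergence (fun τ => B * logMajorant K τ)
      (Eventually.of_forall fun z => aestronglyMeasurable_shift hF' z) ?_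
      ((integrable_logMajorant K).const_mul _) ?_
    · filter_upwards [hball] with z hz
      have h0 : ∀ᵐ τ : ℝ, τ ≠ 0 := by simp [ae_iff, measure_singleton]
      filter_upwards [h0] with τ hτ
      by_cases h : τ + z.re ∈ Set.Ioc a b
      · rw [Set.indicator_of_mem h, norm_mul]
        have hBτ := hB _ (Set.Ioc_subset_Icc_self h)
        have := norm_nonneg (F' (τ + z.re))
        exact mul_le_mul hBτ (hK z hz τ hτ h) (norm_nonneg _) (by linarith)
      · rw [Set.indicator_of_notMem h, zero_mul, norm_zero]
        by_cases hne : (Set.Icc a b).Nonempty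
        · obtain ⟨x, hx⟩ := hne
          exact mul_nonneg ((norm_nonneg _).trans (hB x hx)) (logMajorant_nonneg hK0 τ)
        · exact absurd ⟨a, le_rfl, hab⟩ hne
    · have h0 : ∀ᵐ τ : ℝ, τ ∉ ({0, a - z₀.re, b - z₀.re} : Set ℝ) :=
        measure_eq_zero_iff_ae_notMem.1 (Set.Finite.measure_zero (Set.toFinite _) _)
      filter_upwards [h0] with τ hτ
      simp only [Set.mem_insert_iff, Set.mem_singleton_iff, not_or] at hτ
      refine Tendsto.mul ?_ ?_
      · have hc : ContinuousAt ((Set.Ioc a b).indicator F') (τ + z₀.re) :=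
          continuousAt_indicator_Ioc hF' (fun h => hτ.2.1 (by linarith))
            (fun h => hτ.2.2 (by linarith))
        exact hc.tendsto.comp
          ((continuous_const.add Complex.continuous_re).tendsto z₀)
      · have hc := continuousAt_log_shift (y₀ := z₀.im) hσ0 hτ.1
        exact hc.tendsto.comp (Complex.continuous_im.tendsto z₀)
  have h1 := (((continuousAt_logKernel hσ0 hz₀ hzb).tendsto.const_mul (F b)).sub
    ((continuousAt_logKernel hσ0 hz₀ hza).tendsto.const_mul (F a))).sub hlim
  refine ⟨_, (h1.mono_left nhdsWithin_le_nhds).congr' ?_⟩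
  filter_upwards [self_mem_nhdsWithin] with z hz
  exact (integral_cauchy_eq hσ0 hab hz hF hF').symm

lemma norm_cauchy_integral_le_sup (hσ : |σ| = 1) (hab : a ≤ b) {z₀ : ℂ}
    (hz₀ : 0 ≤ σ * z₀.im) (hza : z₀ ≠ a) (hzb : z₀ ≠ b) :
    ∃ C : ℝ, ∀ᶠ z in 𝓝[openHalfPlane σ] z₀, ∀ (F F' : ℝ → ℂ) (B : ℝ),
      (∀ t ∈ Set.Icc a b, HasDerivAt F (F' t) t) → ContinuousOn F' (Set.Icc a b) →
      (∀ t ∈ Set.Icc a b, ‖F t‖ ≤ B) → (∀ t ∈ Set.Icc a b, ‖F' t‖ ≤ B) →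
      ‖∫ t in a..b, F t * ((t : ℂ) - z)⁻¹‖ ≤ C * B := by
  have hσ0 : σ ≠ 0 := by rintro rfl; simp at hσ
  obtain ⟨K, hK0, hK⟩ := norm_log_le_logMajorant (a := a) (b := b) hσ z₀
  have hball : ∀ᶠ z in 𝓝 z₀, ‖z - z₀‖ ≤ 1 := by
    filter_upwards [Metric.closedBall_mem_nhds z₀ one_pos] with z hz
    simpa [dist_eq_norm] using hz
  have hLa : ∀ᶠ z in 𝓝 z₀, ‖logKernel σ a z‖ < ‖logKernel σ a z₀‖ + 1 :=
    (continuousAt_logKernel hσ0 hz₀ hza).norm.eventually_lt continuousAt_const (by linarith)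
  have hLb : ∀ᶠ z in 𝓝 z₀, ‖logKernel σ b z‖ < ‖logKernel σ b z₀‖ + 1 :=
    (continuousAt_logKernel hσ0 hz₀ hzb).norm.eventually_lt continuousAt_const (by linarith)
  refine ⟨(‖logKernel σ b z₀‖ + 1) + (‖logKernel σ a z₀‖ + 1) + ∫ τ, logMajorant K τ, ?_⟩
  filter_upwards [self_mem_nhdsWithin, nhdsWithin_le_nhds hball, nhdsWithin_le_nhds hLa,
    nhdsWithin_le_nhds hLb] with z hz hzball hza' hzb' F F' B hF hF' hFB hFB'
  have hB0 : 0 ≤ B := (norm_nonneg _).trans (hFB a ⟨le_rfl, hab⟩)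
  rw [integral_cauchy_eq hσ0 hab hz hF hF']
  have h1 : ‖∫ τ : ℝ, (Set.Ioc a b).indicator F' (τ + z.re)
      * Complex.log (σ * Complex.I * (τ - z.im * Complex.I))‖ ≤ ∫ τ, B * logMajorant K τ := by
    refine norm_integral_le_of_norm_le ((integrable_logMajorant K).const_mul _) ?_
    have h0 : ∀ᵐ τ : ℝ, τ ≠ 0 := by simp [ae_iff, measure_singleton]
    filter_upwards [h0] with τ hτ
    by_cases h : τ + z.re ∈ Set.Ioc a b
    · rw [Set.indicator_of_mem h, norm_mul]
      exact mul_le_mul (hFB' _ (Set.Ioc_subset_Icc_self h)) (hK z hzball τ hτ h) (norm_nonneg _) hB0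
    · rw [Set.indicator_of_notMem h, zero_mul, norm_zero]
      exact mul_nonneg hB0 (logMajorant_nonneg hK0 τ)
  rw [integral_const_mul] at h1
  have h2 : ‖F b * logKernel σ b z‖ ≤ B * (‖logKernel σ b z₀‖ + 1) := by
    rw [norm_mul]
    exact mul_le_mul (hFB b ⟨hab, le_rfl⟩) hzb'.le (norm_nonneg _) hB0
  have h3 : ‖F a * logKernel σ a z‖ ≤ B * (‖logKernel σ a z₀‖ + 1) := by
    rw [norm_mul]
    exact mul_le_mul (hFB a ⟨le_rfl, hab⟩) hza'.le (norm_nonneg _) hB0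
  refine (norm_sub_le _ _).trans ((add_le_add_left (norm_sub_le _ _) _).trans ?_)
  linarith

end Boundary

/-! ### Polar coordinates adapted to `|ξ|^s` -/

/-- The density of Lebesgue measure in the coordinates `ξ = t^{1/s} ω`. -/
noncomputable def radialWeight (n : ℕ) (s t : ℝ) : ℝ :=
  (1 / s * t ^ (1 / s - 1)) * (t ^ (1 / s)) ^ (n - 1)

/-- The shell `{ξ : a < |ξ|^s ≤ b}`. -/
def shell (n : ℕ) (s a b : ℝ) : Set (E n) := {ξ | ‖ξ‖ ^ s ∈ Set.Ioc a b}

/-- The unit sphere. -/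
abbrev USphere (n : ℕ) : Type := Metric.sphere (0 : E n) 1

section Polar

variable {n : ℕ} {s : ℝ} {V : Type*} [NormedAddCommGroup V] [NormedSpace ℝ V]

lemma radialWeight_pos (hs : 0 < s) {t : ℝ} (ht : 0 < t) : 0 < radialWeight n s t := by
  unfold radialWeight; positivity

lemma nontrivial_euclidean (hn : 0 < n) : Nontrivial (E n) := by
  have : Nonempty (Fin n) := ⟨⟨0, hn⟩⟩
  infer_instance

lemma continuous_norm_rpow (hs : 0 < s) : Continuous fun ξ : E n => ‖ξ‖ ^ s :=
  continuous_norm.rpow_const fun _ => Or.inr hs.le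

lemma measurableSet_shell (hs : 0 < s) (a b : ℝ) : MeasurableSet (shell n s a b) :=
  (continuous_norm_rpow hs).measurable measurableSet_Ioc

lemma norm_rpow_smul (hs : 0 < s) {t : ℝ} (ht : 0 < t) (ω : USphere n) :
    ‖(t ^ (1 / s)) • (ω : E n)‖ ^ s = t := by
  have h1 : ‖(ω : E n)‖ = 1 := by simp
  rw [norm_smul, h1, mul_one, Real.norm_of_nonneg (by positivity), ← Real.rpow_mul ht.le,
    one_div_mul_cancel hs.ne', Real.rpow_one]

lemma smul_mem_shell_iff (hs : 0 < s) {a b t : ℝ} (ht : 0 < t) (ω : USphere n) :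
    (t ^ (1 / s)) • (ω : E n) ∈ shell n s a b ↔ t ∈ Set.Ioc a b := by
  rw [shell, Set.mem_ofPred_eq, norm_rpow_smul hs ht]

lemma shell_subset_closedBall (hs : 0 < s) {a b : ℝ} :
    shell n s a b ⊆ Metric.closedBall 0 (b ^ (1 / s)) := by
  intro ξ hξ
  rw [mem_closedBall_zero_iff]
  have h1 : (‖ξ‖ ^ s) ^ (1 / s) = ‖ξ‖ := by
    rw [← Real.rpow_mul (norm_nonneg _), mul_one_div_cancel hs.ne', Real.rpow_one]
  rw [← h1]
  exact Real.rpow_le_rpow (by positivity) hξ.2 (by positivity)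

lemma integral_polar (hn : 0 < n) (hs : 0 < s) {h : E n → V} (hh : Integrable h) :
    Integrable (fun ω : USphere n =>
        ∫ t in Set.Ioi (0 : ℝ), radialWeight n s t • h ((t ^ (1 / s)) • (ω : E n)))
        (volume : Measure (E n)).toSphere ∧
      ∫ ξ, h ξ = ∫ ω : USphere n,
        (∫ t in Set.Ioi (0 : ℝ), radialWeight n s t • h ((t ^ (1 / s)) • (ω : E n)))
        ∂(volume : Measure (E n)).toSphere := by
  have := nontrivial_euclidean hn
  have hdim : Module.finrank ℝ (E n) = n := finrank_euclideanSpace_fin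
  have mp := (volume : Measure (E n)).measurePreserving_homeomorphUnitSphereProd
  have memb := (homeomorphUnitSphereProd (E n)).measurableEmbedding
  rw [hdim] at mp
  set g : USphere n × Set.Ioi (0 : ℝ) → V := fun x => h ((x.2 : ℝ) • (x.1 : E n)) with hg
  have hcomp : g ∘ (homeomorphUnitSphereProd (E n)) = fun x : ({0}ᶜ : Set (E n)) => h x := by
    funext x
    have e := congrArg Subtype.val ((homeomorphUnitSphereProd (E n)).symm_apply_apply x)
    simp only [hg, Function.comp_apply]
    rw [← homeomorphUnitSphereProd_symm_apply_coe, e]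
  have hint : Integrable g ((volume : Measure (E n)).toSphere.prod (Measure.volumeIoiPow (n - 1))) := by
    rw [← mp.integrable_comp_emb memb, hcomp]
    exact (integrableOn_iff_comap_subtypeVal (measurableSet_singleton _).compl).1 hh.integrableOn
  have hinner : ∀ ω : USphere n, ∫ ρ : Set.Ioi (0 : ℝ), g (ω, ρ) ∂(Measure.volumeIoiPow (n - 1))
      = ∫ t in Set.Ioi (0 : ℝ), radialWeight n s t • h ((t ^ (1 / s)) • (ω : E n)) := by
    intro ω
    simp only [Measure.volumeIoiPow, ENNReal.ofReal, hg]
    rw [integral_withDensity_eq_integral_smul,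
      integral_subtype_comap measurableSet_Ioi
        fun a => Real.toNNReal (a ^ (n - 1)) • h (a • (ω : E n)),
      ← integral_comp_rpow_Ioi_of_pos (p := 1 / s) (by positivity)]
    · refine setIntegral_congr_fun measurableSet_Ioi fun t ht => ?_
      have ht : (0 : ℝ) < t := ht
      simp only [NNReal.smul_def]
      rw [Real.coe_toNNReal _ (by positivity), smul_smul]
      rfl
    · exact (measurable_subtype_coe.pow_const _).real_toNNReal
  constructor
  · have := hint.integral_prod_left
    simpa only [hinner] using this
  · calc ∫ ξ, h ξ = ∫ x : ({0}ᶜ : Set (E n)), h x ∂((volume : Measure (E n)).comap (↑)) := by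
          rw [integral_subtype_comap (measurableSet_singleton _).compl h,
            restrict_compl_singleton]
      _ = ∫ x, g x ∂((volume : Measure (E n)).toSphere.prod (Measure.volumeIoiPow (n - 1))) := by
          rw [← mp.integral_comp memb]
          congr 1
          exact hcomp.symm
      _ = _ := by
          rw [integral_prod _ hint]
          simp only [hinner]

lemma integral_shell (hn : 0 < n) (hs : 0 < s) {a b : ℝ} (ha : 0 < a) (hab : a ≤ b)
    {h : E n → V} (hh : IntegrableOn h (shell n s a b)) :
    Integrable (fun ω : USphere n =>
        ∫ t in a..b, radialWeight n s t • h ((t ^ (1 / s)) • (ω : E n)))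
        (volume : Measure (E n)).toSphere ∧
      ∫ ξ in shell n s a b, h ξ = ∫ ω : USphere n,
        (∫ t in a..b, radialWeight n s t • h ((t ^ (1 / s)) • (ω : E n)))
        ∂(volume : Measure (E n)).toSphere := by
  have hm := measurableSet_shell (n := n) hs a b
  have h1 := integral_polar hn hs ((integrable_indicator_iff hm).2 hh)
  have hin : ∀ ω : USphere n, ∫ t in Set.Ioi (0 : ℝ), radialWeight n s t •
      (shell n s a b).indicator h ((t ^ (1 / s)) • (ω : E n))
      = ∫ t in a..b, radialWeight n s t • h ((t ^ (1 / s)) • (ω : E n)) := by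
    intro ω
    have hsub : Set.Ioc a b ⊆ Set.Ioi 0 := fun t ht => ha.trans ht.1
    rw [intervalIntegral.integral_of_le hab, ← integral_indicator measurableSet_Ioc,
      ← integral_indicator measurableSet_Ioi]
    congr 1
    funext t
    by_cases ht : t ∈ Set.Ioi (0 : ℝ)
    · rw [Set.indicator_of_mem ht]
      by_cases htI : t ∈ Set.Ioc a b
      · have := (smul_mem_shell_iff hs ht ω).2 htI
        rw [Set.indicator_of_mem htI, Set.indicator_of_mem this]
      · have := (smul_mem_shell_iff hs ht ω).not.2 htI
        rw [Set.indicator_of_notMem htI, Set.indicator_of_notMem this, smul_zero]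
    · rw [Set.indicator_of_notMem ht, Set.indicator_of_notMem fun h' => ht (hsub h')]
  simp only [hin] at h1
  rw [integral_indicator hm] at h1
  exact h1

end Polar

/-! ### Restriction to rays -/

section Rays

variable {n : ℕ} {s a b : ℝ}

lemma Icc_subset_Ioi_zero (ha : 0 < a) : Set.Icc a b ⊆ Set.Ioi 0 := fun _ ht => ha.trans_le ht.1

lemma continuousOn_rpow_Ioi (q : ℝ) : ContinuousOn (fun t : ℝ => t ^ q) (Set.Ioi 0) :=
  fun _ ht => (Real.continuousAt_rpow_const _ _ (Or.inl (ne_of_gt ht))).continuousWithinAt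

lemma contDiffOn_radialWeight : ContDiffOn ℝ 1 (radialWeight n s) (Set.Ioi 0) := by
  unfold radialWeight
  have h : ∀ q : ℝ, ContDiffOn ℝ 1 (fun t : ℝ => t ^ q) (Set.Ioi 0) := fun q t ht =>
    (Real.contDiffAt_rpow_const_of_ne (ne_of_gt ht)).contDiffWithinAt
  exact (contDiffOn_const.mul (h _)).mul ((h _).pow _)

lemma hasDerivAt_radialWeight {t : ℝ} (ht : 0 < t) :
    HasDerivAt (radialWeight n s) (deriv (radialWeight n s) t) t :=
  ((contDiffOn_radialWeight.contDiffAt (Ioi_mem_nhds ht)).differentiableAt one_ne_zero).hasDerivAt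

lemma continuousOn_deriv_radialWeight :
    ContinuousOn (deriv (radialWeight n s)) (Set.Ioi 0) :=
  contDiffOn_radialWeight.continuousOn_deriv_of_isOpen isOpen_Ioi le_rfl

/-- The velocity of the ray `t ↦ t^{1/s} ω`. -/
noncomputable def rayVelocity (s t : ℝ) (ω : E n) : E n := (1 / s * t ^ (1 / s - 1)) • ω

lemma hasDerivAt_comp_ray {H : E n → ℂ} (hH : ContDiff ℝ 1 H) {t : ℝ} (ht : 0 < t) (ω : E n) :
    HasDerivAt (fun t : ℝ => H ((t ^ (1 / s)) • ω))
      (fderiv ℝ H ((t ^ (1 / s)) • ω) (rayVelocity s t ω)) t := by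
  have h1 : HasDerivAt (fun t : ℝ => (t ^ (1 / s)) • ω) (rayVelocity s t ω) t :=
    (Real.hasDerivAt_rpow_const (Or.inl ht.ne')).smul_const ω
  exact ((hH.differentiable one_ne_zero _).hasFDerivAt).comp_hasDerivAt t h1

lemma continuousOn_ray (ω : E n) :
    ContinuousOn (fun t : ℝ => (t ^ (1 / s)) • ω) (Set.Ioi 0) := by
  exact (continuousOn_rpow_Ioi _).smul continuousOn_const

lemma continuousOn_rayVelocity (ω : E n) :
    ContinuousOn (fun t : ℝ => rayVelocity s t ω) (Set.Ioi 0) := by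
  exact (continuousOn_const.mul (continuousOn_rpow_Ioi _)).smul continuousOn_const

lemma continuousOn_deriv_comp_ray {H : E n → ℂ} (hH : ContDiff ℝ 1 H) (ω : E n) :
    ContinuousOn (fun t : ℝ => fderiv ℝ H ((t ^ (1 / s)) • ω) (rayVelocity s t ω))
      (Set.Ioi 0) :=
  (((hH.continuous_fderiv one_ne_zero).comp_continuousOn (continuousOn_ray ω))).clm_apply
    (continuousOn_rayVelocity ω)

lemma exists_rayVelocity_le (ha : 0 < a) :
    ∃ v : ℝ, ∀ t ∈ Set.Icc a b, ∀ ω : USphere n, ‖rayVelocity s t (ω : E n)‖ ≤ v := by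
  have hc : ContinuousOn (fun t : ℝ => 1 / s * t ^ (1 / s - 1)) (Set.Icc a b) := by
    exact continuousOn_const.mul ((continuousOn_rpow_Ioi _).mono (Icc_subset_Ioi_zero ha))
  obtain ⟨v, hv⟩ := isCompact_Icc.exists_bound_of_continuousOn hc
  refine ⟨v, fun t ht ω => ?_⟩
  have h1 : ‖(ω : E n)‖ = 1 := by simp
  rw [rayVelocity, norm_smul, h1, mul_one]
  exact hv t ht

lemma exists_bound_on_rays (hs : 0 < s) (ha : 0 < a) {W : Type*} [NormedAddCommGroup W]
    {H : E n → W} (hH : Continuous H) :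
    ∃ M : ℝ, 0 ≤ M ∧ ∀ t ∈ Set.Icc a b, ∀ ω : USphere n, ‖H ((t ^ (1 / s)) • (ω : E n))‖ ≤ M := by
  obtain ⟨M, hM⟩ := (isCompact_closedBall (0 : E n) (b ^ (1 / s))).exists_bound_of_continuousOn
    hH.continuousOn
  refine ⟨max M 0, le_max_right _ _, fun t ht ω => (hM _ ?_).trans (le_max_left _ _)⟩
  have h1 : ‖(ω : E n)‖ = 1 := by simp
  have ht0 : 0 < t := ha.trans_le ht.1
  rw [mem_closedBall_zero_iff, norm_smul, h1, mul_one, Real.norm_of_nonneg (by positivity)]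
  exact Real.rpow_le_rpow ht0.le ht.2 (by positivity)

/-- The function `w(t) H(t^{1/s} ω)` and its derivative along a ray, with uniform bounds. -/
lemma exists_weighted_ray_bound (hs : 0 < s) (ha : 0 < a) {H : E n → ℂ} (hH : ContDiff ℝ 1 H) :
    ∃ B : ℝ, 0 ≤ B ∧ ∀ ω : USphere n, ∃ m' : ℝ → ℂ,
      (∀ t ∈ Set.Icc a b, HasDerivAt
        (fun t : ℝ => (radialWeight n s t : ℂ) * H ((t ^ (1 / s)) • (ω : E n))) (m' t) t) ∧
      ContinuousOn m' (Set.Icc a b) ∧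
      (∀ t ∈ Set.Icc a b, ‖(radialWeight n s t : ℂ) * H ((t ^ (1 / s)) • (ω : E n))‖ ≤ B) ∧
      ∀ t ∈ Set.Icc a b, ‖m' t‖ ≤ B := by
  have hsub := Icc_subset_Ioi_zero (b := b) ha
  obtain ⟨v, hv⟩ := exists_rayVelocity_le (n := n) (s := s) (b := b) ha
  obtain ⟨M, hM0, hM⟩ := exists_bound_on_rays (b := b) hs ha hH.continuous
  obtain ⟨D, hD0, hD⟩ := exists_bound_on_rays (b := b) hs ha (hH.continuous_fderiv one_ne_zero)
  obtain ⟨W, hW⟩ := isCompact_Icc.exists_bound_of_continuousOn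
    ((contDiffOn_radialWeight (n := n) (s := s)).continuousOn.mono hsub)
  obtain ⟨W', hW'⟩ := isCompact_Icc.exists_bound_of_continuousOn
    ((continuousOn_deriv_radialWeight (n := n) (s := s)).mono hsub)
  refine ⟨|W| * M + |W'| * M + |W| * (D * |v|), by positivity, fun ω => ⟨fun t =>
    ((deriv (radialWeight n s) t : ℝ) : ℂ) * H ((t ^ (1 / s)) • (ω : E n))
      + (radialWeight n s t : ℂ) * fderiv ℝ H ((t ^ (1 / s)) • (ω : E n))
        (rayVelocity s t (ω : E n)), fun t ht => ?_, ?_, fun t ht => ?_, fun t ht => ?_⟩⟩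
  · exact (hasDerivAt_radialWeight (hsub ht)).ofReal_comp.mul
      (hasDerivAt_comp_ray hH (hsub ht) _)
  · refine ContinuousOn.add (ContinuousOn.mul ?_ ?_) (ContinuousOn.mul ?_ ?_)
    · exact Complex.continuous_ofReal.comp_continuousOn (continuousOn_deriv_radialWeight.mono hsub)
    · exact hH.continuous.comp_continuousOn ((continuousOn_ray _).mono hsub)
    · exact Complex.continuous_ofReal.comp_continuousOn
        (contDiffOn_radialWeight.continuousOn.mono hsub)
    · exact (continuousOn_deriv_comp_ray hH _).mono hsub
  · rw [norm_mul, Complex.norm_real]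
    have h1 := (hW t ht).trans (le_abs_self W)
    have h2 := hM t ht ω
    have : ‖radialWeight n s t‖ * ‖H ((t ^ (1 / s)) • (ω : E n))‖ ≤ |W| * M := by gcongr
    have h3 : 0 ≤ |W'| * M + |W| * (D * |v|) := by positivity
    linarith
  · have h1 := (hW t ht).trans (le_abs_self W)
    have h2 := hM t ht ω
    have h3 := (hW' t ht).trans (le_abs_self W')
    have h4 := hD t ht ω
    have h5 := (hv t ht ω).trans (le_abs_self v)
    refine (norm_add_le _ _).trans ?_
    rw [norm_mul, norm_mul, Complex.norm_real, Complex.norm_real]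
    have h6 : ‖fderiv ℝ H ((t ^ (1 / s)) • (ω : E n)) (rayVelocity s t (ω : E n))‖ ≤ D * |v| :=
      (ContinuousLinearMap.le_opNorm _ _).trans (by gcongr)
    have h7 : ‖deriv (radialWeight n s) t‖ * ‖H ((t ^ (1 / s)) • (ω : E n))‖ ≤ |W'| * M := by gcongr
    have h8 : ‖radialWeight n s t‖ * ‖fderiv ℝ H ((t ^ (1 / s)) • (ω : E n))
        (rayVelocity s t (ω : E n))‖ ≤ |W| * (D * |v|) := by gcongr
    have h9 : 0 ≤ |W| * M := by positivity
    linarith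

end Rays

/-! ### Resolvent forms on a shell -/

section Shell

variable {n : ℕ} {s a b : ℝ}

lemma continuous_resolvent_factor (hs : 0 < s) {z : ℂ} (hz : z.im ≠ 0) :
    Continuous fun ξ : E n => (((‖ξ‖ ^ s : ℝ) : ℂ) - z)⁻¹ := by
  refine ((Complex.continuous_ofReal.comp (continuous_norm_rpow hs)).sub
    continuous_const).inv₀ fun ξ h => hz ?_
  have : (((‖ξ‖ ^ s : ℝ) : ℂ) - z).im = -z.im := by simp
  have h' : ((‖ξ‖ ^ s : ℝ) : ℂ) - z = 0 := h
  rw [h'] at this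
  simpa using this.symm

lemma integrableOn_shell (hs : 0 < s) {V : Type*} [NormedAddCommGroup V] {h : E n → V}
    (hh : Continuous h) : IntegrableOn h (shell n s a b) :=
  (hh.continuousOn.integrableOn_compact (isCompact_closedBall (0 : E n) (b ^ (1 / s)))).mono_set
    (shell_subset_closedBall hs)

lemma integral_shell_resolvent (hn : 0 < n) (hs : 0 < s) (ha : 0 < a) (hab : a ≤ b)
    {H : E n → ℂ} (hH : Continuous H) {z : ℂ} (hz : z.im ≠ 0) :
    Integrable (fun ω : USphere n => ∫ t in a..b,
        (radialWeight n s t : ℂ) * H ((t ^ (1 / s)) • (ω : E n)) * ((t : ℂ) - z)⁻¹)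
        (volume : Measure (E n)).toSphere ∧
      ∫ ξ in shell n s a b, H ξ * (((‖ξ‖ ^ s : ℝ) : ℂ) - z)⁻¹ = ∫ ω : USphere n, (∫ t in a..b,
        (radialWeight n s t : ℂ) * H ((t ^ (1 / s)) • (ω : E n)) * ((t : ℂ) - z)⁻¹)
        ∂(volume : Measure (E n)).toSphere := by
  have h1 := integral_shell hn hs ha hab (h := fun ξ => H ξ * (((‖ξ‖ ^ s : ℝ) : ℂ) - z)⁻¹)
    (integrableOn_shell hs (hH.mul (continuous_resolvent_factor hs hz)))
  have hin : ∀ ω : USphere n, (∫ t in a..b, radialWeight n s t •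
      (H ((t ^ (1 / s)) • (ω : E n)) * (((‖(t ^ (1 / s)) • (ω : E n)‖ ^ s : ℝ) : ℂ) - z)⁻¹))
      = ∫ t in a..b,
        (radialWeight n s t : ℂ) * H ((t ^ (1 / s)) • (ω : E n)) * ((t : ℂ) - z)⁻¹ := by
    intro ω
    refine intervalIntegral.integral_congr fun t ht => ?_
    rw [Set.uIcc_of_le hab] at ht
    rw [norm_rpow_smul hs (ha.trans_le ht.1), Complex.real_smul, mul_assoc]
  simpa only [hin] using h1

lemma im_ne_zero_of_mem {σ : ℝ} {z : ℂ} (hz : z ∈ openHalfPlane σ) : z.im ≠ 0 := by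
  intro h
  have : 0 < σ * z.im := hz
  rw [h, mul_zero] at this
  exact lt_irrefl _ this

lemma tendsto_shell_integral (hn : 0 < n) (hs : 0 < s) {σ : ℝ} (hσ : |σ| = 1) (ha : 0 < a)
    (hab : a ≤ b) {z₀ : ℂ} (hz₀ : 0 ≤ σ * z₀.im) (hza : z₀ ≠ a) (hzb : z₀ ≠ b)
    {H : E n → ℂ} (hH : ContDiff ℝ 1 H) :
    ∃ l, Tendsto (fun z : ℂ => ∫ ξ in shell n s a b, H ξ * (((‖ξ‖ ^ s : ℝ) : ℂ) - z)⁻¹)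
      (𝓝[openHalfPlane σ] z₀) (𝓝 l) := by
  obtain ⟨B, hB0, hB⟩ := exists_weighted_ray_bound (b := b) hs ha hH
  choose m' hm' using hB
  obtain ⟨C, hC⟩ := norm_cauchy_integral_le_sup hσ hab hz₀ hza hzb
  have hlim := fun ω : USphere n =>
    tendsto_cauchy_integral hσ hab hz₀ hza hzb (hm' ω).1 (hm' ω).2.1
  choose l hl using hlim
  refine ⟨∫ ω, l ω ∂(volume : Measure (E n)).toSphere, ?_⟩
  have key : Tendsto (fun z : ℂ => ∫ ω : USphere n, (∫ t in a..b,
        (radialWeight n s t : ℂ) * H ((t ^ (1 / s)) • (ω : E n)) * ((t : ℂ) - z)⁻¹)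
        ∂(volume : Measure (E n)).toSphere) (𝓝[openHalfPlane σ] z₀)
        (𝓝 (∫ ω, l ω ∂(volume : Measure (E n)).toSphere)) := by
    refine tendsto_integral_filter_of_dominated_convergence (fun _ => C * B) ?_ ?_
      (integrable_const _) (ae_of_all _ hl)
    · filter_upwards [self_mem_nhdsWithin] with z hz
      exact (integral_shell_resolvent hn hs ha hab hH.continuous
        (im_ne_zero_of_mem hz)).1.aestronglyMeasurable
    · filter_upwards [hC] with z hz
      exact ae_of_all _ fun ω => hz _ _ B (hm' ω).1 (hm' ω).2.1 (hm' ω).2.2.1 (hm' ω).2.2.2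
  refine key.congr' ?_
  filter_upwards [self_mem_nhdsWithin] with z hz
  exact (integral_shell_resolvent hn hs ha hab hH.continuous (im_ne_zero_of_mem hz)).2.symm

/-- A `C¹` function which is square integrable together with its gradient. -/
structure IsH1 (φ : E n → ℂ) : Prop where
  contDiff : ContDiff ℝ 1 φ
  integrable_sq : Integrable fun ξ => ‖φ ξ‖ ^ 2
  integrable_grad_sq : Integrable fun ξ => ‖fderiv ℝ φ ξ‖ ^ 2

/-- The weighted energy `R ∫ |φ|² + R⁻¹ ∫ |∇φ|²`. -/
noncomputable def gradEnergy (R : ℝ) (φ : E n → ℂ) : ℝ :=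
  R * (∫ ξ, ‖φ ξ‖ ^ 2) + R⁻¹ * ∫ ξ, ‖fderiv ℝ φ ξ‖ ^ 2

/-- The density of `gradEnergy`. -/
noncomputable def energyDensity (R : ℝ) (φ : E n → ℂ) (ξ : E n) : ℝ :=
  R * ‖φ ξ‖ ^ 2 + R⁻¹ * ‖fderiv ℝ φ ξ‖ ^ 2

lemma IsH1.integrable_energyDensity {φ : E n → ℂ} (hφ : IsH1 φ) (R : ℝ) :
    Integrable (energyDensity R φ) :=
  (hφ.integrable_sq.const_mul _).add (hφ.integrable_grad_sq.const_mul _)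

lemma IsH1.continuous_energyDensity {φ : E n → ℂ} (hφ : IsH1 φ) (R : ℝ) :
    Continuous (energyDensity R φ) :=
  (continuous_const.mul (hφ.contDiff.continuous.norm.pow 2)).add
    (continuous_const.mul ((hφ.contDiff.continuous_fderiv one_ne_zero).norm.pow 2))

lemma IsH1.integral_energyDensity {φ : E n → ℂ} (hφ : IsH1 φ) (R : ℝ) :
    ∫ ξ, energyDensity R φ ξ = gradEnergy R φ := by
  unfold energyDensity gradEnergy
  rw [integral_add (hφ.integrable_sq.const_mul _) (hφ.integrable_grad_sq.const_mul _),
    integral_const_mul, integral_const_mul]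

lemma energyDensity_nonneg {R : ℝ} (hR : 0 ≤ R) (φ : E n → ℂ) (ξ : E n) :
    0 ≤ energyDensity R φ ξ := by
  unfold energyDensity; positivity

lemma gradEnergy_nonneg {R : ℝ} (hR : 0 ≤ R) (φ : E n → ℂ) : 0 ≤ gradEnergy R φ := by
  unfold gradEnergy
  have h1 : 0 ≤ ∫ ξ, ‖φ ξ‖ ^ 2 := integral_nonneg fun _ => by positivity
  have h2 : 0 ≤ ∫ ξ, ‖fderiv ℝ φ ξ‖ ^ 2 := integral_nonneg fun _ => by positivity
  positivity

lemma integral_sq_le_gradEnergy {R : ℝ} (hR : 1 ≤ R) (φ : E n → ℂ) :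
    ∫ ξ, ‖φ ξ‖ ^ 2 ≤ gradEnergy R φ := by
  have h1 : 0 ≤ ∫ ξ, ‖φ ξ‖ ^ 2 := integral_nonneg fun _ => by positivity
  have h2 : 0 ≤ ∫ ξ, ‖fderiv ℝ φ ξ‖ ^ 2 := integral_nonneg fun _ => by positivity
  have h3 : 0 ≤ R⁻¹ * ∫ ξ, ‖fderiv ℝ φ ξ‖ ^ 2 := mul_nonneg (by positivity) h2
  unfold gradEnergy
  nlinarith

/-- The energy on a ray of a function with `C¹` amplitude is controlled by the energy density. -/
lemma energy_ray_le (hs : 0 < s) (ha : 0 < a) (hab : a ≤ b) (c : ℝ) (hc : 0 ≤ c) :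
    ∃ C : ℝ, 0 ≤ C ∧ ∀ (φ : E n → ℂ) (R : ℝ) (ω : USphere n) (m m' : ℝ → ℂ), IsH1 φ → 1 ≤ R →
      (∀ t ∈ Set.Icc a b, HasDerivAt m (m' t) t) → ContinuousOn m' (Set.Icc a b) →
      (∀ t ∈ Set.Icc a b, ‖m t‖ ≤ c) → (∀ t ∈ Set.Icc a b, ‖m' t‖ ≤ c) →
      energy a b R (fun t => m t * φ ((t ^ (1 / s)) • (ω : E n)))
        (fun t => m' t * φ ((t ^ (1 / s)) • (ω : E n))
          + m t * fderiv ℝ φ ((t ^ (1 / s)) • (ω : E n)) (rayVelocity s t (ω : E n)))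
        ≤ C * ∫ t in a..b, radialWeight n s t • energyDensity R φ ((t ^ (1 / s)) • (ω : E n)) := by
  have hsub := Icc_subset_Ioi_zero (b := b) ha
  obtain ⟨v, hv⟩ := exists_rayVelocity_le (n := n) (s := s) (b := b) ha
  obtain ⟨t₀, ht₀, hmin⟩ := isCompact_Icc.exists_isMinOn (Set.nonempty_Icc.2 hab)
    ((contDiffOn_radialWeight (n := n) (s := s)).continuousOn.mono hsub)
  set W₀ := radialWeight n s t₀ with hW₀
  have hW₀pos : 0 < W₀ := radialWeight_pos hs (hsub ht₀)
  have hWmin : ∀ t ∈ Set.Icc a b, W₀ ≤ radialWeight n s t := fun t ht => hmin ht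
  set D := c ^ 2 + 2 * c ^ 2 + 2 * (c * |v|) ^ 2 with hD
  refine ⟨D / W₀, by positivity, fun φ R ω m m' hφ hR hm hm' hmc hmc' => ?_⟩
  have hR0 : 0 < R := by linarith
  have hRinv : R⁻¹ ≤ R := (inv_le_one_of_one_le₀ hR).trans hR
  have hmcont : ContinuousOn m (Set.Icc a b) :=
    fun t ht => (hm t ht).continuousAt.continuousWithinAt
  have hφray : ContinuousOn (fun t : ℝ => φ ((t ^ (1 / s)) • (ω : E n))) (Set.Icc a b) :=
    hφ.contDiff.continuous.comp_continuousOn ((continuousOn_ray _).mono hsub)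
  have hdray := (continuousOn_deriv_comp_ray (s := s) hφ.contDiff (ω : E n)).mono hsub
  have hA : ContinuousOn (fun t => m t * φ ((t ^ (1 / s)) • (ω : E n))) (Set.Icc a b) :=
    hmcont.mul hφray
  have hA' : ContinuousOn (fun t => m' t * φ ((t ^ (1 / s)) • (ω : E n))
          + m t * fderiv ℝ φ ((t ^ (1 / s)) • (ω : E n)) (rayVelocity s t (ω : E n)))
      (Set.Icc a b) := (hm'.mul hφray).add (hmcont.mul hdray)
  have i1 : IntervalIntegrable (fun t => R * ‖m t * φ ((t ^ (1 / s)) • (ω : E n))‖ ^ 2)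
      volume a b := ((hA.norm.pow 2).intervalIntegrable_of_Icc (μ := volume) hab).const_mul R
  have i2 : IntervalIntegrable (fun t => R⁻¹ * ‖m' t * φ ((t ^ (1 / s)) • (ω : E n))
          + m t * fderiv ℝ φ ((t ^ (1 / s)) • (ω : E n)) (rayVelocity s t (ω : E n))‖ ^ 2)
      volume a b := ((hA'.norm.pow 2).intervalIntegrable_of_Icc (μ := volume) hab).const_mul R⁻¹
  have i3 : IntervalIntegrable (fun t => radialWeight n s t •
      energyDensity R φ ((t ^ (1 / s)) • (ω : E n))) volume a b :=
    ((contDiffOn_radialWeight.continuousOn.mono hsub).smul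
      ((hφ.continuous_energyDensity R).comp_continuousOn
        ((continuousOn_ray _).mono hsub))).intervalIntegrable_of_Icc hab
  unfold energy
  rw [← intervalIntegral.integral_const_mul, ← intervalIntegral.integral_const_mul,
    ← intervalIntegral.integral_const_mul, ← intervalIntegral.integral_add i1 i2]
  refine intervalIntegral.integral_mono_on hab (i1.add i2) (i3.const_mul _) fun t ht => ?_
  set x := ‖φ ((t ^ (1 / s)) • (ω : E n))‖ with hx
  set y := ‖fderiv ℝ φ ((t ^ (1 / s)) • (ω : E n))‖ with hy
  have hx0 : 0 ≤ x := norm_nonneg _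
  have hy0 : 0 ≤ y := norm_nonneg _
  have b1 : ‖m t * φ ((t ^ (1 / s)) • (ω : E n))‖ ≤ c * x := by
    rw [norm_mul]; exact mul_le_mul_of_nonneg_right (hmc t ht) hx0
  have b2 : ‖m' t * φ ((t ^ (1 / s)) • (ω : E n))
          + m t * fderiv ℝ φ ((t ^ (1 / s)) • (ω : E n)) (rayVelocity s t (ω : E n))‖
      ≤ c * x + (c * |v|) * y := by
    refine (norm_add_le _ _).trans ?_
    rw [norm_mul, norm_mul]
    have h1 : ‖m' t‖ * x ≤ c * x := mul_le_mul_of_nonneg_right (hmc' t ht) hx0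
    have h2 : ‖fderiv ℝ φ ((t ^ (1 / s)) • (ω : E n)) (rayVelocity s t (ω : E n))‖ ≤ y * |v| :=
      (ContinuousLinearMap.le_opNorm _ _).trans
        (mul_le_mul_of_nonneg_left ((hv t ht ω).trans (le_abs_self v)) hy0)
    have h3 : ‖m t‖ * ‖fderiv ℝ φ ((t ^ (1 / s)) • (ω : E n)) (rayVelocity s t (ω : E n))‖
        ≤ c * (y * |v|) := mul_le_mul (hmc t ht) h2 (norm_nonneg _) hc
    linarith
  have b1' : ‖m t * φ ((t ^ (1 / s)) • (ω : E n))‖ ^ 2 ≤ c ^ 2 * x ^ 2 := by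
    rw [← mul_pow]; gcongr
  have b2' : ‖m' t * φ ((t ^ (1 / s)) • (ω : E n))
          + m t * fderiv ℝ φ ((t ^ (1 / s)) • (ω : E n)) (rayVelocity s t (ω : E n))‖ ^ 2
      ≤ 2 * c ^ 2 * x ^ 2 + 2 * (c * |v|) ^ 2 * y ^ 2 := by
    calc _ ≤ (c * x + (c * |v|) * y) ^ 2 := by gcongr
      _ ≤ _ := by nlinarith [sq_nonneg (c * x - (c * |v|) * y)]
  have hED : energyDensity R φ ((t ^ (1 / s)) • (ω : E n)) = R * x ^ 2 + R⁻¹ * y ^ 2 := rfl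
  have hstep : R * ‖m t * φ ((t ^ (1 / s)) • (ω : E n))‖ ^ 2
      + R⁻¹ * ‖m' t * φ ((t ^ (1 / s)) • (ω : E n))
          + m t * fderiv ℝ φ ((t ^ (1 / s)) • (ω : E n)) (rayVelocity s t (ω : E n))‖ ^ 2
      ≤ D * (R * x ^ 2 + R⁻¹ * y ^ 2) := by
    have e1 : R * ‖m t * φ ((t ^ (1 / s)) • (ω : E n))‖ ^ 2 ≤ R * (c ^ 2 * x ^ 2) := by gcongr
    have e2 : R⁻¹ * ‖m' t * φ ((t ^ (1 / s)) • (ω : E n))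
          + m t * fderiv ℝ φ ((t ^ (1 / s)) • (ω : E n)) (rayVelocity s t (ω : E n))‖ ^ 2
        ≤ R⁻¹ * (2 * c ^ 2 * x ^ 2 + 2 * (c * |v|) ^ 2 * y ^ 2) := by gcongr
    have e3 : R⁻¹ * (2 * c ^ 2 * x ^ 2) ≤ R * (2 * c ^ 2 * x ^ 2) := by gcongr
    have e4 : 0 ≤ R * (2 * (c * |v|) ^ 2 * x ^ 2) := by positivity
    have e5 : 0 ≤ R⁻¹ * ((c ^ 2 + 2 * c ^ 2) * y ^ 2) := by positivity
    rw [hD]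
    nlinarith
  refine hstep.trans ?_
  rw [hED, smul_eq_mul]
  have hED0 : 0 ≤ R * x ^ 2 + R⁻¹ * y ^ 2 := by positivity
  calc D * (R * x ^ 2 + R⁻¹ * y ^ 2) = D / W₀ * (W₀ * (R * x ^ 2 + R⁻¹ * y ^ 2)) := by
        field_simp
    _ ≤ _ := by
        have := hWmin t ht
        gcongr

/-- The resolvent form on a shell around the singular sphere. -/
lemma norm_shell_integral_le (hn : 0 < n) (hs : 0 < s) (ha : 0 < a) (hab : a < b) {d : ℝ}
    (hd : 0 < d) {ρ : E n → ℂ} (hρ : ContDiff ℝ 1 ρ) :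
    ∃ C : ℝ, 0 ≤ C ∧ ∀ z : ℂ, z.im ≠ 0 → a ≤ z.re - d → z.re + d ≤ b →
      ∀ (φ γ : E n → ℂ) (R R' : ℝ), IsH1 φ → IsH1 γ → 1 ≤ R → 1 ≤ R' →
      ‖∫ ξ in shell n s a b, ρ ξ * φ ξ * γ ξ * (((‖ξ‖ ^ s : ℝ) : ℂ) - z)⁻¹‖
        ≤ C * (gradEnergy R φ + gradEnergy R' γ) := by
  have hsub := Icc_subset_Ioi_zero (b := b) ha
  obtain ⟨B, hB0, hB⟩ := exists_weighted_ray_bound (b := b) hs ha hρ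
  choose m' hm' using hB
  obtain ⟨C₁, hC₁0, hC₁⟩ := energy_ray_le (n := n) hs ha hab.le B hB0
  obtain ⟨C₂, hC₂0, hC₂⟩ := energy_ray_le (n := n) hs ha hab.le 1 zero_le_one
  set C₀ := 2 + 2 * (1 / (b - a) + 2) * d⁻¹ + 8 * (1 + d) * (1 / (b - a) + 3)
        + 2 * Real.pi * (1 / (b - a) + 2) with hC₀
  have hC₀0 : 0 ≤ C₀ := by
    have h1 : 0 < b - a := sub_pos.2 hab
    have h2 := Real.pi_pos
    positivity
  refine ⟨C₀ * (C₁ + C₂), by positivity, fun z hz hza hzb φ γ R R' hφ hγ hR hR' => ?_⟩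
  have hR0 : 0 ≤ R := by linarith
  have hR'0 : 0 ≤ R' := by linarith
  have hHc : Continuous fun ξ => ρ ξ * φ ξ * γ ξ :=
    (hρ.continuous.mul hφ.contDiff.continuous).mul hγ.contDiff.continuous
  have hpol := integral_shell_resolvent hn hs ha hab.le hHc hz
  have hkφ := integral_shell hn hs ha hab.le
    (integrableOn_shell (a := a) (b := b) hs (hφ.continuous_energyDensity R))
  have hkγ := integral_shell hn hs ha hab.le
    (integrableOn_shell (a := a) (b := b) hs (hγ.continuous_energyDensity R'))
  rw [hpol.2]
  have hray : ∀ ω : USphere n, ‖∫ t in a..b, (radialWeight n s t : ℂ)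
      * (ρ ((t ^ (1 / s)) • (ω : E n)) * φ ((t ^ (1 / s)) • (ω : E n))
        * γ ((t ^ (1 / s)) • (ω : E n))) * ((t : ℂ) - z)⁻¹‖
      ≤ C₀ * (C₁ * (∫ t in a..b, radialWeight n s t •
            energyDensity R φ ((t ^ (1 / s)) • (ω : E n)))
          + C₂ * ∫ t in a..b, radialWeight n s t •
            energyDensity R' γ ((t ^ (1 / s)) • (ω : E n))) := by
    intro ω
    obtain ⟨k1, k2, k3, k4⟩ := hm' ω
    have e1 := hC₁ φ R ω _ _ hφ hR k1 k2 k3 k4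
    have e2 := hC₂ γ R' ω (fun _ => 1) (fun _ => 0) hγ hR' (fun t _ => hasDerivAt_const t 1)
      continuousOn_const (by simp) (by simp)
    have hmcont : ContinuousOn (fun t : ℝ =>
        (radialWeight n s t : ℂ) * ρ ((t ^ (1 / s)) • (ω : E n))) (Set.Icc a b) :=
      fun t ht => (k1 t ht).continuousAt.continuousWithinAt
    have hφray : ContinuousOn (fun t : ℝ => φ ((t ^ (1 / s)) • (ω : E n))) (Set.Icc a b) :=
      hφ.contDiff.continuous.comp_continuousOn ((continuousOn_ray _).mono hsub)
    have hγray : ContinuousOn (fun t : ℝ => γ ((t ^ (1 / s)) • (ω : E n))) (Set.Icc a b) :=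
      hγ.contDiff.continuous.comp_continuousOn ((continuousOn_ray _).mono hsub)
    have main := norm_cauchy_integral_le (l := z.re) (y := z.im) (d := d) hz hd hza hzb hR hR'
      (fun t ht => (k1 t ht).mul (hasDerivAt_comp_ray (s := s) hφ.contDiff (hsub ht) (ω : E n)))
      ((k2.mul hφray).add (hmcont.mul
        ((continuousOn_deriv_comp_ray (s := s) hφ.contDiff (ω : E n)).mono hsub)))
      (fun t ht => (hasDerivAt_const t (1 : ℂ)).mul
        (hasDerivAt_comp_ray (s := s) hγ.contDiff (hsub ht) (ω : E n)))
      ((continuousOn_const.mul hγray).add (continuousOn_const.mul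
        ((continuousOn_deriv_comp_ray (s := s) hγ.contDiff (ω : E n)).mono hsub)))
    have hzeq : ((z.re : ℂ) + z.im * Complex.I) = z := Complex.re_add_im z
    rw [hzeq] at main
    have hcongr : ∫ t in a..b, (radialWeight n s t : ℂ)
        * (ρ ((t ^ (1 / s)) • (ω : E n)) * φ ((t ^ (1 / s)) • (ω : E n))
          * γ ((t ^ (1 / s)) • (ω : E n))) * ((t : ℂ) - z)⁻¹
        = ∫ t in a..b, ((radialWeight n s t : ℂ) * ρ ((t ^ (1 / s)) • (ω : E n))
          * φ ((t ^ (1 / s)) • (ω : E n))) * (1 * γ ((t ^ (1 / s)) • (ω : E n)))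
          * ((t : ℂ) - z)⁻¹ :=
      intervalIntegral.integral_congr fun t _ => by ring
    rw [hcongr]
    refine main.trans ?_
    rw [← hC₀]
    exact mul_le_mul_of_nonneg_left (add_le_add e1 e2) hC₀0
  refine (norm_integral_le_of_norm_le (((hkφ.1.const_mul C₁).add
    (hkγ.1.const_mul C₂)).const_mul C₀) (ae_of_all _ hray)).trans ?_
  rw [integral_const_mul, integral_add' (hkφ.1.const_mul C₁) (hkγ.1.const_mul C₂),
    integral_const_mul, integral_const_mul, ← hkφ.2, ← hkγ.2]
  have f1 : ∫ ξ in shell n s a b, energyDensity R φ ξ ≤ gradEnergy R φ := by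
    rw [← hφ.integral_energyDensity]
    exact setIntegral_le_integral (hφ.integrable_energyDensity R)
      (ae_of_all _ (energyDensity_nonneg hR0 φ))
  have f2 : ∫ ξ in shell n s a b, energyDensity R' γ ξ ≤ gradEnergy R' γ := by
    rw [← hγ.integral_energyDensity]
    exact setIntegral_le_integral (hγ.integrable_energyDensity R')
      (ae_of_all _ (energyDensity_nonneg hR'0 γ))
  have g1 := gradEnergy_nonneg hR0 φ
  have g2 := gradEnergy_nonneg hR'0 γ
  calc _ ≤ C₀ * (C₁ * gradEnergy R φ + C₂ * gradEnergy R' γ) := by gcongr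
    _ ≤ C₀ * ((C₁ + C₂) * (gradEnergy R φ + gradEnergy R' γ)) := by
        gcongr
        nlinarith [mul_nonneg hC₁0 g2, mul_nonneg hC₂0 g1]
    _ = _ := by ring

end Shell

/-! ### The resolvent form -/

section Form

variable {n : ℕ} {s : ℝ}

/-- The integral `∫ ρ φ γ (|ξ|^s - z)⁻¹ dξ`. -/
noncomputable def resolventForm (s : ℝ) (ρ φ γ : E n → ℂ) (z : ℂ) : ℂ :=
  ∫ ξ, ρ ξ * φ ξ * γ ξ * (((‖ξ‖ ^ s : ℝ) : ℂ) - z)⁻¹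

lemma abs_sub_re_le_norm (t : ℝ) (z : ℂ) : |t - z.re| ≤ ‖(t : ℂ) - z‖ := by
  simpa using Complex.abs_re_le_norm ((t : ℂ) - z)

lemma abs_im_le_norm_sub (t : ℝ) (z : ℂ) : |z.im| ≤ ‖(t : ℂ) - z‖ := by
  simpa using Complex.abs_im_le_norm ((t : ℂ) - z)

lemma norm_le_norm_sub_of_re_nonpos {t : ℝ} (ht : 0 ≤ t) {z : ℂ} (hz : z.re ≤ 0) :
    ‖z‖ ≤ ‖(t : ℂ) - z‖ := by
  rw [Complex.norm_def, Complex.norm_def]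
  refine Real.sqrt_le_sqrt ?_
  simp only [Complex.normSq_apply, Complex.sub_re, Complex.sub_im, Complex.ofReal_re,
    Complex.ofReal_im]
  nlinarith [mul_nonneg ht (neg_nonneg.2 hz)]

lemma one_add_le_norm_sub {t M d : ℝ} (hM : 0 ≤ M) {z : ℂ} (hz : |z.re| ≤ M) (hd : 0 < d)
    (h : d ≤ ‖(t : ℂ) - z‖) : 1 + t ≤ (1 + (M + 1) / d) * ‖(t : ℂ) - z‖ := by
  have h1 := (le_abs_self _).trans (abs_sub_re_le_norm t z)
  have h2 := (le_abs_self _).trans hz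
  have h3 : M + 1 ≤ (M + 1) / d * ‖(t : ℂ) - z‖ := by
    calc M + 1 = (M + 1) / d * d := by field_simp
      _ ≤ _ := by gcongr
  linarith

lemma norm_symbol_le {ρ : E n → ℂ} {N M d : ℝ} (hN : 0 ≤ N)
    (hρ : ∀ ξ, ‖ρ ξ‖ ≤ N * (1 + ‖ξ‖ ^ s)) (hM : 0 ≤ M) {z : ℂ} (hz : |z.re| ≤ M) (hd : 0 < d)
    {ξ : E n} (h : d ≤ ‖((‖ξ‖ ^ s : ℝ) : ℂ) - z‖) :
    ‖ρ ξ * (((‖ξ‖ ^ s : ℝ) : ℂ) - z)⁻¹‖ ≤ N * (1 + (M + 1) / d) := by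
  have hpos : 0 < ‖((‖ξ‖ ^ s : ℝ) : ℂ) - z‖ := hd.trans_le h
  rw [norm_mul, norm_inv, ← div_eq_mul_inv, div_le_iff₀ hpos]
  calc _ ≤ N * (1 + ‖ξ‖ ^ s) := hρ ξ
    _ ≤ N * ((1 + (M + 1) / d) * ‖((‖ξ‖ ^ s : ℝ) : ℂ) - z‖) := by
        gcongr
        exact one_add_le_norm_sub hM hz hd h
    _ = _ := by ring

variable {ρ φ γ : E n → ℂ} {N : ℝ}

lemma norm_form_integrand_le {M d : ℝ} (hN : 0 ≤ N)
    (hρ : ∀ ξ, ‖ρ ξ‖ ≤ N * (1 + ‖ξ‖ ^ s)) (hM : 0 ≤ M) {z : ℂ} (hz : |z.re| ≤ M) (hd : 0 < d)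
    {ξ : E n} (h : d ≤ ‖((‖ξ‖ ^ s : ℝ) : ℂ) - z‖) :
    ‖ρ ξ * φ ξ * γ ξ * (((‖ξ‖ ^ s : ℝ) : ℂ) - z)⁻¹‖
      ≤ N * (1 + (M + 1) / d) * (‖φ ξ‖ ^ 2 + ‖γ ξ‖ ^ 2) := by
  have h1 := norm_symbol_le hN hρ hM hz hd h
  calc _ = ‖ρ ξ * (((‖ξ‖ ^ s : ℝ) : ℂ) - z)⁻¹‖ * (‖φ ξ‖ * ‖γ ξ‖) := by
        simp only [norm_mul]; ring
    _ ≤ N * (1 + (M + 1) / d) * (‖φ ξ‖ ^ 2 + ‖γ ξ‖ ^ 2) := by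
        gcongr
        nlinarith [sq_nonneg (‖φ ξ‖ - ‖γ ξ‖), sq_nonneg ‖φ ξ‖, sq_nonneg ‖γ ξ‖]

lemma continuous_form_integrand (hs : 0 < s) (hρc : Continuous ρ) (hφ : IsH1 φ) (hγ : IsH1 γ)
    {z : ℂ} (hz : z.im ≠ 0) :
    Continuous fun ξ => ρ ξ * φ ξ * γ ξ * (((‖ξ‖ ^ s : ℝ) : ℂ) - z)⁻¹ :=
  ((hρc.mul hφ.contDiff.continuous).mul hγ.contDiff.continuous).mul
    (continuous_resolvent_factor hs hz)

lemma integrable_form_integrand (hs : 0 < s) (hρc : Continuous ρ) (hN : 0 ≤ N)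
    (hρ : ∀ ξ, ‖ρ ξ‖ ≤ N * (1 + ‖ξ‖ ^ s)) (hφ : IsH1 φ) (hγ : IsH1 γ) {z : ℂ} (hz : z.im ≠ 0) :
    Integrable fun ξ => ρ ξ * φ ξ * γ ξ * (((‖ξ‖ ^ s : ℝ) : ℂ) - z)⁻¹ := by
  refine Integrable.mono' ((hφ.integrable_sq.add hγ.integrable_sq).const_mul
    (N * (1 + (|z.re| + 1) / |z.im|)))
    (continuous_form_integrand hs hρc hφ hγ hz).aestronglyMeasurable (ae_of_all _ fun ξ => ?_)
  exact norm_form_integrand_le hN hρ (abs_nonneg _) le_rfl (abs_pos.2 hz) (abs_im_le_norm_sub _ z)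

lemma norm_setIntegral_form_le {S : Set (E n)} (hS : MeasurableSet S) {M d : ℝ} (hN : 0 ≤ N)
    (hρ : ∀ ξ, ‖ρ ξ‖ ≤ N * (1 + ‖ξ‖ ^ s)) (hM : 0 ≤ M) {z : ℂ} (hz : |z.re| ≤ M) (hd : 0 < d)
    (h : ∀ ξ ∈ S, d ≤ ‖((‖ξ‖ ^ s : ℝ) : ℂ) - z‖) (hφ : IsH1 φ) (hγ : IsH1 γ)
    {R R' : ℝ} (hR : 1 ≤ R) (hR' : 1 ≤ R') :
    ‖∫ ξ in S, ρ ξ * φ ξ * γ ξ * (((‖ξ‖ ^ s : ℝ) : ℂ) - z)⁻¹‖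
      ≤ N * (1 + (M + 1) / d) * (gradEnergy R φ + gradEnergy R' γ) := by
  have hi : Integrable fun ξ => N * (1 + (M + 1) / d) * (‖φ ξ‖ ^ 2 + ‖γ ξ‖ ^ 2) :=
    (hφ.integrable_sq.add hγ.integrable_sq).const_mul _
  calc _ ≤ ∫ ξ in S, N * (1 + (M + 1) / d) * (‖φ ξ‖ ^ 2 + ‖γ ξ‖ ^ 2) := by
        refine norm_integral_le_of_norm_le hi.integrableOn ?_
        exact (ae_restrict_mem hS).mono fun ξ hξ =>
          norm_form_integrand_le hN hρ hM hz hd (h ξ hξ)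
    _ ≤ ∫ ξ, N * (1 + (M + 1) / d) * (‖φ ξ‖ ^ 2 + ‖γ ξ‖ ^ 2) :=
        setIntegral_le_integral hi (ae_of_all _ fun ξ => by
          change 0 ≤ N * (1 + (M + 1) / d) * (‖φ ξ‖ ^ 2 + ‖γ ξ‖ ^ 2)
          positivity)
    _ = N * (1 + (M + 1) / d) * ((∫ ξ, ‖φ ξ‖ ^ 2) + ∫ ξ, ‖γ ξ‖ ^ 2) := by
        rw [integral_const_mul, integral_add hφ.integrable_sq hγ.integrable_sq]
    _ ≤ _ := by
        gcongr
        · exact integral_sq_le_gradEnergy hR φ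
        · exact integral_sq_le_gradEnergy hR' γ

/-- The limiting absorption estimate for the resolvent form, uniformly for `|z|` bounded below
and `Re z` bounded. -/
theorem norm_resolventForm_le (hn : 0 < n) (hs : 0 < s) (hρc : ContDiff ℝ 1 ρ) (hN : 0 ≤ N)
    (hρ : ∀ ξ, ‖ρ ξ‖ ≤ N * (1 + ‖ξ‖ ^ s)) {δ M : ℝ} (hδ : 0 < δ) (hM : 0 ≤ M) :
    ∃ C : ℝ, 0 ≤ C ∧ ∀ z : ℂ, z.im ≠ 0 → δ ≤ ‖z‖ → |z.re| ≤ M → ∀ (φ γ : E n → ℂ) (R R' : ℝ),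
      IsH1 φ → IsH1 γ → 1 ≤ R → 1 ≤ R' →
      ‖resolventForm s ρ φ γ z‖ ≤ C * (gradEnergy R φ + gradEnergy R' γ) := by
  set d := min (δ / 4) 1 with hd
  have hd0 : 0 < d := lt_min (by linarith) one_pos
  have hd1 : d ≤ δ / 4 := min_le_left _ _
  have hd2 : d ≤ 1 := min_le_right _ _
  set b := M + δ + 1 with hb
  obtain ⟨C, hC0, hC⟩ := norm_shell_integral_le hn hs (a := δ / 4) (b := b) (by linarith)
    (by linarith) hd0 hρc
  refine ⟨C + N * (1 + (M + 1) / d), by positivity,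
    fun z hz hzδ hzM φ γ R R' hφ hγ hR hR' => ?_⟩
  have g1 := gradEnergy_nonneg (zero_le_one.trans hR) φ
  have g2 := gradEnergy_nonneg (zero_le_one.trans hR') γ
  have hreM := (le_abs_self _).trans hzM
  by_cases hre : δ / 2 ≤ z.re
  · have h1 := hC z hz (by linarith) (by linarith) φ γ R R' hφ hγ hR hR'
    have h2 := norm_setIntegral_form_le (measurableSet_shell hs (δ / 4) b).compl hN hρ hM hzM hd0
      (fun ξ hξ => ?_) hφ hγ hR hR'
    · unfold resolventForm
      rw [← integral_add_compl (measurableSet_shell hs (δ / 4) b)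
        (integrable_form_integrand hs hρc.continuous hN hρ hφ hγ hz)]
      refine (norm_add_le _ _).trans ?_
      linarith
    · refine le_trans ?_ (abs_sub_re_le_norm _ z)
      have hξ' : ¬ (δ / 4 < ‖ξ‖ ^ s ∧ ‖ξ‖ ^ s ≤ b) := hξ
      rcases not_and_or.1 hξ' with h | h
      · rw [abs_sub_comm]
        exact le_trans (by linarith) (le_abs_self _)
      · exact le_trans (by linarith) (le_abs_self _)
  · have h2 := norm_setIntegral_form_le (S := Set.univ) MeasurableSet.univ hN hρ hM hzM hd0
      (fun ξ _ => ?_) hφ hγ hR hR'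
    · rw [setIntegral_univ] at h2
      refine h2.trans ?_
      have : 0 ≤ C * (gradEnergy R φ + gradEnergy R' γ) := by positivity
      linarith
    · have ht : 0 ≤ ‖ξ‖ ^ s := by positivity
      rcases le_or_gt z.re 0 with h | h
      · exact le_trans (by linarith) (norm_le_norm_sub_of_re_nonpos ht h)
      · refine le_trans ?_ (abs_im_le_norm_sub _ z)
        have h3 := Complex.norm_le_abs_re_add_abs_im z
        rw [abs_of_pos h] at h3
        linarith

lemma exists_shell_avoiding {z₀ : ℂ} (hz₀ : z₀ ≠ 0) :
    ∃ a b d : ℝ, 0 < a ∧ a ≤ b ∧ 0 < d ∧ z₀ ≠ a ∧ z₀ ≠ b ∧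
      ∀ t : ℝ, 0 ≤ t → t ∉ Set.Ioc a b → 2 * d ≤ ‖(t : ℂ) - z₀‖ := by
  have key : ∀ d : ℝ, 0 < d → (∀ t : ℝ, 0 ≤ t → 2 * d ≤ ‖(t : ℂ) - z₀‖) →
      ∃ a b d : ℝ, 0 < a ∧ a ≤ b ∧ 0 < d ∧ z₀ ≠ a ∧ z₀ ≠ b ∧
      ∀ t : ℝ, 0 ≤ t → t ∉ Set.Ioc a b → 2 * d ≤ ‖(t : ℂ) - z₀‖ := by
    intro d hd h
    have hne : z₀ ≠ ((1 : ℝ) : ℂ) := by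
      intro h1
      have := h 1 zero_le_one
      rw [h1] at this
      simp at this
      linarith
    exact ⟨1, 1, d, one_pos, le_rfl, hd, hne, hne, fun t ht _ => h t ht⟩
  by_cases him : z₀.im = 0
  · rcases le_or_gt z₀.re 0 with h | h
    · refine key (‖z₀‖ / 2) (by have := norm_pos_iff.2 hz₀; positivity) fun t ht => ?_
      linarith [norm_le_norm_sub_of_re_nonpos ht h]
    · refine ⟨z₀.re / 2, 2 * z₀.re, z₀.re / 4, by linarith, by linarith, by linarith, ?_, ?_,
        fun t ht hmem => ?_⟩
      · intro h1
        have := congrArg Complex.re h1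
        rw [Complex.ofReal_re] at this
        linarith
      · intro h1
        have := congrArg Complex.re h1
        rw [Complex.ofReal_re] at this
        linarith
      · refine le_trans ?_ (abs_sub_re_le_norm _ z₀)
        rcases not_and_or.1 hmem with h' | h'
        · rw [abs_sub_comm]
          exact le_trans (by linarith) (le_abs_self _)
        · exact le_trans (by linarith) (le_abs_self _)
  · refine key (|z₀.im| / 2) (by positivity) fun t ht => ?_
    linarith [abs_im_le_norm_sub t z₀]

/-- The resolvent form has boundary values away from the origin. -/
theorem tendsto_resolventForm (hn : 0 < n) (hs : 0 < s) (hρc : ContDiff ℝ 1 ρ) (hN : 0 ≤ N)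
    (hρ : ∀ ξ, ‖ρ ξ‖ ≤ N * (1 + ‖ξ‖ ^ s)) {σ : ℝ} (hσ : |σ| = 1) {z₀ : ℂ}
    (hσz : 0 ≤ σ * z₀.im) (hz₀ : z₀ ≠ 0) (hφ : IsH1 φ) (hγ : IsH1 γ) :
    ∃ l, Tendsto (resolventForm s ρ φ γ) (𝓝[openHalfPlane σ] z₀) (𝓝 l) := by
  obtain ⟨a, b, d, ha, hab, hd, hza, hzb, hd'⟩ := exists_shell_avoiding hz₀
  obtain ⟨l, hl⟩ := tendsto_shell_integral hn hs hσ ha hab hσz hza hzb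
    ((hρc.mul hφ.contDiff).mul hγ.contDiff)
  have hmeas := (measurableSet_shell (n := n) hs a b).compl
  have hnotmem : ∀ ξ ∈ (shell n s a b)ᶜ, 2 * d ≤ ‖((‖ξ‖ ^ s : ℝ) : ℂ) - z₀‖ :=
    fun ξ hξ => hd' _ (by positivity) hξ
  have hlim : Tendsto (fun z : ℂ => ∫ ξ in (shell n s a b)ᶜ,
      ρ ξ * φ ξ * γ ξ * (((‖ξ‖ ^ s : ℝ) : ℂ) - z)⁻¹) (𝓝[openHalfPlane σ] z₀)
      (𝓝 (∫ ξ in (shell n s a b)ᶜ, ρ ξ * φ ξ * γ ξ * (((‖ξ‖ ^ s : ℝ) : ℂ) - z₀)⁻¹)) := by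
    have hi : Integrable fun ξ =>
        N * (1 + ((|z₀.re| + d) + 1) / d) * (‖φ ξ‖ ^ 2 + ‖γ ξ‖ ^ 2) :=
      (hφ.integrable_sq.add hγ.integrable_sq).const_mul _
    refine tendsto_integral_filter_of_dominated_convergence _ ?_ ?_ hi.integrableOn ?_
    · filter_upwards [self_mem_nhdsWithin] with z hz
      exact (continuous_form_integrand hs hρc.continuous hφ hγ
        (im_ne_zero_of_mem hz)).aestronglyMeasurable
    · filter_upwards [mem_nhdsWithin_of_mem_nhds (Metric.ball_mem_nhds z₀ hd)] with z hz
      rw [Metric.mem_ball, dist_eq_norm] at hz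
      refine (ae_restrict_mem hmeas).mono fun ξ hξ => ?_
      refine norm_form_integrand_le hN hρ (by positivity) ?_ hd ?_
      · have h1 := (Complex.abs_re_le_norm (z - z₀)).trans hz.le
        rw [Complex.sub_re] at h1
        have h2 := abs_sub_abs_le_abs_sub z.re z₀.re
        linarith
      · have h1 := hnotmem ξ hξ
        have h2 : ‖((‖ξ‖ ^ s : ℝ) : ℂ) - z₀‖ ≤ ‖((‖ξ‖ ^ s : ℝ) : ℂ) - z‖ + ‖z - z₀‖ :=
          norm_sub_le_norm_sub_add_norm_sub _ _ _
        linarith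
    · refine (ae_restrict_mem hmeas).mono fun ξ hξ => ?_
      refine Tendsto.const_mul _ ?_
      refine Tendsto.mono_left ?_ nhdsWithin_le_nhds
      have hne : ((‖ξ‖ ^ s : ℝ) : ℂ) - z₀ ≠ 0 := norm_pos_iff.1 (by linarith [hnotmem ξ hξ])
      exact ((continuousAt_const.sub continuousAt_id).inv₀ hne)
  refine ⟨_, (hl.add hlim).congr' ?_⟩
  filter_upwards [self_mem_nhdsWithin] with z hz
  exact integral_add_compl (measurableSet_shell hs a b)
    (integrable_form_integrand hs hρc.continuous hN hρ hφ hγ (im_ne_zero_of_mem hz))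

end Form

/-! ### Multiplication operators and multipliers on `L²` -/

section Multiplication

variable {n : ℕ} {s : ℝ}

/-- The Hilbert space `L²(ℝⁿ)`. -/
abbrev L2 (n : ℕ) : Type := Lp ℂ 2 (volume : Measure (E n))

lemma memLp_mul_coe {a : E n → ℂ} (ha : MemLp a ∞ volume) (f : L2 n) :
    MemLp (fun x => a x * f x) 2 volume :=
  MemLp.mul (r := 2) (Lp.memLp f) ha

/-- Multiplication by a bounded function. -/
noncomputable def mulL2 {a : E n → ℂ} (ha : MemLp a ∞ volume) : L2 n →L[ℂ] L2 n :=
  LinearMap.mkContinuousOfExistsBound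
    { toFun := fun f => (memLp_mul_coe ha f).toLp _
      map_add' := fun f g => by
        apply Lp.ext
        filter_upwards [(memLp_mul_coe ha (f + g)).coeFn_toLp, (memLp_mul_coe ha f).coeFn_toLp,
          (memLp_mul_coe ha g).coeFn_toLp, Lp.coeFn_add f g, Lp.coeFn_add
          ((memLp_mul_coe ha f).toLp _) ((memLp_mul_coe ha g).toLp _)] with x h1 h2 h3 h4 h5
        rw [h1, h5, Pi.add_apply, h2, h3, h4, Pi.add_apply, mul_add]
      map_smul' := fun c f => by
        apply Lp.ext
        filter_upwards [(memLp_mul_coe ha (c • f)).coeFn_toLp, (memLp_mul_coe ha f).coeFn_toLp,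
          Lp.coeFn_smul c f, Lp.coeFn_smul c ((memLp_mul_coe ha f).toLp _)] with x h1 h2 h3 h4
        simp only [RingHom.id_apply]
        rw [h1, h4, Pi.smul_apply, h2, h3, Pi.smul_apply, smul_eq_mul, smul_eq_mul]
        ring }
    ⟨(eLpNormEssSup a volume).toReal, fun f => by
      refine Lp.norm_le_mul_norm_of_ae_le_mul ?_
      have hfin : eLpNormEssSup a volume ≠ ⊤ := by
        have := ha.2.ne
        rwa [eLpNorm_exponent_top] at this
      filter_upwards [(memLp_mul_coe ha f).coeFn_toLp, ae_le_eLpNormEssSup (f := a) (μ := volume)]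
        with x h1 h2
      have h3 : ‖a x‖ ≤ (eLpNormEssSup a volume).toReal := by
        rw [← toReal_enorm]
        exact ENNReal.toReal_mono hfin h2
      change ‖((memLp_mul_coe ha f).toLp _ : E n → ℂ) x‖ ≤ _
      rw [h1, norm_mul]
      gcongr⟩

lemma coeFn_mulL2 {a : E n → ℂ} (ha : MemLp a ∞ volume) (f : L2 n) :
    mulL2 ha f =ᵐ[volume] fun x => a x * f x :=
  (memLp_mul_coe ha f).coeFn_toLp

lemma memLp_top_of_forall_le {a : E n → ℂ} (ha : AEStronglyMeasurable a volume) {C : ℝ}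
    (hC : ∀ x, ‖a x‖ ≤ C) : MemLp a ∞ volume :=
  memLp_top_of_bound ha C (ae_of_all _ hC)

lemma norm_mulL2_le {a : E n → ℂ} (ha : MemLp a ∞ volume) {C : ℝ} (hC : ∀ x, ‖a x‖ ≤ C)
    (f : L2 n) : ‖mulL2 ha f‖ ≤ C * ‖f‖ := by
  refine Lp.norm_le_mul_norm_of_ae_le_mul ?_
  filter_upwards [coeFn_mulL2 ha f] with x hx
  rw [hx, norm_mul]
  exact mul_le_mul_of_nonneg_right (hC x) (norm_nonneg _)

lemma inner_eq_integral (f g : L2 n) : inner ℂ g f = ∫ x, f x * conj (g x) := by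
  rw [L2.inner_def]
  rfl

end Multiplication

section Symbol

variable {n : ℕ} {s : ℝ}

/-- A `C¹` symbol of growth at most `|ξ|^s`. -/
structure IsSymbolOfOrder (s : ℝ) (ρ : E n → ℂ) : Prop where
  contDiff : ContDiff ℝ 1 ρ
  exists_bound : ∃ N : ℝ, 0 ≤ N ∧ ∀ ξ, ‖ρ ξ‖ ≤ N * (1 + ‖ξ‖ ^ s)

/-- The symbol `r(2πξ) / (2π)^s`, adapted to the normalization of the Fourier transform. -/
noncomputable def scaledSymbol (s : ℝ) (r : E n → ℂ) (ξ : E n) : ℂ :=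
  r ((2 * Real.pi) • ξ) / (((2 * Real.pi) ^ s : ℝ) : ℂ)

/-- The spectral parameter `z / (2π)^s`. -/
noncomputable def scaledParam (s : ℝ) (z : ℂ) : ℂ := z / (((2 * Real.pi) ^ s : ℝ) : ℂ)

lemma two_pi_rpow_pos (s : ℝ) : 0 < (2 * Real.pi) ^ s := by
  have := Real.pi_pos
  positivity

lemma one_le_two_pi_rpow (hs : 0 < s) : 1 ≤ (2 * Real.pi) ^ s :=
  Real.one_le_rpow (by linarith [Real.pi_gt_three]) hs.le

lemma resolventSymbol_two_pi_smul (r : E n → ℂ) (z : ℂ) (ξ : E n) :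
    resolventSymbol s r z ((2 * Real.pi) • ξ)
      = scaledSymbol s r ξ * (((‖ξ‖ ^ s : ℝ) : ℂ) - scaledParam s z)⁻¹ := by
  have hc : (((2 * Real.pi) ^ s : ℝ) : ℂ) ≠ 0 :=
    Complex.ofReal_ne_zero.2 (two_pi_rpow_pos s).ne'
  have hn : ‖(2 * Real.pi) • ξ‖ ^ s = (2 * Real.pi) ^ s * ‖ξ‖ ^ s := by
    rw [norm_smul, Real.norm_of_nonneg (by positivity),
      Real.mul_rpow (by positivity) (norm_nonneg _)]
  have hfac : (((‖(2 * Real.pi) • ξ‖ ^ s : ℝ) : ℂ) - z)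
      = (((2 * Real.pi) ^ s : ℝ) : ℂ) * (((‖ξ‖ ^ s : ℝ) : ℂ) - scaledParam s z) := by
    unfold scaledParam
    rw [hn, Complex.ofReal_mul]
    field_simp
  unfold resolventSymbol
  rw [hfac, mul_inv, scaledSymbol, div_eq_mul_inv]
  ring

lemma scaledParam_re (s : ℝ) (z : ℂ) : (scaledParam s z).re = z.re / (2 * Real.pi) ^ s := by
  unfold scaledParam; rw [Complex.div_ofReal_re]

lemma scaledParam_im (s : ℝ) (z : ℂ) : (scaledParam s z).im = z.im / (2 * Real.pi) ^ s := by
  unfold scaledParam; rw [Complex.div_ofReal_im]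

lemma scaledParam_im_ne_zero {z : ℂ} (hz : z.im ≠ 0) : (scaledParam s z).im ≠ 0 := by
  rw [scaledParam_im]
  exact div_ne_zero hz (two_pi_rpow_pos s).ne'

lemma norm_scaledParam (s : ℝ) (z : ℂ) : ‖scaledParam s z‖ = ‖z‖ / (2 * Real.pi) ^ s := by
  unfold scaledParam
  rw [norm_div, Complex.norm_real, Real.norm_of_nonneg (two_pi_rpow_pos s).le]

lemma continuous_scaledParam (s : ℝ) : Continuous (scaledParam s) :=
  continuous_id.div_const _

lemma japanese_pos (τ : ℝ) (ξ : E n) : 0 < japanese τ ξ := by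
  unfold japanese; positivity

lemma japanese_le (hs : 0 < s) (ξ : E n) : japanese s ξ ≤ 2 ^ (s / 2) * (1 + ‖ξ‖ ^ s) := by
  have h1 : (1 + ‖ξ‖ ^ 2) ≤ 2 * (max 1 ‖ξ‖) ^ 2 := by
    have h2 : (1 : ℝ) ≤ (max 1 ‖ξ‖) ^ 2 := one_le_pow₀ (le_max_left _ _)
    have h3 : ‖ξ‖ ^ 2 ≤ (max 1 ‖ξ‖) ^ 2 := by gcongr; exact le_max_right _ _
    linarith
  have hm : (0 : ℝ) ≤ max 1 ‖ξ‖ := zero_le_one.trans (le_max_left _ _)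
  unfold japanese
  calc (1 + ‖ξ‖ ^ 2) ^ (s / 2) ≤ (2 * (max 1 ‖ξ‖) ^ 2) ^ (s / 2) := by gcongr
    _ = 2 ^ (s / 2) * (max 1 ‖ξ‖) ^ s := by
        rw [Real.mul_rpow (by norm_num) (by positivity), ← Real.rpow_natCast (max 1 ‖ξ‖) 2,
          ← Real.rpow_mul hm]
        congr 2
        push_cast
        ring
    _ ≤ 2 ^ (s / 2) * (1 + ‖ξ‖ ^ s) := by
        gcongr
        have h0 : (0 : ℝ) ≤ ‖ξ‖ ^ s := by positivity
        rcases le_total 1 ‖ξ‖ with h | h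
        · rw [max_eq_right h]; linarith
        · rw [max_eq_left h, Real.one_rpow]; linarith

lemma isSymbolOfOrder_scaledSymbol (hs : 0 < s) {r : E n → ℂ} (hr : ContDiff ℝ 1 r)
    (hb : ∃ M : ℝ, ∀ ξ, ‖r ξ / (japanese s ξ : ℂ)‖ ≤ M) :
    IsSymbolOfOrder s (scaledSymbol s r) := by
  refine ⟨(hr.comp (contDiff_const_smul _)).div_const _, ?_⟩
  obtain ⟨M, hM⟩ := hb
  have hM0 : 0 ≤ M := (norm_nonneg _).trans (hM 0)
  refine ⟨M * 2 ^ (s / 2), by positivity, fun ξ => ?_⟩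
  have hc := two_pi_rpow_pos s
  have hc1 := one_le_two_pi_rpow hs
  have h1 : ‖r ((2 * Real.pi) • ξ)‖ ≤ M * japanese s ((2 * Real.pi) • ξ) := by
    have := hM ((2 * Real.pi) • ξ)
    rwa [norm_div, Complex.norm_real, Real.norm_of_nonneg (japanese_pos _ _).le,
      div_le_iff₀ (japanese_pos _ _)] at this
  have hn : ‖(2 * Real.pi) • ξ‖ ^ s = (2 * Real.pi) ^ s * ‖ξ‖ ^ s := by
    rw [norm_smul, Real.norm_of_nonneg (by positivity),
      Real.mul_rpow (by positivity) (norm_nonneg _)]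
  unfold scaledSymbol
  rw [norm_div, Complex.norm_real, Real.norm_of_nonneg hc.le, div_le_iff₀ hc]
  calc _ ≤ M * japanese s ((2 * Real.pi) • ξ) := h1
    _ ≤ M * (2 ^ (s / 2) * (1 + ‖(2 * Real.pi) • ξ‖ ^ s)) := by
        gcongr; exact japanese_le hs _
    _ ≤ M * (2 ^ (s / 2) * ((2 * Real.pi) ^ s * (1 + ‖ξ‖ ^ s))) := by
        rw [hn]; gcongr; linarith
    _ = _ := by ring

/-- The symbol of `r(D) R_0(z)` in the variable dual to `x` under the kernel `exp(-2πi x·ξ)`. -/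
noncomputable def resolventMultiplier (s : ℝ) (r : E n → ℂ) (z : ℂ) (ξ : E n) : ℂ :=
  resolventSymbol s r z ((2 * Real.pi) • ξ)

lemma memLp_resolventMultiplier (hs : 0 < s) {r : E n → ℂ}
    (hr : IsSymbolOfOrder s (scaledSymbol s r)) {z : ℂ} (hz : z.im ≠ 0) :
    MemLp (resolventMultiplier s r z) ∞ volume := by
  have heq : resolventMultiplier s r z = fun ξ =>
      scaledSymbol s r ξ * (((‖ξ‖ ^ s : ℝ) : ℂ) - scaledParam s z)⁻¹ :=
    funext fun ξ => resolventSymbol_two_pi_smul r z ξ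
  rw [heq]
  obtain ⟨N, hN, hb⟩ := hr.exists_bound
  have hz' := scaledParam_im_ne_zero (s := s) hz
  exact memLp_top_of_forall_le
    (hr.contDiff.continuous.mul (continuous_resolvent_factor hs hz')).aestronglyMeasurable
    fun ξ => norm_symbol_le hN hb (abs_nonneg _) le_rfl (abs_pos.2 hz') (abs_im_le_norm_sub _ _)

lemma multL2_eq (hs : 0 < s) {r : E n → ℂ} (hr : IsSymbolOfOrder s (scaledSymbol s r)) {z : ℂ}
    (hz : z.im ≠ 0) (f : L2 n) :
    multL2 (resolventSymbol s r z) f = 𝓕⁻ (mulL2 (memLp_resolventMultiplier hs hr hz) (𝓕 f)) := by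
  have h := memLp_mul_coe (memLp_resolventMultiplier hs hr hz) (𝓕 f)
  exact dif_pos h

/-- The sesquilinear form `⟨r(D) R_0(z) f, g⟩`. -/
noncomputable def sesqForm (s : ℝ) (r : E n → ℂ) (z : ℂ) (f g : L2 n) : ℂ :=
  inner ℂ g (multL2 (resolventSymbol s r z) f)

lemma sesqForm_eq_inner (hs : 0 < s) {r : E n → ℂ} (hr : IsSymbolOfOrder s (scaledSymbol s r))
    {z : ℂ} (hz : z.im ≠ 0) (f g : L2 n) :
    sesqForm s r z f g
      = inner ℂ (𝓕 g) (mulL2 (memLp_resolventMultiplier hs hr hz) (𝓕 f)) := by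
  unfold sesqForm
  rw [multL2_eq hs hr hz, ← Lp.inner_fourier_eq, FourierTransform.fourier_fourierInv_eq]

lemma sesqForm_eq_integral (hs : 0 < s) {r : E n → ℂ}
    (hr : IsSymbolOfOrder s (scaledSymbol s r)) {z : ℂ} (hz : z.im ≠ 0) (f g : L2 n) :
    sesqForm s r z f g = ∫ ξ, resolventMultiplier s r z ξ * (𝓕 f) ξ * conj ((𝓕 g) ξ) := by
  rw [sesqForm_eq_inner hs hr hz, inner_eq_integral]
  refine integral_congr_ae ?_
  filter_upwards [coeFn_mulL2 (memLp_resolventMultiplier hs hr hz) (𝓕 f)] with ξ hξ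
  rw [hξ]

/-- The resolvent as a bounded operator on `L²`. -/
lemma exists_resolvent_operator (hs : 0 < s) {r : E n → ℂ}
    (hr : IsSymbolOfOrder s (scaledSymbol s r)) {z : ℂ} (hz : z.im ≠ 0) :
    ∃ A : L2 n →L[ℂ] L2 n, ∀ f, multL2 (resolventSymbol s r z) f = A f := by
  refine ⟨((Lp.fourierTransformₗᵢ (E n) ℂ).symm : L2 n →L[ℂ] L2 n) ∘L
    (mulL2 (memLp_resolventMultiplier hs hr hz)) ∘L
    ((Lp.fourierTransformₗᵢ (E n) ℂ) : L2 n →L[ℂ] L2 n), fun f => ?_⟩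
  rw [multL2_eq hs hr hz]
  rfl

end Symbol

/-! ### Schwartz functions and the weighted resolvent estimate -/

section Schwartz

variable {n : ℕ} {s : ℝ}

lemma sq_opNorm_le_sum {V : Type*} [NormedAddCommGroup V] [NormedSpace ℝ V] (L : E n →L[ℝ] V) :
    ‖L‖ ^ 2 ≤ ∑ i, ‖L (EuclideanSpace.basisFun (Fin n) ℝ i)‖ ^ 2 := by
  set S := ∑ i, ‖L (EuclideanSpace.basisFun (Fin n) ℝ i)‖ ^ 2 with hS
  have hS0 : 0 ≤ S := Finset.sum_nonneg fun i _ => by positivity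
  have h : ‖L‖ ≤ Real.sqrt S := by
    refine L.opNorm_le_bound (Real.sqrt_nonneg _) fun v => ?_
    have hv : L v = ∑ i, v i • L (EuclideanSpace.basisFun (Fin n) ℝ i) := by
      conv_lhs => rw [← (EuclideanSpace.basisFun (Fin n) ℝ).sum_repr v]
      simp
    rw [hv]
    calc _ ≤ ∑ i, ‖v i‖ * ‖L (EuclideanSpace.basisFun (Fin n) ℝ i)‖ := by
          refine (norm_sum_le _ _).trans (le_of_eq ?_)
          simp only [norm_smul]
      _ ≤ Real.sqrt (∑ i, ‖v i‖ ^ 2) * Real.sqrt S := Real.sum_mul_le_sqrt_mul_sqrt _ _ _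
      _ = Real.sqrt S * ‖v‖ := by rw [EuclideanSpace.norm_eq, mul_comm]
  calc ‖L‖ ^ 2 ≤ Real.sqrt S ^ 2 := by gcongr
    _ = S := Real.sq_sqrt hS0

lemma integrable_norm_sq_schwartz {V : Type*} [NormedAddCommGroup V] [NormedSpace ℝ V]
    (p : 𝓢(E n, V)) : Integrable fun x => ‖p x‖ ^ 2 :=
  (memLp_two_iff_integrable_sq_norm p.continuous.aestronglyMeasurable).1 (p.memLp 2)

lemma isH1_schwartz (p : 𝓢(E n, ℂ)) : IsH1 p :=
  ⟨p.smooth 1, integrable_norm_sq_schwartz p,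
    integrable_norm_sq_schwartz (SchwartzMap.fderivCLM ℝ (E n) ℂ p)⟩

lemma norm_sq_toLp (p : 𝓢(E n, ℂ)) : ‖p.toLp 2‖ ^ 2 = ∫ x, ‖p x‖ ^ 2 := by
  have h := inner_eq_integral (p.toLp 2) (p.toLp 2)
  rw [inner_self_eq_norm_sq_to_K] at h
  have h2 : ∫ x, (p.toLp 2 : E n → ℂ) x * conj ((p.toLp 2 : E n → ℂ) x)
      = ∫ x, ((‖p x‖ ^ 2 : ℝ) : ℂ) := by
    refine integral_congr_ae ?_
    filter_upwards [p.coeFn_toLp 2] with x hx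
    rw [hx, Complex.mul_conj, Complex.normSq_eq_norm_sq]
  rw [h2, integral_complex_ofReal] at h
  exact Complex.ofReal_injective (by push_cast at h ⊢; exact h)

open LineDeriv in
lemma integral_fderiv_fourier_sq (p : 𝓢(E n, ℂ)) (i : Fin n) :
    ∫ ξ, ‖fderiv ℝ (𝓕 p : 𝓢(E n, ℂ)) ξ (EuclideanSpace.basisFun (Fin n) ℝ i)‖ ^ 2
      = (2 * Real.pi) ^ 2 * ∫ x : E n, ‖x i‖ ^ 2 * ‖p x‖ ^ 2 := by
  set e := EuclideanSpace.basisFun (Fin n) ℝ i with he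
  have h1 : ∀ ξ, fderiv ℝ (𝓕 p : 𝓢(E n, ℂ)) ξ e
      = (𝓕 (-(2 * Real.pi * Complex.I) • SchwartzMap.smulLeftCLM ℂ (inner ℝ · e) p) :
          𝓢(E n, ℂ)) ξ := by
    intro ξ
    rw [← SchwartzMap.lineDerivOp_apply_eq_fderiv, SchwartzMap.lineDerivOp_fourier_eq]
  simp only [h1]
  rw [SchwartzMap.integral_norm_sq_fourier, ← integral_const_mul]
  congr 1
  ext x
  have hg : (fun x : E n => inner ℝ x e).HasTemperateGrowth :=
    ((innerSL ℝ).flip e).hasTemperateGrowth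
  have hinner : inner ℝ x e = x i := by
    rw [he, real_inner_comm, EuclideanSpace.basisFun_inner]
  rw [smul_apply, SchwartzMap.smulLeftCLM_apply_apply hg, hinner, norm_smul, norm_smul]
  have h2 : ‖-(2 * (Real.pi : ℂ) * Complex.I)‖ = 2 * Real.pi := by
    simp [abs_of_pos Real.pi_pos]
  rw [h2]
  ring

lemma integrable_coord_sq_mul (p : 𝓢(E n, ℂ)) (i : Fin n) :
    Integrable fun x : E n => ‖x i‖ ^ 2 * ‖p x‖ ^ 2 := by
  set e := EuclideanSpace.basisFun (Fin n) ℝ i with he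
  have hg : (fun x : E n => inner ℝ x e).HasTemperateGrowth :=
    ((innerSL ℝ).flip e).hasTemperateGrowth
  refine (integrable_norm_sq_schwartz (SchwartzMap.smulLeftCLM ℂ (inner ℝ · e) p)).congr
    (ae_of_all _ fun x => ?_)
  have hinner : inner ℝ x e = x i := by
    rw [he, real_inner_comm, EuclideanSpace.basisFun_inner]
  change ‖SchwartzMap.smulLeftCLM ℂ (inner ℝ · e) p x‖ ^ 2 = ‖x i‖ ^ 2 * ‖p x‖ ^ 2
  rw [SchwartzMap.smulLeftCLM_apply_apply hg, hinner, norm_smul, mul_pow]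

lemma sum_coord_sq_mul (p : E n → ℂ) (x : E n) :
    ∑ i, ‖x i‖ ^ 2 * ‖p x‖ ^ 2 = ‖x‖ ^ 2 * ‖p x‖ ^ 2 := by
  rw [← Finset.sum_mul, EuclideanSpace.norm_sq_eq]

lemma integrable_norm_sq_mul (p : 𝓢(E n, ℂ)) :
    Integrable fun x : E n => ‖x‖ ^ 2 * ‖p x‖ ^ 2 := by
  have := integrable_finsetSum Finset.univ fun i _ => integrable_coord_sq_mul p i
  simpa only [sum_coord_sq_mul] using this

lemma integral_norm_fderiv_fourier_sq_le (p : 𝓢(E n, ℂ)) :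
    ∫ ξ, ‖fderiv ℝ (𝓕 p : 𝓢(E n, ℂ)) ξ‖ ^ 2 ≤ (2 * Real.pi) ^ 2 * ∫ x : E n, ‖x‖ ^ 2 * ‖p x‖ ^ 2 := by
  have hint : ∀ i, Integrable fun ξ =>
      ‖fderiv ℝ (𝓕 p : 𝓢(E n, ℂ)) ξ (EuclideanSpace.basisFun (Fin n) ℝ i)‖ ^ 2 := fun i =>
    integrable_norm_sq_schwartz (SchwartzMap.evalCLM ℝ (E n) ℂ
      (EuclideanSpace.basisFun (Fin n) ℝ i) (SchwartzMap.fderivCLM ℝ (E n) ℂ (𝓕 p)))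
  calc _ ≤ ∫ ξ, ∑ i, ‖fderiv ℝ (𝓕 p : 𝓢(E n, ℂ)) ξ (EuclideanSpace.basisFun (Fin n) ℝ i)‖ ^ 2 :=
        integral_mono (isH1_schwartz (𝓕 p : 𝓢(E n, ℂ))).integrable_grad_sq
          (integrable_finsetSum _ fun i _ => hint i) fun ξ => sq_opNorm_le_sum _
    _ = _ := by
        rw [integral_finsetSum _ fun i _ => hint i]
        simp only [integral_fderiv_fourier_sq]
        rw [← Finset.mul_sum, ← integral_finsetSum _ fun i _ => integrable_coord_sq_mul p i]
        simp only [sum_coord_sq_mul]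

lemma norm_fderiv_conj (φ : E n → ℂ) (ξ : E n) :
    ‖fderiv ℝ (fun η => conj (φ η)) ξ‖ = ‖fderiv ℝ φ ξ‖ := by
  have h : fderiv ℝ (fun η => conj (φ η)) ξ
      = (Complex.conjLIE : ℂ →L[ℝ] ℂ).comp (fderiv ℝ φ ξ) :=
    LinearIsometryEquiv.comp_fderiv Complex.conjLIE
  rw [h]
  exact LinearIsometry.norm_toContinuousLinearMap_comp Complex.conjLIE.toLinearIsometry

lemma IsH1.conj {φ : E n → ℂ} (hφ : IsH1 φ) : IsH1 fun ξ => conj (φ ξ) := by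
  refine ⟨Complex.conjCLE.contDiff.comp hφ.contDiff, ?_, ?_⟩
  · simpa using hφ.integrable_sq
  · simpa only [norm_fderiv_conj] using hφ.integrable_grad_sq

lemma gradEnergy_conj (R : ℝ) (φ : E n → ℂ) :
    gradEnergy R (fun ξ => conj (φ ξ)) = gradEnergy R φ := by
  unfold gradEnergy
  simp only [norm_fderiv_conj, RCLike.norm_conj]

/-- The weight `⟨x⟩^τ` as a complex valued function. -/
noncomputable def weight (n : ℕ) (τ : ℝ) (x : E n) : ℂ := (japanese τ x : ℂ)

lemma hasTemperateGrowth_weight (τ : ℝ) : (weight n τ).HasTemperateGrowth := by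
  have h := Function.hasTemperateGrowth_one_add_norm_sq_rpow (E n) (τ / 2)
  exact Function.Complex.hasTemperateGrowth_ofReal.comp h

lemma norm_weight (τ : ℝ) (x : E n) : ‖weight n τ x‖ = japanese τ x := by
  unfold weight
  rw [Complex.norm_real, Real.norm_of_nonneg (japanese_pos _ _).le]

lemma japanese_sq (τ : ℝ) (x : E n) : japanese τ x ^ 2 = (1 + ‖x‖ ^ 2) ^ τ := by
  unfold japanese
  rw [← Real.rpow_natCast, ← Real.rpow_mul (by positivity)]
  congr 1
  push_cast
  ring

lemma japanese_neg_one_sq (x : E n) : japanese (-1) x ^ 2 = (1 + ‖x‖ ^ 2)⁻¹ := by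
  rw [japanese_sq, Real.rpow_neg_one]

lemma japanese_one_sq (x : E n) : japanese 1 x ^ 2 = 1 + ‖x‖ ^ 2 := by
  rw [japanese_sq, Real.rpow_one]

lemma weight_mul (τ τ' : ℝ) (x : E n) : weight n τ x * weight n τ' x = weight n (τ + τ') x := by
  unfold weight japanese
  rw [← Complex.ofReal_mul, ← Real.rpow_add (by positivity)]
  congr 2
  ring

lemma weight_zero (x : E n) : weight n 0 x = 1 := by
  simp [weight, japanese]

lemma japanese_neg_one_le_one (x : E n) : japanese (-1) x ≤ 1 := by
  have h1 := japanese_neg_one_sq x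
  have h2 : (1 + ‖x‖ ^ 2)⁻¹ ≤ 1 := inv_le_one_of_one_le₀ (by linarith [sq_nonneg ‖x‖])
  rw [← h1] at h2
  exact (sq_le_one_iff₀ (japanese_pos _ _).le).1 h2

lemma memLp_weight : MemLp (weight n (-1)) ∞ volume :=
  memLp_top_of_forall_le (hasTemperateGrowth_weight (-1)).1.continuous.aestronglyMeasurable
    fun x => (norm_weight (-1) x).trans_le (japanese_neg_one_le_one x)

/-- Multiplication by `⟨x⟩⁻¹` on `L²`. -/
noncomputable def weightOp (n : ℕ) : L2 n →L[ℂ] L2 n := mulL2 (memLp_weight (n := n))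

lemma weightOp_toLp (h : 𝓢(E n, ℂ)) :
    weightOp n (h.toLp 2) = (SchwartzMap.smulLeftCLM ℂ (weight n (-1)) h).toLp 2 := by
  apply Lp.ext
  filter_upwards [coeFn_mulL2 (memLp_weight (n := n)) (h.toLp 2), h.coeFn_toLp 2,
    (SchwartzMap.smulLeftCLM ℂ (weight n (-1)) h).coeFn_toLp 2] with x h1 h2 h3
  unfold weightOp
  rw [h1, h2, h3, SchwartzMap.smulLeftCLM_apply_apply (hasTemperateGrowth_weight (-1)),
    smul_eq_mul]

lemma norm_sq_mul_weight_le (h : 𝓢(E n, ℂ)) :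
    ∫ x : E n, ‖x‖ ^ 2 * ‖SchwartzMap.smulLeftCLM ℂ (weight n (-1)) h x‖ ^ 2
      ≤ ‖h.toLp 2‖ ^ 2 := by
  rw [norm_sq_toLp]
  refine integral_mono (integrable_norm_sq_mul _) (integrable_norm_sq_schwartz h) fun x => ?_
  change ‖x‖ ^ 2 * ‖SchwartzMap.smulLeftCLM ℂ (weight n (-1)) h x‖ ^ 2 ≤ ‖h x‖ ^ 2
  rw [SchwartzMap.smulLeftCLM_apply_apply (hasTemperateGrowth_weight (-1)), norm_smul, mul_pow,
    norm_weight, japanese_neg_one_sq, ← mul_assoc]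
  have h1 : ‖x‖ ^ 2 * (1 + ‖x‖ ^ 2)⁻¹ ≤ 1 := by
    rw [← div_eq_mul_inv, div_le_one (by positivity)]
    linarith
  exact mul_le_of_le_one_left (by positivity) h1

lemma gradEnergy_le_of_le {R a b : ℝ} (hR : 0 < R) {φ : E n → ℂ} (h0 : ∫ ξ, ‖φ ξ‖ ^ 2 = a ^ 2)
    (h1 : ∫ ξ, ‖fderiv ℝ φ ξ‖ ^ 2 ≤ (2 * Real.pi) ^ 2 * b ^ 2) :
    gradEnergy R φ ≤ (2 * Real.pi) ^ 2 * (R * a ^ 2 + R⁻¹ * b ^ 2) := by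
  have hpi : 1 ≤ (2 * Real.pi) ^ 2 := one_le_pow₀ (by linarith [Real.pi_gt_three])
  have h5 : R⁻¹ * (∫ ξ, ‖fderiv ℝ φ ξ‖ ^ 2) ≤ R⁻¹ * ((2 * Real.pi) ^ 2 * b ^ 2) := by gcongr
  have h6 : R * a ^ 2 ≤ (2 * Real.pi) ^ 2 * (R * a ^ 2) :=
    le_mul_of_one_le_left (by positivity) hpi
  unfold gradEnergy
  rw [h0]
  linarith

lemma gradEnergy_fourier_le {R : ℝ} (hR : 0 < R) (h : 𝓢(E n, ℂ)) :
    gradEnergy R (𝓕 (SchwartzMap.smulLeftCLM ℂ (weight n (-1)) h) : 𝓢(E n, ℂ))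
      ≤ (2 * Real.pi) ^ 2
        * (R * ‖weightOp n (h.toLp 2)‖ ^ 2 + R⁻¹ * ‖h.toLp 2‖ ^ 2) := by
  refine gradEnergy_le_of_le hR ?_ ?_
  · rw [SchwartzMap.integral_norm_sq_fourier, weightOp_toLp, norm_sq_toLp]
  · exact (integral_norm_fderiv_fourier_sq_le _).trans
      (mul_le_mul_of_nonneg_left (norm_sq_mul_weight_le h) (by positivity))

lemma sesqForm_toLp (hs : 0 < s) {r : E n → ℂ} (hr : IsSymbolOfOrder s (scaledSymbol s r)) {z : ℂ}
    (hz : z.im ≠ 0) (p k : 𝓢(E n, ℂ)) :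
    sesqForm s r z (p.toLp 2) (k.toLp 2)
      = resolventForm s (scaledSymbol s r) (𝓕 p : 𝓢(E n, ℂ)) (fun ξ => conj ((𝓕 k : 𝓢(E n, ℂ)) ξ)) (scaledParam s z) := by
  rw [sesqForm_eq_integral hs hr hz, SchwartzMap.toLp_fourier_eq, SchwartzMap.toLp_fourier_eq]
  refine integral_congr_ae ?_
  filter_upwards [(𝓕 p : 𝓢(E n, ℂ)).coeFn_toLp 2, (𝓕 k : 𝓢(E n, ℂ)).coeFn_toLp 2] with ξ h1 h2
  rw [h1, h2]
  unfold resolventMultiplier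
  rw [resolventSymbol_two_pi_smul]
  ring

/-- The weighted resolvent estimate on `L²`. -/
theorem norm_sesqForm_weight_le (hn : 0 < n) (hs : 0 < s) {r : E n → ℂ}
    (hr : IsSymbolOfOrder s (scaledSymbol s r)) {δ M : ℝ} (hδ : 0 < δ) (hM : 0 ≤ M) :
    ∃ C : ℝ, 0 ≤ C ∧ ∀ z : ℂ, z.im ≠ 0 → δ ≤ ‖z‖ → |z.re| ≤ M → ∀ (h k : L2 n) (R R' : ℝ),
      1 ≤ R → 1 ≤ R' →
      ‖sesqForm s r z (weightOp n h) (weightOp n k)‖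
        ≤ C * ((R * ‖weightOp n h‖ ^ 2 + R⁻¹ * ‖h‖ ^ 2)
          + (R' * ‖weightOp n k‖ ^ 2 + R'⁻¹ * ‖k‖ ^ 2)) := by
  obtain ⟨N, hN, hb⟩ := hr.exists_bound
  have hc := two_pi_rpow_pos s
  obtain ⟨C, hC0, hC⟩ := norm_resolventForm_le hn hs hr.contDiff hN hb
    (δ := δ / (2 * Real.pi) ^ s) (M := M / (2 * Real.pi) ^ s) (by positivity) (by positivity)
  refine ⟨C * (2 * Real.pi) ^ 2, by positivity, fun z hz hzδ hzM h k R R' hR hR' => ?_⟩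
  obtain ⟨A, hA⟩ := exists_resolvent_operator hs hr hz
  have hR0 : 0 < R := by linarith
  have hR'0 : 0 < R' := by linarith
  refine DenseRange.induction_on₂ (p := fun h k : L2 n =>
      ‖sesqForm s r z (weightOp n h) (weightOp n k)‖
        ≤ C * (2 * Real.pi) ^ 2 * ((R * ‖weightOp n h‖ ^ 2 + R⁻¹ * ‖h‖ ^ 2)
          + (R' * ‖weightOp n k‖ ^ 2 + R'⁻¹ * ‖k‖ ^ 2)))
    (SchwartzMap.denseRange_toLpCLM (F := ℂ) (E := E n) (μ := volume) (p := 2) (by norm_num))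
    ?_ ?_ h k
  · simp only [sesqForm, hA]
    refine isClosed_le ?_ ?_
    · fun_prop
    · fun_prop
  · intro h k
    simp only [SchwartzMap.toLpCLM_apply]
    rw [weightOp_toLp, weightOp_toLp, sesqForm_toLp hs hr hz, ← weightOp_toLp, ← weightOp_toLp]
    refine (hC _ (scaledParam_im_ne_zero hz) ?_ ?_ _ _ R R' (isH1_schwartz _)
      (isH1_schwartz _).conj hR hR').trans ?_
    · rw [norm_scaledParam]; gcongr
    · rw [scaledParam_re, abs_div, abs_of_pos hc]; gcongr
    · rw [gradEnergy_conj]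
      have e1 := gradEnergy_fourier_le hR0 h
      have e2 := gradEnergy_fourier_le hR'0 k
      calc _ ≤ C * ((2 * Real.pi) ^ 2
            * (R * ‖weightOp n (h.toLp 2)‖ ^ 2 + R⁻¹ * ‖h.toLp 2‖ ^ 2)
            + (2 * Real.pi) ^ 2
            * (R' * ‖weightOp n (k.toLp 2)‖ ^ 2 + R'⁻¹ * ‖k.toLp 2‖ ^ 2)) := by gcongr
        _ = _ := by ring

/-- Boundary values of the sesquilinear form on Schwartz functions. -/
theorem tendsto_sesqForm_toLp (hn : 0 < n) (hs : 0 < s) {r : E n → ℂ}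
    (hr : IsSymbolOfOrder s (scaledSymbol s r)) {σ : ℝ} (hσ : |σ| = 1) {z₀ : ℂ}
    (hσz : 0 ≤ σ * z₀.im) (hz₀ : z₀ ≠ 0) (p k : 𝓢(E n, ℂ)) :
    ∃ l, Tendsto (fun z => sesqForm s r z (p.toLp 2) (k.toLp 2)) (𝓝[openHalfPlane σ] z₀)
      (𝓝 l) := by
  obtain ⟨N, hN, hb⟩ := hr.exists_bound
  have hc := two_pi_rpow_pos s
  have hz₀' : scaledParam s z₀ ≠ 0 := by
    rw [← norm_pos_iff, norm_scaledParam]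
    have := norm_pos_iff.2 hz₀
    positivity
  obtain ⟨l, hl⟩ := tendsto_resolventForm hn hs hr.contDiff hN hb hσ (z₀ := scaledParam s z₀)
    (by rw [scaledParam_im, ← mul_div_assoc]; positivity) hz₀' (isH1_schwartz (𝓕 p : 𝓢(E n, ℂ)))
    (isH1_schwartz (𝓕 k : 𝓢(E n, ℂ))).conj
  refine ⟨l, ?_⟩
  have hmap : Tendsto (scaledParam s) (𝓝[openHalfPlane σ] z₀)
      (𝓝[openHalfPlane σ] (scaledParam s z₀)) := by
    refine tendsto_nhdsWithin_iff.2 ⟨(continuous_scaledParam s).continuousAt.tendsto.mono_left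
      nhdsWithin_le_nhds, ?_⟩
    filter_upwards [self_mem_nhdsWithin] with z hz
    have hz' : 0 < σ * z.im := hz
    change 0 < σ * (scaledParam s z).im
    rw [scaledParam_im, ← mul_div_assoc]
    positivity
  refine (hl.comp hmap).congr' ?_
  filter_upwards [self_mem_nhdsWithin] with z hz
  exact (sesqForm_toLp hs hr (im_ne_zero_of_mem hz) p k).symm

end Schwartz

/-! ### Dyadic truncations and the `B` norm -/

section Truncation

variable {n : ℕ} {s : ℝ}

lemma radius_succ (k : ℕ) : radius (k + 1) = 2 ^ k := by
  simp [radius]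

lemma radius_pos (k : ℕ) : 0 < radius (k + 1) := by
  rw [radius_succ]; positivity

lemma one_le_radius (k : ℕ) : 1 ≤ radius (k + 1) := by
  rw [radius_succ]; exact one_le_pow₀ (by norm_num)

lemma radius_mono : Monotone radius := by
  refine monotone_nat_of_le_succ fun k => ?_
  rcases k with _ | k
  · simp [radius]
  · rw [radius_succ, radius_succ]
    exact pow_le_pow_right₀ (by norm_num) (Nat.le_succ k)

lemma tendsto_radius : Tendsto radius atTop atTop := by
  rw [← tendsto_add_atTop_iff_nat 1]
  simp only [radius_succ]
  exact tendsto_pow_atTop_atTop_of_one_lt (by norm_num)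

lemma measurableSet_annulus (k : ℕ) : MeasurableSet (annulus n k) :=
  (measurableSet_lt measurable_const measurable_norm).inter
    (measurableSet_lt measurable_norm measurable_const)

lemma disjoint_annulus {j k : ℕ} (hjk : j ≠ k) :
    Disjoint (annulus n (j + 1)) (annulus n (k + 1)) := by
  wlog h : j < k generalizing j k
  · exact (this hjk.symm (lt_of_le_of_ne (not_lt.1 h) hjk.symm)).symm
  rw [Set.disjoint_left]
  intro x hj hk
  have h1 : ‖x‖ < radius (j + 1) := hj.2
  have h2 : radius k < ‖x‖ := hk.1
  exact absurd (radius_mono (Nat.succ_le_of_lt h)) (not_le.2 (h2.trans h1))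

lemma exists_mem_annulus {x : E n} (hx : ∀ k, ‖x‖ ≠ radius k) : ∃ k, x ∈ annulus n (k + 1) := by
  have h : ∃ k, ‖x‖ < radius k := (tendsto_radius.eventually_gt_atTop ‖x‖).exists
  classical
  set m := Nat.find h with hm
  have hmlt : ‖x‖ < radius m := Nat.find_spec h
  obtain ⟨k, hk⟩ : ∃ k, m = k + 1 := by
    refine Nat.exists_eq_succ_of_ne_zero fun h0 => ?_
    rw [h0] at hmlt
    simp only [radius, if_true] at hmlt
    exact absurd (norm_nonneg x) (not_le.2 hmlt)
  refine ⟨k, ?_, by rwa [hk] at hmlt⟩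
  have : ¬ ‖x‖ < radius k := Nat.find_min h (by omega)
  exact lt_of_le_of_ne (not_lt.1 this) (hx k).symm

lemma ae_exists_mem_annulus (hn : 0 < n) :
    ∀ᵐ x : E n ∂volume, ∃ k, x ∈ annulus n (k + 1) := by
  have := nontrivial_euclidean hn
  have h : ∀ᵐ x : E n ∂volume, ∀ k, ‖x‖ ≠ radius k := by
    refine ae_all_iff.2 fun k => ?_
    have h0 := Measure.addHaar_sphere (volume : Measure (E n)) 0 (radius k)
    refine (measure_eq_zero_iff_ae_notMem.1 h0).mono fun x hx hx' => hx ?_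
    simpa using hx'
  exact h.mono fun x hx => exists_mem_annulus hx

/-- The indicator function of an annulus. -/
noncomputable def annulusInd (n k : ℕ) : E n → ℂ := (annulus n (k + 1)).indicator fun _ => 1

lemma annulusInd_mul (k : ℕ) (f : E n → ℂ) (x : E n) :
    annulusInd n k x * f x = (annulus n (k + 1)).indicator f x := by
  unfold annulusInd
  by_cases h : x ∈ annulus n (k + 1) <;> simp [h]

lemma norm_annulusInd_le (k : ℕ) (x : E n) : ‖annulusInd n k x‖ ≤ 1 := by
  unfold annulusInd
  by_cases h : x ∈ annulus n (k + 1) <;> simp [h]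

lemma memLp_annulusInd (k : ℕ) : MemLp (annulusInd n k) ∞ volume :=
  memLp_top_of_forall_le ((aestronglyMeasurable_indicator_iff (measurableSet_annulus _)).2
    aestronglyMeasurable_const) (norm_annulusInd_le k)

/-- Restriction of an `L²` function to an annulus. -/
noncomputable def trunc (n k : ℕ) : L2 n →L[ℂ] L2 n := mulL2 (memLp_annulusInd (n := n) k)

lemma coeFn_trunc (k : ℕ) (f : L2 n) :
    trunc n k f =ᵐ[volume] (annulus n (k + 1)).indicator f := by
  filter_upwards [coeFn_mulL2 (memLp_annulusInd (n := n) k) f] with x hx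
  rw [← annulusInd_mul]
  exact hx

lemma enorm_trunc (k : ℕ) (f : L2 n) :
    ‖trunc n k f‖ₑ = eLpNorm f 2 (volume.restrict (annulus n (k + 1))) := by
  rw [Lp.enorm_def, eLpNorm_congr_ae (coeFn_trunc k f),
    eLpNorm_indicator_eq_eLpNorm_restrict (measurableSet_annulus _)]

lemma norm_trunc_le (k : ℕ) (f : L2 n) : ‖trunc n k f‖ ≤ ‖f‖ := by
  exact (norm_mulL2_le (memLp_annulusInd (n := n) k) (norm_annulusInd_le k) f).trans_eq
    (one_mul _)

lemma trunc_trunc_self (k : ℕ) (f : L2 n) : trunc n k (trunc n k f) = trunc n k f := by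
  apply Lp.ext
  filter_upwards [coeFn_trunc k (trunc n k f), coeFn_trunc k f] with x h1 h2
  rw [h1]
  by_cases h : x ∈ annulus n (k + 1)
  · rw [Set.indicator_of_mem h]
  · rw [h2, Set.indicator_of_notMem h, Set.indicator_of_notMem h]

lemma trunc_trunc_of_ne {j k : ℕ} (hjk : j ≠ k) (f : L2 n) : trunc n j (trunc n k f) = 0 := by
  apply Lp.ext
  filter_upwards [coeFn_trunc j (trunc n k f), coeFn_trunc k f, Lp.coeFn_zero ℂ 2
    (volume : Measure (E n))] with x h1 h2 h3
  rw [h1, h3, Pi.zero_apply]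
  by_cases h : x ∈ annulus n (j + 1)
  · rw [Set.indicator_of_mem h, h2,
      Set.indicator_of_notMem (Set.disjoint_left.1 (disjoint_annulus hjk) h)]
  · rw [Set.indicator_of_notMem h]

lemma eq_zero_of_trunc (hn : 0 < n) {f : L2 n} (hf : ∀ k, trunc n k f = 0) : f = 0 := by
  apply Lp.ext
  have h1 : ∀ᵐ x : E n ∂volume, ∀ k, trunc n k f x = (annulus n (k + 1)).indicator f x :=
    ae_all_iff.2 fun k => coeFn_trunc k f
  filter_upwards [h1, ae_exists_mem_annulus hn, Lp.coeFn_zero ℂ 2 (volume : Measure (E n))]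
    with x h1 h2 h3
  obtain ⟨k, hk⟩ := h2
  have h4 := h1 k
  rw [hf k, h3, Set.indicator_of_mem hk] at h4
  rw [h3, ← h4]

/-- The weights `R_j^{1/2}`. -/
noncomputable def dyadicWeight (k : ℕ) : ℝ := radius (k + 1) ^ (1 / 2 : ℝ)

lemma dyadicWeight_pos (k : ℕ) : 0 < dyadicWeight k := Real.rpow_pos_of_pos (radius_pos k) _

lemma dyadicWeight_sq (k : ℕ) : dyadicWeight k ^ 2 = radius (k + 1) := by
  unfold dyadicWeight
  rw [← Real.sqrt_eq_rpow, Real.sq_sqrt (radius_pos k).le]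

lemma one_le_dyadicWeight (k : ℕ) : 1 ≤ dyadicWeight k :=
  Real.one_le_rpow (one_le_radius k) (by norm_num)

lemma inv_dyadicWeight (k : ℕ) : radius (k + 1) ^ (-(1 / 2) : ℝ) = (dyadicWeight k)⁻¹ :=
  Real.rpow_neg (radius_pos k).le _

lemma summable_inv_dyadicWeight : Summable fun k => (dyadicWeight k)⁻¹ := by
  have h : ∀ k, (dyadicWeight k)⁻¹ = ((2 : ℝ) ^ (-(1 / 2) : ℝ)) ^ k := by
    intro k
    rw [← inv_dyadicWeight, radius_succ, ← Real.rpow_natCast, ← Real.rpow_natCast,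
      ← Real.rpow_mul (by norm_num), ← Real.rpow_mul (by norm_num), mul_comm]
  simp only [h]
  exact summable_geometric_of_lt_one (by positivity)
    (Real.rpow_lt_one_of_one_lt_of_neg (by norm_num) (by norm_num))

/-- The terms of the `B` norm. -/
noncomputable def bTerm (f : L2 n) (k : ℕ) : ℝ := dyadicWeight k * ‖trunc n k f‖

lemma bTerm_nonneg (f : L2 n) (k : ℕ) : 0 ≤ bTerm f k :=
  mul_nonneg (dyadicWeight_pos k).le (norm_nonneg _)

lemma bNorm_eq_tsum (f : L2 n) :
    bNorm (f : E n →ₘ[volume] ℂ) = ∑' k, ENNReal.ofReal (bTerm f k) := by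
  unfold bNorm bTerm
  refine tsum_congr fun k => ?_
  rw [ENNReal.ofReal_mul (dyadicWeight_pos k).le, ofReal_norm, enorm_trunc]
  rfl

lemma mem_BSpace_iff {f : L2 n} : f ∈ BSpace n ↔ Summable (bTerm f) := by
  have h : f ∈ BSpace n ↔ bNorm (f : E n →ₘ[volume] ℂ) < ⊤ := Iff.rfl
  rw [h, bNorm_eq_tsum]
  constructor
  · intro h'
    have := ENNReal.summable_toReal h'.ne
    simpa only [ENNReal.toReal_ofReal (bTerm_nonneg f _)] using this
  · intro h'
    rw [← ENNReal.ofReal_tsum_of_nonneg (bTerm_nonneg f) h']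
    exact ENNReal.ofReal_lt_top

/-- The `B` norm as a real number. -/
noncomputable def bReal (f : L2 n) : ℝ := ∑' k, bTerm f k

lemma bReal_nonneg (f : L2 n) : 0 ≤ bReal f := tsum_nonneg (bTerm_nonneg f)

lemma bNorm_eq_ofReal {f : L2 n} (hf : f ∈ BSpace n) :
    bNorm (f : E n →ₘ[volume] ℂ) = ENNReal.ofReal (bReal f) := by
  rw [bNorm_eq_tsum, bReal,
    ENNReal.ofReal_tsum_of_nonneg (bTerm_nonneg f) (mem_BSpace_iff.1 hf)]

lemma hasSum_bTerm {f : L2 n} (hf : f ∈ BSpace n) : HasSum (bTerm f) (bReal f) :=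
  (mem_BSpace_iff.1 hf).hasSum

lemma bTerm_add_le (f g : L2 n) (k : ℕ) : bTerm (f + g) k ≤ bTerm f k + bTerm g k := by
  unfold bTerm
  rw [map_add, ← mul_add]
  exact mul_le_mul_of_nonneg_left (norm_add_le _ _) (dyadicWeight_pos k).le

lemma bReal_add_le {f g : L2 n} (hf : f ∈ BSpace n) (hg : g ∈ BSpace n) :
    bReal (f + g) ≤ bReal f + bReal g := by
  unfold bReal
  rw [← (mem_BSpace_iff.1 hf).tsum_add (mem_BSpace_iff.1 hg)]
  exact (mem_BSpace_iff.1 (add_mem hf hg)).tsum_le_tsum (bTerm_add_le f g)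
    ((mem_BSpace_iff.1 hf).add (mem_BSpace_iff.1 hg))

lemma hasSum_trunc (hn : 0 < n) {f : L2 n} (hf : f ∈ BSpace n) :
    HasSum (fun k => trunc n k f) f := by
  have hs : Summable fun k => ‖trunc n k f‖ := by
    refine Summable.of_nonneg_of_le (fun k => norm_nonneg _) (fun k => ?_) (mem_BSpace_iff.1 hf)
    exact le_mul_of_one_le_left (norm_nonneg _) (one_le_dyadicWeight k)
  have hsum := hs.of_norm.hasSum
  set g := ∑' k, trunc n k f with hg
  have key : g - f = 0 := by
    refine eq_zero_of_trunc hn fun j => ?_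
    have h1 := hsum.mapL (trunc n j)
    have h2 : HasSum (fun k => trunc n j (trunc n k f)) (trunc n j (trunc n j f)) :=
      hasSum_single j fun k hk => trunc_trunc_of_ne (Ne.symm hk) f
    rw [map_sub, h1.unique h2, trunc_trunc_self, sub_self]
  rwa [sub_eq_zero.1 key] at hsum

lemma bTerm_trunc (j k : ℕ) (f : L2 n) : bTerm (trunc n k f) j = if j = k then bTerm f k else 0 := by
  unfold bTerm
  split_ifs with h
  · rw [h, trunc_trunc_self]
  · rw [trunc_trunc_of_ne h, norm_zero, mul_zero]

lemma trunc_mem_BSpace (k : ℕ) (f : L2 n) : trunc n k f ∈ BSpace n := by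
  rw [mem_BSpace_iff]
  refine summable_of_ne_finset_zero (s := {k}) fun j hj => ?_
  rw [bTerm_trunc, if_neg (by simpa using hj)]

lemma bReal_trunc (k : ℕ) (f : L2 n) : bReal (trunc n k f) = bTerm f k := by
  unfold bReal
  rw [tsum_eq_single k fun j hj => by rw [bTerm_trunc, if_neg hj], bTerm_trunc, if_pos rfl]

/-- The tail of the dyadic decomposition tends to zero in `B`. -/
lemma tendsto_bReal_sub_sum {f : L2 n} (hf : f ∈ BSpace n) :
    Tendsto (fun N => bReal (f - ∑ k ∈ Finset.range N, trunc n k f)) atTop (𝓝 0) := by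
  have h : ∀ N, bReal (f - ∑ k ∈ Finset.range N, trunc n k f) = ∑' k, bTerm f (k + N) := by
    intro N
    have hterm : ∀ j, bTerm (f - ∑ k ∈ Finset.range N, trunc n k f) j
        = if j < N then 0 else bTerm f j := by
      intro j
      unfold bTerm
      rw [map_sub, map_sum]
      split_ifs with hj
      · rw [Finset.sum_eq_single_of_mem j (Finset.mem_range.2 hj)
          fun k _ hk => trunc_trunc_of_ne (Ne.symm hk) f, trunc_trunc_self, sub_self, norm_zero,
          mul_zero]
      · rw [Finset.sum_eq_zero fun k hk => trunc_trunc_of_ne (fun h => hj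
          (by rw [h]; exact Finset.mem_range.1 hk)) f, sub_zero]
    have hsum : Summable (bTerm (f - ∑ k ∈ Finset.range N, trunc n k f)) :=
      mem_BSpace_iff.1 (sub_mem hf (sum_mem fun k _ => trunc_mem_BSpace k f))
    unfold bReal
    rw [← hsum.sum_add_tsum_nat_add N,
      Finset.sum_eq_zero fun j hj => by rw [hterm, if_pos (Finset.mem_range.1 hj)], zero_add]
    refine tsum_congr fun k => ?_
    rw [hterm, if_neg (by omega)]
  simp only [h]
  exact tendsto_sum_nat_add (bTerm f)

end Truncation

/-! ### The resolvent form on `B × B` -/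

section Dyadic

variable {n : ℕ} {s : ℝ}

lemma le_two_mul_of_forall_scale {X D P S : ℝ} (hD : 0 ≤ D) (hP : 0 ≤ P) (hS : 0 ≤ S)
    (h : ∀ t : ℝ, 0 < t → X ≤ D * (t ^ 2 * P ^ 2 + (t⁻¹) ^ 2 * S ^ 2)) : X ≤ 2 * D * (P * S) := by
  have key : ∀ ε : ℝ, 0 < ε → X ≤ 2 * D * (P * S) + ε * (D * (P + S)) := by
    intro ε hε
    have hPε : 0 < P + ε := by linarith
    have hSε : 0 < S + ε := by linarith
    have h1 := h (Real.sqrt ((S + ε) / (P + ε))) (Real.sqrt_pos.2 (by positivity))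
    rw [inv_pow, Real.sq_sqrt (by positivity), inv_div] at h1
    have h2 : (S + ε) / (P + ε) * P ^ 2 ≤ (S + ε) * P := by
      rw [div_mul_eq_mul_div, div_le_iff₀ hPε]
      nlinarith [mul_nonneg (mul_nonneg hSε.le hP) hε.le]
    have h3 : (P + ε) / (S + ε) * S ^ 2 ≤ (P + ε) * S := by
      rw [div_mul_eq_mul_div, div_le_iff₀ hSε]
      nlinarith [mul_nonneg (mul_nonneg hPε.le hS) hε.le]
    calc X ≤ _ := h1
      _ ≤ D * ((S + ε) * P + (P + ε) * S) := by gcongr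
      _ = _ := by ring
  refine le_of_forall_pos_le_add fun η hη => ?_
  have hQ : 0 ≤ D * (P + S) := by positivity
  refine (key (η / (D * (P + S) + 1)) (by positivity)).trans ?_
  gcongr
  rw [div_mul_eq_mul_div, div_le_iff₀ (by positivity)]
  nlinarith

lemma japanese_one_le {R : ℝ} (hR : 1 ≤ R) {x : E n} (hx : ‖x‖ ≤ R) : japanese 1 x ≤ 2 * R := by
  refine (sq_le_sq₀ (japanese_pos 1 x).le (by linarith)).1 ?_
  rw [japanese_one_sq]
  nlinarith [norm_nonneg x]

lemma japanese_neg_one_eq_inv (x : E n) : japanese (-1) x = (japanese 1 x)⁻¹ := by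
  unfold japanese
  rw [neg_div, Real.rpow_neg (by positivity)]

/-- The function `1_{X_k} ⟨x⟩`. -/
noncomputable def truncWeight (n k : ℕ) (x : E n) : ℂ := annulusInd n k x * weight n 1 x

lemma norm_truncWeight_le (k : ℕ) (x : E n) :
    ‖truncWeight n k x‖ ≤ 2 * radius (k + 1) * ‖annulusInd n k x‖ := by
  unfold truncWeight annulusInd
  by_cases h : x ∈ annulus n (k + 1)
  · rw [Set.indicator_of_mem h, norm_mul, norm_weight, norm_one, one_mul, mul_one]
    exact japanese_one_le (one_le_radius k) h.2.le
  · rw [Set.indicator_of_notMem h]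
    simp

lemma memLp_truncWeight (k : ℕ) : MemLp (truncWeight n k) ∞ volume := by
  refine memLp_top_of_forall_le ((memLp_annulusInd k).1.mul
    (hasTemperateGrowth_weight 1).1.continuous.aestronglyMeasurable) (C := 2 * radius (k + 1))
    fun x => (norm_truncWeight_le k x).trans ?_
  have := radius_pos k
  exact mul_le_of_le_one_right (by positivity) (norm_annulusInd_le k x)

lemma weightOp_truncWeight (k : ℕ) (f : L2 n) :
    weightOp n (mulL2 (memLp_truncWeight (n := n) k) f) = trunc n k f := by
  apply Lp.ext
  filter_upwards [coeFn_mulL2 (memLp_weight (n := n)) (mulL2 (memLp_truncWeight (n := n) k) f),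
    coeFn_mulL2 (memLp_truncWeight (n := n) k) f,
    coeFn_mulL2 (memLp_annulusInd (n := n) k) f] with x h1 h2 h3
  unfold weightOp trunc
  rw [h1, h2, h3]
  unfold truncWeight
  have h4 := weight_mul (-1) 1 x
  rw [neg_add_cancel, weight_zero] at h4
  linear_combination (annulusInd n k x * f x) * h4

lemma norm_mulL2_truncWeight_le (k : ℕ) (f : L2 n) :
    ‖mulL2 (memLp_truncWeight (n := n) k) f‖ ≤ 2 * radius (k + 1) * ‖trunc n k f‖ := by
  refine Lp.norm_le_mul_norm_of_ae_le_mul ?_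
  filter_upwards [coeFn_mulL2 (memLp_truncWeight (n := n) k) f,
    coeFn_mulL2 (memLp_annulusInd (n := n) k) f] with x h2 h3
  unfold trunc
  rw [h2, h3, norm_mul, norm_mul, ← mul_assoc]
  exact mul_le_mul_of_nonneg_right (norm_truncWeight_le k x) (norm_nonneg _)

lemma weighted_energy_trunc_le (k : ℕ) (f : L2 n) :
    radius (k + 1) * ‖weightOp n (mulL2 (memLp_truncWeight (n := n) k) f)‖ ^ 2
      + (radius (k + 1))⁻¹ * ‖mulL2 (memLp_truncWeight (n := n) k) f‖ ^ 2 ≤ 5 * bTerm f k ^ 2 := by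
  have hR := radius_pos k
  have h1 := norm_mulL2_truncWeight_le k f
  rw [weightOp_truncWeight, bTerm, mul_pow, dyadicWeight_sq]
  calc _ ≤ radius (k + 1) * ‖trunc n k f‖ ^ 2
        + (radius (k + 1))⁻¹ * (2 * radius (k + 1) * ‖trunc n k f‖) ^ 2 := by gcongr
    _ = _ := by field_simp; ring

lemma bTerm_smul (c : ℂ) (f : L2 n) (k : ℕ) : bTerm (c • f) k = ‖c‖ * bTerm f k := by
  unfold bTerm
  rw [map_smul, norm_smul]
  ring

/-- The limiting absorption principle as a bound of the form on `B × B`. -/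
theorem norm_sesqForm_le (hn : 0 < n) (hs : 0 < s) {r : E n → ℂ}
    (hr : IsSymbolOfOrder s (scaledSymbol s r)) {δ M : ℝ} (hδ : 0 < δ) (hM : 0 ≤ M) :
    ∃ C : ℝ, 0 ≤ C ∧ ∀ z : ℂ, z.im ≠ 0 → δ ≤ ‖z‖ → |z.re| ≤ M → ∀ f g : L2 n,
      f ∈ BSpace n → g ∈ BSpace n → ‖sesqForm s r z f g‖ ≤ C * bReal f * bReal g := by
  obtain ⟨C, hC0, hC⟩ := norm_sesqForm_weight_le hn hs hr hδ hM
  refine ⟨2 * (C * 5), by positivity, fun z hz hzδ hzM f g hf hg => ?_⟩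
  obtain ⟨A, hA⟩ := exists_resolvent_operator hs hr hz
  have hpiece : ∀ (f g : L2 n) (j k : ℕ), ‖inner ℂ (trunc n k g) (A (trunc n j f))‖
      ≤ C * 5 * (bTerm f j ^ 2 + bTerm g k ^ 2) := by
    intro f g j k
    have h1 := hC z hz hzδ hzM (mulL2 (memLp_truncWeight (n := n) j) f)
      (mulL2 (memLp_truncWeight (n := n) k) g) _ _ (one_le_radius j) (one_le_radius k)
    have h2 := weighted_energy_trunc_le j f
    have h3 := weighted_energy_trunc_le k g
    have h4 : ‖inner ℂ (trunc n k g) (A (trunc n j f))‖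
        = ‖sesqForm s r z (weightOp n (mulL2 (memLp_truncWeight (n := n) j) f))
          (weightOp n (mulL2 (memLp_truncWeight (n := n) k) g))‖ := by
      rw [weightOp_truncWeight, weightOp_truncWeight, sesqForm, hA]
    rw [h4]
    calc _ ≤ _ := h1
      _ ≤ C * (5 * bTerm f j ^ 2 + 5 * bTerm g k ^ 2) := by gcongr
      _ = _ := by ring
  have hprod : ∀ j k : ℕ, ‖inner ℂ (trunc n k g) (A (trunc n j f))‖
      ≤ 2 * (C * 5) * (bTerm f j * bTerm g k) := by
    intro j k
    refine le_two_mul_of_forall_scale (by positivity) (bTerm_nonneg _ _) (bTerm_nonneg _ _)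
      fun t ht => ?_
    have h1 := hpiece ((t : ℂ) • f) (((t⁻¹ : ℝ) : ℂ) • g) j k
    have h2 : inner ℂ (trunc n k (((t⁻¹ : ℝ) : ℂ) • g)) (A (trunc n j ((t : ℂ) • f)))
        = inner ℂ (trunc n k g) (A (trunc n j f)) := by
      rw [map_smul, map_smul, map_smul, inner_smul_left, inner_smul_right, Complex.conj_ofReal,
        ← mul_assoc, ← Complex.ofReal_mul, inv_mul_cancel₀ ht.ne', Complex.ofReal_one, one_mul]
    rw [h2, bTerm_smul, bTerm_smul, Complex.norm_real, Complex.norm_real,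
      Real.norm_of_nonneg ht.le, Real.norm_of_nonneg (inv_pos.2 ht).le, mul_pow, mul_pow] at h1
    exact h1
  have hinner : ∀ j, ‖inner ℂ g (A (trunc n j f))‖ ≤ 2 * (C * 5) * bReal g * bTerm f j := by
    intro j
    have h1 : HasSum (fun k => inner ℂ (trunc n k g) (A (trunc n j f)))
        (inner ℂ g (A (trunc n j f))) := by
      have h2 := ((hasSum_trunc hn hg).mapL (innerSL ℂ (A (trunc n j f)))).star
      simpa using h2
    have h3 := (hasSum_bTerm hg).mul_left (2 * (C * 5) * bTerm f j)
    refine (h1.norm_le_of_bounded h3 fun k => ?_).trans_eq (by ring)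
    exact (hprod j k).trans_eq (by ring)
  have h4 : HasSum (fun j => inner ℂ g (A (trunc n j f))) (inner ℂ g (A f)) :=
    (hasSum_trunc hn hf).mapL ((innerSL ℂ g).comp A)
  have h5 := (hasSum_bTerm hf).mul_left (2 * (C * 5) * bReal g)
  rw [sesqForm, hA]
  exact (h4.norm_le_of_bounded h5 hinner).trans_eq (by ring)

/-! ### Density of Schwartz functions in `B` -/

lemma bTerm_weightOp_le (h : L2 n) (k : ℕ) : bTerm (weightOp n h) k ≤ 2 * (dyadicWeight k)⁻¹ * ‖h‖ := by
  have hR := radius_pos k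
  have hle : ‖trunc n k (weightOp n h)‖ ≤ 2 * (radius (k + 1))⁻¹ * ‖h‖ := by
    refine Lp.norm_le_mul_norm_of_ae_le_mul ?_
    filter_upwards [coeFn_trunc k (weightOp n h), coeFn_mulL2 (memLp_weight (n := n)) h]
      with x h1 h2
    rw [h1]
    by_cases hx : x ∈ annulus n (k + 1)
    · unfold weightOp
      rw [Set.indicator_of_mem hx, h2, norm_mul, norm_weight]
      gcongr
      rw [← div_eq_mul_inv, le_div_iff₀ hR]
      rcases k with _ | k
      · have : radius (0 + 1) = 1 := by simp [radius_succ]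
        rw [this, mul_one]
        linarith [japanese_neg_one_le_one x]
      · have h3 : radius (k + 1) < ‖x‖ := hx.1
        have h4 : radius (k + 1 + 1) = 2 * radius (k + 1) := by
          rw [radius_succ, radius_succ, pow_succ]; ring
        have h5 : ‖x‖ ≤ japanese 1 x := by
          refine (sq_le_sq₀ (norm_nonneg _) (japanese_pos 1 x).le).1 ?_
          rw [japanese_one_sq]; linarith
        rw [japanese_neg_one_eq_inv, inv_mul_le_iff₀ (japanese_pos 1 x), h4]
        linarith
    · rw [Set.indicator_of_notMem hx, norm_zero]
      positivity
  unfold bTerm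
  calc _ ≤ dyadicWeight k * (2 * (radius (k + 1))⁻¹ * ‖h‖) :=
        mul_le_mul_of_nonneg_left hle (dyadicWeight_pos k).le
    _ = _ := by
        rw [← dyadicWeight_sq]
        have := (dyadicWeight_pos k).ne'
        field_simp

lemma weightOp_mem_BSpace (h : L2 n) : weightOp n h ∈ BSpace n := by
  rw [mem_BSpace_iff]
  exact Summable.of_nonneg_of_le (bTerm_nonneg _) (bTerm_weightOp_le h)
    ((summable_inv_dyadicWeight.mul_left 2).mul_right ‖h‖)

lemma exists_bReal_weightOp_le : ∃ C : ℝ, 0 ≤ C ∧ ∀ h : L2 n, bReal (weightOp n h) ≤ C * ‖h‖ := by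
  refine ⟨∑' k, 2 * (dyadicWeight k)⁻¹, tsum_nonneg fun k => ?_, fun h => ?_⟩
  · have := dyadicWeight_pos k
    positivity
  · rw [← tsum_mul_right]
    exact (mem_BSpace_iff.1 (weightOp_mem_BSpace h)).tsum_le_tsum (bTerm_weightOp_le h)
      ((summable_inv_dyadicWeight.mul_left 2).mul_right ‖h‖)

lemma toLp_eq_weightOp (p : 𝓢(E n, ℂ)) :
    p.toLp 2 volume = weightOp n ((SchwartzMap.smulLeftCLM ℂ (weight n 1) p).toLp 2 volume) := by
  rw [weightOp_toLp, SchwartzMap.smulLeftCLM_smulLeftCLM_apply (hasTemperateGrowth_weight (-1))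
    (hasTemperateGrowth_weight 1)]
  congr 1
  ext x
  rw [SchwartzMap.smulLeftCLM_apply_apply
    ((hasTemperateGrowth_weight (-1)).mul (hasTemperateGrowth_weight 1)), Pi.mul_apply,
    weight_mul, neg_add_cancel, weight_zero, one_smul]

lemma toLp_mem_BSpace (p : 𝓢(E n, ℂ)) : p.toLp 2 volume ∈ BSpace n := by
  rw [toLp_eq_weightOp]
  exact weightOp_mem_BSpace _

/-- Schwartz functions are dense in `B`. -/
theorem exists_schwartz_bReal_sub_le {f : L2 n} (hf : f ∈ BSpace n) {ε : ℝ} (hε : 0 < ε) :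
    ∃ p : 𝓢(E n, ℂ), bReal (f - p.toLp 2 volume) ≤ ε := by
  obtain ⟨C, hC0, hC⟩ := exists_bReal_weightOp_le (n := n)
  obtain ⟨N, hN⟩ := ((tendsto_bReal_sub_sum hf).eventually_lt_const (half_pos hε)).exists
  set h := ∑ k ∈ Finset.range N, mulL2 (memLp_truncWeight (n := n) k) f with hh
  have hW : weightOp n h = ∑ k ∈ Finset.range N, trunc n k f := by
    rw [hh, map_sum]
    simp only [weightOp_truncWeight]
  obtain ⟨q, hq⟩ := Metric.denseRange_iff.1 (SchwartzMap.denseRange_toLpCLM (F := ℂ) (E := E n)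
    (μ := volume) (p := 2) (by norm_num)) h (ε / 2 / (C + 1)) (by positivity)
  refine ⟨SchwartzMap.smulLeftCLM ℂ (weight n (-1)) q, ?_⟩
  rw [← weightOp_toLp]
  have heq : f - weightOp n (q.toLp 2 volume) = (f - ∑ k ∈ Finset.range N, trunc n k f)
      + weightOp n (h - q.toLp 2 volume) := by
    rw [map_sub, hW]; abel
  rw [heq]
  refine (bReal_add_le (sub_mem hf (sum_mem fun k _ => trunc_mem_BSpace k f))
    (weightOp_mem_BSpace _)).trans ?_
  rw [dist_eq_norm, SchwartzMap.toLpCLM_apply] at hq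
  have h1 : C * ‖h - q.toLp 2 volume‖ ≤ ε / 2 := by
    calc _ ≤ C * (ε / 2 / (C + 1)) := by gcongr
      _ = C / (C + 1) * (ε / 2) := by ring
      _ ≤ 1 * (ε / 2) := by
          gcongr
          rw [div_le_one (by positivity)]
          linarith
      _ = _ := one_mul _
  linarith [hC (h - q.toLp 2 volume)]

end Dyadic

/-! ### Boundary values of the resolvent form -/

section BoundaryForm

variable {n : ℕ} {s σ : ℝ} {r : E n → ℂ}

lemma exists_tendsto_of_approx {l : Filter ℂ} [NeBot l] {F : ℂ → ℂ}
    (h : ∀ ε : ℝ, 0 < ε → ∃ (G : ℂ → ℂ) (c : ℂ), Tendsto G l (𝓝 c) ∧ ∀ᶠ z in l, ‖F z - G z‖ ≤ ε) :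
    ∃ c, Tendsto F l (𝓝 c) := by
  refine cauchy_map_iff_exists_tendsto.1 (Metric.cauchy_iff.2 ⟨inferInstance, fun ε hε => ?_⟩)
  obtain ⟨G, c, hG, hF⟩ := h (ε / 4) (by positivity)
  refine ⟨Metric.ball c (ε / 2), ?_, fun x hx y hy => ?_⟩
  · have hG' : ∀ᶠ z in l, dist (G z) c < ε / 4 :=
      hG.eventually (Metric.ball_mem_nhds c (show 0 < ε / 4 by positivity))
    refine mem_map.2 ?_
    filter_upwards [hF, hG'] with z h1 h2'
    have h1' : dist (F z) (G z) ≤ ε / 4 := by rwa [dist_eq_norm]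
    exact Metric.mem_ball.2 ((dist_triangle _ (G z) _).trans_lt (by linarith))
  · have := dist_triangle_right x y c
    rw [Metric.mem_ball] at hx hy
    linarith

lemma mul_self_of_abs_eq_one (hσ : |σ| = 1) : σ * σ = 1 := by
  rw [← abs_mul_abs_self, hσ, one_mul]

lemma tendsto_vertical (hσ : |σ| = 1) {z : ℂ} (hz : z ∈ puncturedHalfPlane σ) :
    Tendsto (fun ε : ℝ => z + σ * ε * Complex.I) (𝓝[>] 0) (𝓝[openHalfPlane σ] z) := by
  refine tendsto_nhdsWithin_iff.2 ⟨?_, ?_⟩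
  · have : Continuous fun ε : ℝ => z + σ * ε * Complex.I := by fun_prop
    have h2 := this.tendsto 0
    simp only [Complex.ofReal_zero, mul_zero, zero_mul, add_zero] at h2
    exact h2.mono_left nhdsWithin_le_nhds
  · filter_upwards [self_mem_nhdsWithin] with ε hε
    have h1 : 0 ≤ σ * z.im := hz.1
    have h2 : (0 : ℝ) < ε := hε
    have h3 : (z + σ * ε * Complex.I).im = z.im + σ * ε := by simp
    change 0 < σ * (z + σ * ε * Complex.I).im
    rw [h3, mul_add, ← mul_assoc, mul_self_of_abs_eq_one hσ]
    linarith

lemma neBot_nhdsWithin_openHalfPlane (hσ : |σ| = 1) {z : ℂ} (hz : z ∈ puncturedHalfPlane σ) :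
    NeBot (𝓝[openHalfPlane σ] z) :=
  (tendsto_vertical hσ hz).neBot

lemma mem_openHalfPlane_of_im_ne_zero (hσ : |σ| = 1) {z : ℂ} (hz : z ∈ puncturedHalfPlane σ)
    (him : z.im ≠ 0) : z ∈ openHalfPlane σ := by
  have h1 : 0 ≤ σ * z.im := hz.1
  refine lt_of_le_of_ne h1 (Ne.symm (mul_ne_zero ?_ him))
  rintro rfl
  simp at hσ

lemma sesqForm_add_left (hs : 0 < s) (hr : IsSymbolOfOrder s (scaledSymbol s r)) {z : ℂ}
    (hz : z.im ≠ 0) (f f' g : L2 n) :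
    sesqForm s r z (f + f') g = sesqForm s r z f g + sesqForm s r z f' g := by
  obtain ⟨A, hA⟩ := exists_resolvent_operator hs hr hz
  simp only [sesqForm, hA, map_add, inner_add_right]

lemma sesqForm_smul_left (hs : 0 < s) (hr : IsSymbolOfOrder s (scaledSymbol s r)) {z : ℂ}
    (hz : z.im ≠ 0) (c : ℂ) (f g : L2 n) :
    sesqForm s r z (c • f) g = c * sesqForm s r z f g := by
  obtain ⟨A, hA⟩ := exists_resolvent_operator hs hr hz
  simp only [sesqForm, hA, map_smul, inner_smul_right]

lemma sesqForm_add_right (z : ℂ) (f g g' : L2 n) :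
    sesqForm s r z f (g + g') = sesqForm s r z f g + sesqForm s r z f g' := by
  simp only [sesqForm, inner_add_left]

lemma sesqForm_smul_right (c : ℂ) (z : ℂ) (f g : L2 n) :
    sesqForm s r z f (c • g) = conj c * sesqForm s r z f g := by
  simp only [sesqForm, inner_smul_left]

lemma sesqForm_sub_sub (hs : 0 < s) (hr : IsSymbolOfOrder s (scaledSymbol s r)) {z : ℂ}
    (hz : z.im ≠ 0) (f f' g g' : L2 n) :
    sesqForm s r z f g - sesqForm s r z f' g'
      = sesqForm s r z (f - f') g + sesqForm s r z f' (g - g') := by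
  obtain ⟨A, hA⟩ := exists_resolvent_operator hs hr hz
  simp only [sesqForm, hA, map_sub, inner_sub_left, inner_sub_right]
  ring

lemma eventually_region {z₀ : ℂ} (l : Set ℂ) {δ M : ℝ} (hδ : δ < ‖z₀‖) (hM : |z₀.re| < M) :
    ∀ᶠ z in 𝓝[l] z₀, δ ≤ ‖z‖ ∧ |z.re| ≤ M := by
  have h1 : ∀ᶠ z : ℂ in 𝓝 z₀, δ < ‖z‖ := continuous_norm.continuousAt.eventually_const_lt hδ
  have h2 : ∀ᶠ z : ℂ in 𝓝 z₀, |z.re| < M :=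
    (Complex.continuous_re.abs).continuousAt.eventually_lt_const hM
  filter_upwards [mem_nhdsWithin_of_mem_nhds h1, mem_nhdsWithin_of_mem_nhds h2] with z h3 h4
  exact ⟨le_of_lt h3, le_of_lt h4⟩

theorem exists_tendsto_sesqForm (hn : 0 < n) (hs : 0 < s)
    (hr : IsSymbolOfOrder s (scaledSymbol s r)) (hσ : |σ| = 1) {z₀ : ℂ}
    (hz₀ : z₀ ∈ puncturedHalfPlane σ) {f g : L2 n} (hf : f ∈ BSpace n) (hg : g ∈ BSpace n) :
    ∃ l, Tendsto (fun z => sesqForm s r z f g) (𝓝[openHalfPlane σ] z₀) (𝓝 l) := by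
  have := neBot_nhdsWithin_openHalfPlane hσ hz₀
  have hpos := norm_pos_iff.2 hz₀.2
  obtain ⟨C, hC0, hC⟩ := norm_sesqForm_le hn hs hr (δ := ‖z₀‖ / 2) (M := |z₀.re| + 1)
    (by positivity) (by positivity)
  refine exists_tendsto_of_approx fun ε hε => ?_
  have hg0 := bReal_nonneg g
  obtain ⟨p, hp⟩ := exists_schwartz_bReal_sub_le hf (ε := ε / 2 / (C * bReal g + 1))
    (by positivity)
  have hp0 := bReal_nonneg (p.toLp 2 volume)
  obtain ⟨k, hk⟩ := exists_schwartz_bReal_sub_le hg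
    (ε := ε / 2 / (C * bReal (p.toLp 2 volume) + 1)) (by positivity)
  obtain ⟨c, hc⟩ := tendsto_sesqForm_toLp hn hs hr hσ hz₀.1 hz₀.2 p k
  refine ⟨_, c, hc, ?_⟩
  filter_upwards [self_mem_nhdsWithin, eventually_region (openHalfPlane σ)
    (half_lt_self hpos) (lt_add_one |z₀.re|)] with z hz hreg
  have him := im_ne_zero_of_mem hz
  rw [sesqForm_sub_sub hs hr him]
  refine (norm_add_le _ _).trans ?_
  have h1 := hC z him hreg.1 hreg.2 _ _ (sub_mem hf (toLp_mem_BSpace p)) hg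
  have h2 := hC z him hreg.1 hreg.2 _ _ (toLp_mem_BSpace p) (sub_mem hg (toLp_mem_BSpace k))
  have aux : ∀ Q η : ℝ, 0 ≤ Q → 0 < η → Q * (η / (Q + 1)) ≤ η := by
    intro Q η hQ hη
    rw [← mul_div_assoc, div_le_iff₀ (by positivity)]
    nlinarith
  have h3 : C * bReal (f - p.toLp 2 volume) * bReal g ≤ ε / 2 := by
    calc _ = (C * bReal g) * bReal (f - p.toLp 2 volume) := by ring
      _ ≤ (C * bReal g) * (ε / 2 / (C * bReal g + 1)) := by gcongr
      _ ≤ _ := aux _ _ (by positivity) (by positivity)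
  have h4 : C * bReal (p.toLp 2 volume) * bReal (g - k.toLp 2 volume) ≤ ε / 2 := by
    calc _ ≤ (C * bReal (p.toLp 2 volume)) * (ε / 2 / (C * bReal (p.toLp 2 volume) + 1)) := by
          gcongr
      _ ≤ _ := aux _ _ (by positivity) (by positivity)
  linarith

/-- The form `⟨r(D) R_0(z) f, g⟩` extended to the boundary of the half plane. -/
noncomputable def boundaryForm (σ s : ℝ) (r : E n → ℂ) (f g : L2 n) : ℂ → ℂ :=
  extendFrom (openHalfPlane σ) fun z => sesqForm s r z f g

lemma tendsto_boundaryForm (hn : 0 < n) (hs : 0 < s)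
    (hr : IsSymbolOfOrder s (scaledSymbol s r)) (hσ : |σ| = 1) {z : ℂ}
    (hz : z ∈ puncturedHalfPlane σ) {f g : L2 n} 
    (hf : f ∈ BSpace n) (hg : g ∈ BSpace n) :
    Tendsto (fun w => sesqForm s r w f g) (𝓝[openHalfPlane σ] z) (𝓝 (boundaryForm σ s r f g z)) :=
  tendsto_extendFrom (exists_tendsto_sesqForm hn hs hr hσ hz hf hg)

lemma boundaryForm_eq (hn : 0 < n) (hs : 0 < s)
    (hr : IsSymbolOfOrder s (scaledSymbol s r)) (hσ : |σ| = 1) {z : ℂ}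
    (hz : z ∈ puncturedHalfPlane σ) {f g : L2 n} 
    (hf : f ∈ BSpace n) (hg : g ∈ BSpace n) (him : z.im ≠ 0) :
    boundaryForm σ s r f g z = sesqForm s r z f g := by
  have hmem := mem_openHalfPlane_of_im_ne_zero hσ hz him
  have h := (tendsto_boundaryForm hn hs hr hσ hz hf hg).mono_left
    (show pure z ≤ 𝓝[openHalfPlane σ] z from pure_le_nhdsWithin hmem)
  exact tendsto_nhds_unique h (tendsto_pure_nhds _ _)

lemma boundaryForm_add_left (hn : 0 < n) (hs : 0 < s)
    (hr : IsSymbolOfOrder s (scaledSymbol s r)) (hσ : |σ| = 1) {z : ℂ}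
    (hz : z ∈ puncturedHalfPlane σ) {f f' g : L2 n} 
    (hf : f ∈ BSpace n) (hf' : f' ∈ BSpace n) (hg : g ∈ BSpace n) :
    boundaryForm σ s r (f + f') g z = boundaryForm σ s r f g z + boundaryForm σ s r f' g z := by
  have := neBot_nhdsWithin_openHalfPlane hσ hz
  refine tendsto_nhds_unique (tendsto_boundaryForm hn hs hr hσ hz (add_mem hf hf') hg)
    (((tendsto_boundaryForm hn hs hr hσ hz hf hg).add
      (tendsto_boundaryForm hn hs hr hσ hz hf' hg)).congr' ?_)
  filter_upwards [self_mem_nhdsWithin] with w hw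
  exact (sesqForm_add_left hs hr (im_ne_zero_of_mem hw) f f' g).symm

lemma boundaryForm_smul_left (hn : 0 < n) (hs : 0 < s)
    (hr : IsSymbolOfOrder s (scaledSymbol s r)) (hσ : |σ| = 1) {z : ℂ}
    (hz : z ∈ puncturedHalfPlane σ) {f g : L2 n} 
    (c : ℂ) (hf : f ∈ BSpace n) (hg : g ∈ BSpace n) :
    boundaryForm σ s r (c • f) g z = c * boundaryForm σ s r f g z := by
  have := neBot_nhdsWithin_openHalfPlane hσ hz
  refine tendsto_nhds_unique
    (tendsto_boundaryForm hn hs hr hσ hz ((BSpace n).smul_mem c hf) hg)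
    (((tendsto_boundaryForm hn hs hr hσ hz hf hg).const_mul c).congr' ?_)
  filter_upwards [self_mem_nhdsWithin] with w hw
  exact (sesqForm_smul_left hs hr (im_ne_zero_of_mem hw) c f g).symm

lemma boundaryForm_add_right (hn : 0 < n) (hs : 0 < s)
    (hr : IsSymbolOfOrder s (scaledSymbol s r)) (hσ : |σ| = 1) {z : ℂ}
    (hz : z ∈ puncturedHalfPlane σ) {f g g' : L2 n} 
    (hf : f ∈ BSpace n) (hg : g ∈ BSpace n) (hg' : g' ∈ BSpace n) :
    boundaryForm σ s r f (g + g') z = boundaryForm σ s r f g z + boundaryForm σ s r f g' z := by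
  have := neBot_nhdsWithin_openHalfPlane hσ hz
  exact tendsto_nhds_unique (tendsto_boundaryForm hn hs hr hσ hz hf (add_mem hg hg'))
    (((tendsto_boundaryForm hn hs hr hσ hz hf hg).add
      (tendsto_boundaryForm hn hs hr hσ hz hf hg')).congr
        fun w => (sesqForm_add_right w f g g').symm)

lemma boundaryForm_smul_right (hn : 0 < n) (hs : 0 < s)
    (hr : IsSymbolOfOrder s (scaledSymbol s r)) (hσ : |σ| = 1) {z : ℂ}
    (hz : z ∈ puncturedHalfPlane σ) {f g : L2 n} 
    (c : ℂ) (hf : f ∈ BSpace n) (hg : g ∈ BSpace n) :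
    boundaryForm σ s r f (c • g) z = conj c * boundaryForm σ s r f g z := by
  have := neBot_nhdsWithin_openHalfPlane hσ hz
  exact tendsto_nhds_unique
    (tendsto_boundaryForm hn hs hr hσ hz hf ((BSpace n).smul_mem c hg))
    (((tendsto_boundaryForm hn hs hr hσ hz hf hg).const_mul (conj c)).congr
      fun w => (sesqForm_smul_right c w f g).symm)

lemma continuousOn_boundaryForm (hn : 0 < n) (hs : 0 < s)
    (hr : IsSymbolOfOrder s (scaledSymbol s r)) (hσ : |σ| = 1) {f g : L2 n} (hf : f ∈ BSpace n)
    (hg : g ∈ BSpace n) : ContinuousOn (boundaryForm σ s r f g) (puncturedHalfPlane σ) :=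
  continuousOn_extendFrom
    (fun _ hz => mem_closure_iff_nhdsWithin_neBot.2 (neBot_nhdsWithin_openHalfPlane hσ hz))
    fun _ hz => exists_tendsto_sesqForm hn hs hr hσ hz hf hg

lemma norm_boundaryForm_le (hn : 0 < n) (hs : 0 < s)
    (hr : IsSymbolOfOrder s (scaledSymbol s r)) (hσ : |σ| = 1) {δ M : ℝ} (hδ : 0 < δ)
    (hM : 0 ≤ M) :
    ∃ C : ℝ, 0 ≤ C ∧ ∀ z ∈ puncturedHalfPlane σ, δ ≤ ‖z‖ → |z.re| ≤ M → ∀ f ∈ BSpace n,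
      ∀ g ∈ BSpace n, ‖boundaryForm σ s r f g z‖ ≤ C * bReal f * bReal g := by
  obtain ⟨C, hC0, hC⟩ := norm_sesqForm_le hn hs hr (δ := δ / 2) (M := M + 1)
    (by positivity) (by positivity)
  refine ⟨C, hC0, fun z hz hzδ hzM f hf g hg => ?_⟩
  have := neBot_nhdsWithin_openHalfPlane hσ hz
  refine le_of_tendsto (tendsto_boundaryForm hn hs hr hσ hz hf hg).norm ?_
  filter_upwards [self_mem_nhdsWithin, eventually_region (openHalfPlane σ)
    (show δ / 2 < ‖z‖ by linarith) (show |z.re| < M + 1 by linarith)] with w hw hreg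
  exact hC w (im_ne_zero_of_mem hw) hreg.1 hreg.2 f g hf hg

end BoundaryForm

/-! ### Duality between `B` and `B^*` -/

section Duality

variable {n : ℕ}

lemma restrict_iUnion_annulus (hn : 0 < n) :
    (volume : Measure (E n)).restrict (⋃ k, annulus n (k + 1)) = volume :=
  Measure.restrict_eq_self_of_ae_mem
    ((ae_exists_mem_annulus hn).mono fun _ hx => Set.mem_iUnion.2 hx)

lemma pairwise_disjoint_annulus :
    Pairwise (Function.onFun Disjoint fun k => annulus n (k + 1)) :=
  fun _ _ hjk => disjoint_annulus hjk

lemma ae_of_forall_ae_annulus (hn : 0 < n) {p : E n → Prop}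
    (h : ∀ k, ∀ᵐ x ∂(volume.restrict (annulus n (k + 1))), p x) : ∀ᵐ x : E n ∂volume, p x := by
  rw [← restrict_iUnion_annulus hn]
  exact ae_restrict_iUnion_iff _ _ |>.2 h

lemma memLp_two_annulus {v : E n →ₘ[volume] ℂ} (hv : v ∈ BStar n) (k : ℕ) :
    MemLp v 2 (volume.restrict (annulus n k)) := by
  refine MemLp.mono_measure ?_ (hv.1 _ (isCompact_closedBall (0 : E n) (radius k)))
  refine Measure.restrict_mono (fun x hx => ?_) le_rfl
  simpa using hx.2.le

lemma eLpNorm_annulus_le_bStarNorm (v : E n →ₘ[volume] ℂ) (k : ℕ) :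
    eLpNorm v 2 (volume.restrict (annulus n (k + 1)))
      ≤ ENNReal.ofReal (dyadicWeight k) * bStarNorm v := by
  have h := le_iSup (fun k : ℕ => ENNReal.ofReal (radius (k + 1) ^ (-(1 / 2) : ℝ)) *
      eLpNorm v 2 (volume.restrict (annulus n (k + 1)))) k
  have hw := dyadicWeight_pos k
  calc _ = ENNReal.ofReal (dyadicWeight k) * (ENNReal.ofReal (radius (k + 1) ^ (-(1 / 2) : ℝ)) *
      eLpNorm v 2 (volume.restrict (annulus n (k + 1)))) := by
        rw [← mul_assoc, ← ENNReal.ofReal_mul hw.le, inv_dyadicWeight, mul_inv_cancel₀ hw.ne',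
          ENNReal.ofReal_one, one_mul]
    _ ≤ _ := mul_le_mul_right h _

lemma bStarNorm_le_iff {v : E n →ₘ[volume] ℂ} {K : ℝ} :
    bStarNorm v ≤ ENNReal.ofReal K ↔ ∀ k, eLpNorm v 2 (volume.restrict (annulus n (k + 1)))
      ≤ ENNReal.ofReal (dyadicWeight k * K) := by
  constructor
  · intro h k
    refine (eLpNorm_annulus_le_bStarNorm v k).trans ?_
    rw [ENNReal.ofReal_mul (dyadicWeight_pos k).le]
    exact mul_le_mul_right h _
  · intro h
    refine iSup_le fun k => ?_
    have hw := dyadicWeight_pos k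
    calc _ ≤ ENNReal.ofReal (radius (k + 1) ^ (-(1 / 2) : ℝ))
          * ENNReal.ofReal (dyadicWeight k * K) := mul_le_mul_right (h k) _
      _ = ENNReal.ofReal K := by
          rw [← ENNReal.ofReal_mul (by rw [inv_dyadicWeight]; positivity), inv_dyadicWeight,
            ← mul_assoc, inv_mul_cancel₀ hw.ne', one_mul]

lemma eq_zero_of_bStarNorm_eq_zero (hn : 0 < n) {v : E n →ₘ[volume] ℂ} (hv : bStarNorm v = 0) :
    v = 0 := by
  apply AEEqFun.ext
  have h : ∀ᵐ x : E n ∂volume, v x = 0 := by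
    refine ae_of_forall_ae_annulus hn fun k => ?_
    have h1 := eLpNorm_annulus_le_bStarNorm v k
    rw [hv, mul_zero] at h1
    exact (eLpNorm_eq_zero_iff v.aestronglyMeasurable.restrict (by norm_num)).1
      (le_antisymm h1 zero_le)
  filter_upwards [h, AEEqFun.coeFn_zero (μ := (volume : Measure (E n))) (β := ℂ)] with x h1 h2
  rw [h1, h2, Pi.zero_apply]

/-- The `B^*` norm as a real number. -/
noncomputable def bStarReal (v : E n →ₘ[volume] ℂ) : ℝ := (bStarNorm v).toReal

lemma bStarReal_nonneg (v : E n →ₘ[volume] ℂ) : 0 ≤ bStarReal v := ENNReal.toReal_nonneg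

lemma bStarNorm_eq_ofReal {v : E n →ₘ[volume] ℂ} (hv : v ∈ BStar n) :
    bStarNorm v = ENNReal.ofReal (bStarReal v) :=
  (ENNReal.ofReal_toReal hv.2.ne).symm

lemma integrableOn_annulus_mul_conj {v : E n →ₘ[volume] ℂ} (hv : v ∈ BStar n) (g : L2 n) (k : ℕ) :
    IntegrableOn (fun x => v x * conj (g x)) (annulus n (k + 1)) :=
  (memLp_two_annulus hv _).integrable_mul ((Lp.memLp g).restrict _).star

lemma setIntegral_norm_mul_conj_le {v : E n →ₘ[volume] ℂ} (hv : v ∈ BStar n) (g : L2 n) (k : ℕ) :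
    ∫ x in annulus n (k + 1), ‖v x * conj (g x)‖ ≤ bStarReal v * bTerm g k := by
  have h1 : eLpNorm (fun x => v x * conj (g x)) 1 (volume.restrict (annulus n (k + 1)))
      ≤ eLpNorm v 2 (volume.restrict (annulus n (k + 1)))
        * eLpNorm g 2 (volume.restrict (annulus n (k + 1))) := by
    have h2 := eLpNorm_smul_le_mul_eLpNorm (p := 2) (q := 2) (r := 1)
      (f := fun x => conj (g x)) (φ := v) (μ := volume.restrict (annulus n (k + 1)))
      ((Lp.memLp g).restrict _).star.1 v.aestronglyMeasurable.restrict
    refine h2.trans_eq ?_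
    congr 1
    exact eLpNorm_congr_norm_ae (ae_of_all _ fun x => RCLike.norm_conj _)
  have h3 : eLpNorm (fun x => v x * conj (g x)) 1 (volume.restrict (annulus n (k + 1)))
      ≤ ENNReal.ofReal (bStarReal v * bTerm g k) := by
    refine h1.trans ?_
    rw [← enorm_trunc, bTerm, mul_left_comm, ← mul_assoc,
      ENNReal.ofReal_mul (mul_nonneg (dyadicWeight_pos k).le (bStarReal_nonneg v)),
      ENNReal.ofReal_mul (dyadicWeight_pos k).le, ← bStarNorm_eq_ofReal hv, ofReal_norm]
    exact mul_le_mul_left (eLpNorm_annulus_le_bStarNorm v k) _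
  rw [eLpNorm_one_eq_lintegral_enorm] at h3
  rw [integral_norm_eq_lintegral_enorm (integrableOn_annulus_mul_conj hv g k).1]
  exact ENNReal.toReal_le_of_le_ofReal
    (mul_nonneg (bStarReal_nonneg v) (bTerm_nonneg g k)) h3

lemma integrable_mul_conj_of_mem (hn : 0 < n) {v : E n →ₘ[volume] ℂ} (hv : v ∈ BStar n) {g : L2 n}
    (hg : g ∈ BSpace n) : Integrable fun x => v x * conj (g x) := by
  have h := integrableOn_iUnion_of_summable_integral_norm
    (fun k => integrableOn_annulus_mul_conj hv g k)
    (Summable.of_nonneg_of_le (fun k => integral_nonneg fun x => norm_nonneg _)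
      (setIntegral_norm_mul_conj_le hv g) ((mem_BSpace_iff.1 hg).mul_left _))
  rwa [IntegrableOn, restrict_iUnion_annulus hn] at h

lemma hasSum_pairing (hn : 0 < n) (v : BStar n) (g : BSpace n) :
    HasSum (fun k => ∫ x in annulus n (k + 1), (v : E n →ₘ[volume] ℂ) x * conj ((g : L2 n) x))
      (pairing v g) := by
  have hi := integrable_mul_conj_of_mem hn v.2 g.2
  have h := hasSum_integral_iUnion (fun k => measurableSet_annulus (n := n) (k + 1))
    pairwise_disjoint_annulus (hi.integrableOn (s := ⋃ k, annulus n (k + 1)))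
  rwa [restrict_iUnion_annulus hn] at h

lemma norm_pairing_le (hn : 0 < n) (v : BStar n) (g : BSpace n) :
    ‖pairing v g‖ ≤ bStarReal (v : E n →ₘ[volume] ℂ) * bReal (g : L2 n) :=
  (hasSum_pairing hn v g).norm_le_of_bounded ((hasSum_bTerm g.2).mul_left _) fun k =>
    (norm_integral_le_integral_norm _).trans (setIntegral_norm_mul_conj_le v.2 g k)

lemma pairing_add_left (hn : 0 < n) (v w : BStar n) (g : BSpace n) :
    pairing (v + w) g = pairing v g + pairing w g := by
  unfold pairing
  rw [← integral_add (integrable_mul_conj_of_mem hn v.2 g.2)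
    (integrable_mul_conj_of_mem hn w.2 g.2)]
  refine integral_congr_ae ?_
  filter_upwards [AEEqFun.coeFn_add (v : E n →ₘ[volume] ℂ) w] with x hx
  rw [Submodule.coe_add, hx, Pi.add_apply, add_mul]

lemma pairing_smul_left (c : ℂ) (v : BStar n) (g : BSpace n) :
    pairing (c • v) g = c * pairing v g := by
  unfold pairing
  rw [← integral_const_mul]
  refine integral_congr_ae ?_
  filter_upwards [AEEqFun.coeFn_smul c (v : E n →ₘ[volume] ℂ)] with x hx
  rw [Submodule.coe_smul, hx, Pi.smul_apply, smul_eq_mul, mul_assoc]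

lemma pairing_sub_left (hn : 0 < n) (v w : BStar n) (g : BSpace n) :
    pairing (v - w) g = pairing v g - pairing w g := by
  have h := pairing_add_left hn (v - w) w g
  have h2 : v - w + w = v := sub_add_cancel v w
  rw [h2] at h
  rw [h]; ring

lemma pairing_sub_right (hn : 0 < n) (v : BStar n) (g g' : BSpace n) :
    pairing v (g - g') = pairing v g - pairing v g' := by
  unfold pairing
  rw [← integral_sub (integrable_mul_conj_of_mem hn v.2 g.2)
    (integrable_mul_conj_of_mem hn v.2 g'.2)]
  refine integral_congr_ae ?_
  filter_upwards [Lp.coeFn_sub (g : L2 n) g'] with x hx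
  rw [Submodule.coe_sub, hx, Pi.sub_apply, map_sub, mul_sub]

/-- The pairing separates the points of `B^*`. -/
lemma eq_zero_of_pairing (hn : 0 < n) {v : BStar n} (hv : ∀ g : BSpace n, pairing v g = 0) :
    v = 0 := by
  apply Subtype.ext
  apply AEEqFun.ext
  have h : ∀ᵐ x : E n ∂volume, (v : E n →ₘ[volume] ℂ) x = 0 := by
    refine ae_of_forall_ae_annulus hn fun k => ?_
    have hmem : MemLp ((annulus n (k + 1)).indicator (v : E n →ₘ[volume] ℂ)) 2 volume :=
      (memLp_indicator_iff_restrict (measurableSet_annulus _)).2 (memLp_two_annulus v.2 _)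
    have hB : trunc n k (hmem.toLp _) = hmem.toLp _ := by
      apply Lp.ext
      filter_upwards [coeFn_trunc k (hmem.toLp _), hmem.coeFn_toLp] with x h1 h2
      rw [h1]
      by_cases hx : x ∈ annulus n (k + 1)
      · rw [Set.indicator_of_mem hx]
      · rw [h2, Set.indicator_of_notMem hx, Set.indicator_of_notMem hx]
    have h1 := hv ⟨hmem.toLp _, hB ▸ trunc_mem_BSpace k _⟩
    unfold pairing at h1
    have h2 : ∫ x, (v : E n →ₘ[volume] ℂ) x * conj ((hmem.toLp _ : L2 n) x)
        = ∫ x, ((‖(annulus n (k + 1)).indicator (v : E n →ₘ[volume] ℂ) x‖ ^ 2 : ℝ) : ℂ) := by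
      refine integral_congr_ae ?_
      filter_upwards [hmem.coeFn_toLp] with x hx
      rw [hx]
      by_cases hx' : x ∈ annulus n (k + 1)
      · rw [Set.indicator_of_mem hx', Complex.mul_conj, Complex.normSq_eq_norm_sq]
      · rw [Set.indicator_of_notMem hx']
        simp
    rw [h2, integral_complex_ofReal, Complex.ofReal_eq_zero] at h1
    have h3 := (integral_eq_zero_iff_of_nonneg (fun x => by positivity)
      ((memLp_two_iff_integrable_sq_norm hmem.1).1 hmem)).1 h1
    rw [ae_restrict_iff' (measurableSet_annulus _)]
    filter_upwards [h3] with x hx hx'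
    rw [Set.indicator_of_mem hx'] at hx
    simpa using hx
  filter_upwards [h, AEEqFun.coeFn_zero (μ := (volume : Measure (E n))) (β := ℂ)] with x h1 h2
  rw [h1, Submodule.coe_zero, h2, Pi.zero_apply]

lemma exists_glue (hn : 0 < n) (y : ℕ → L2 n) :
    ∃ v : E n →ₘ[volume] ℂ, ∀ k, v =ᵐ[volume.restrict (annulus n (k + 1))] y k := by
  set f : E n → ℂ := fun x => ∑' k, (annulus n (k + 1)).indicator (y k) x with hf
  have hfk : ∀ k, ∀ x ∈ annulus n (k + 1), f x = y k x := by
    intro k x hx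
    have h1 : f x = (annulus n (k + 1)).indicator (y k) x :=
      tsum_eq_single k fun j hj => Set.indicator_of_notMem
        (Set.disjoint_left.1 (disjoint_annulus hj.symm) hx) _
    rw [h1, Set.indicator_of_mem hx]
  have hk : ∀ k, f =ᵐ[volume.restrict (annulus n (k + 1))] y k := fun k =>
    (ae_restrict_mem (measurableSet_annulus _)).mono (hfk k)
  have hmeas : AEStronglyMeasurable f volume := by
    rw [← restrict_iUnion_annulus hn, aestronglyMeasurable_iUnion_iff]
    exact fun k => ((Lp.aestronglyMeasurable (y k)).restrict).congr (hk k).symm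
  exact ⟨AEEqFun.mk f hmeas, fun k =>
    Filter.EventuallyEq.trans (ae_restrict_of_ae (AEEqFun.coeFn_mk f hmeas)) (hk k)⟩

lemma mem_BStar_of_glue (hn : 0 < n) {y : ℕ → L2 n} {v : E n →ₘ[volume] ℂ}
    (hv : ∀ k, v =ᵐ[volume.restrict (annulus n (k + 1))] y k) {K : ℝ}
    (hy : ∀ k, ‖y k‖ ≤ dyadicWeight k * K) :
    v ∈ BStar n ∧ bStarNorm v ≤ ENNReal.ofReal K := by
  have hb : bStarNorm v ≤ ENNReal.ofReal K := by
    refine bStarNorm_le_iff.2 fun k => ?_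
    rw [eLpNorm_congr_ae (hv k), ← enorm_trunc, ← ofReal_norm]
    exact ENNReal.ofReal_le_ofReal ((norm_trunc_le k _).trans (hy k))
  refine ⟨⟨fun S hS => ?_, hb.trans_lt ENNReal.ofReal_lt_top⟩, hb⟩
  obtain ⟨R, hR⟩ := hS.isBounded.exists_norm_le
  obtain ⟨N, hN⟩ := (tendsto_radius.eventually_gt_atTop R).exists
  have hmeas : AEStronglyMeasurable v (volume.restrict S) := v.aestronglyMeasurable.restrict
  have hag : v =ᵐ[volume.restrict S] (∑ k ∈ Finset.range N, trunc n k (y k) : L2 n) := by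
    have h1 : ∀ᵐ x : E n ∂volume, ∀ k, x ∈ annulus n (k + 1) → v x = y k x :=
      ae_all_iff.2 fun k => (ae_restrict_iff' (measurableSet_annulus _)).1 (hv k)
    have h2 : ∀ᵐ x : E n ∂volume, ∀ k, trunc n k (y k) x
        = (annulus n (k + 1)).indicator (y k) x := ae_all_iff.2 fun k => coeFn_trunc k (y k)
    have hSm : ∀ᵐ x ∂(volume.restrict S), x ∈ S := ae_restrict_mem hS.measurableSet
    filter_upwards [hSm, ae_restrict_of_ae h1, ae_restrict_of_ae h2,
      ae_restrict_of_ae (ae_exists_mem_annulus hn), ae_restrict_of_ae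
      (Lp.coeFn_finsetSum (Finset.range N) fun k => trunc n k (y k))] with x hx h1 h2 h3 h4
    obtain ⟨k, hk⟩ := h3
    rw [h4, h1 k hk, Finset.sum_apply, Finset.sum_eq_single_of_mem k]
    · rw [h2, Set.indicator_of_mem hk]
    · rw [Finset.mem_range]
      by_contra hcon
      have h5 : radius N ≤ radius k := radius_mono (not_lt.1 hcon)
      have h6 : radius k < ‖x‖ := hk.1
      linarith [hR x hx]
    · intro j _ hj
      rw [h2, Set.indicator_of_notMem (Set.disjoint_left.1 (disjoint_annulus hj.symm) hk)]
  exact ((Lp.memLp _).restrict S).ae_eq hag.symm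

/-- Riesz representation of bounded antilinear functionals on `B`. -/
theorem exists_pairing_eq (hn : 0 < n) {Λ : L2 n → ℂ} {K : ℝ} (hK : 0 ≤ K)
    (hadd : ∀ f ∈ BSpace n, ∀ g ∈ BSpace n, Λ (f + g) = Λ f + Λ g)
    (hsmul : ∀ (c : ℂ), ∀ f ∈ BSpace n, Λ (c • f) = conj c * Λ f)
    (hbd : ∀ f ∈ BSpace n, ‖Λ f‖ ≤ K * bReal f) :
    ∃ v : BStar n, bStarNorm (v : E n →ₘ[volume] ℂ) ≤ ENNReal.ofReal K ∧
      ∀ g : BSpace n, pairing v g = Λ g := by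
  have hℓ : ∀ k, ∃ y : L2 n, ‖y‖ ≤ dyadicWeight k * K ∧
      ∀ g : L2 n, Λ (trunc n k g) = inner ℂ g y := by
    intro k
    have hw := dyadicWeight_pos k
    have hbound : ∀ g : L2 n, ‖conj (Λ (trunc n k g))‖ ≤ dyadicWeight k * K * ‖g‖ := by
      intro g
      rw [RCLike.norm_conj]
      refine (hbd _ (trunc_mem_BSpace k g)).trans ?_
      rw [bReal_trunc, bTerm]
      calc _ ≤ K * (dyadicWeight k * ‖g‖) := by gcongr; exact norm_trunc_le k g
        _ = _ := by ring
    let ℓ : L2 n →L[ℂ] ℂ := LinearMap.mkContinuous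
      { toFun := fun g => conj (Λ (trunc n k g))
        map_add' := fun f g => by
          rw [map_add, hadd _ (trunc_mem_BSpace k f) _ (trunc_mem_BSpace k g), map_add]
        map_smul' := fun c f => by
          rw [map_smul, hsmul _ _ (trunc_mem_BSpace k f), map_mul, Complex.conj_conj]
          rfl } (dyadicWeight k * K) hbound
    refine ⟨(InnerProductSpace.toDual ℂ (L2 n)).symm ℓ, ?_, fun g => ?_⟩
    · rw [LinearIsometryEquiv.norm_map]
      exact LinearMap.mkContinuous_norm_le _ (by positivity) _
    · rw [← inner_conj_symm, InnerProductSpace.toDual_symm_apply]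
      exact (Complex.conj_conj _).symm
  choose y hy hyΛ using hℓ
  obtain ⟨v, hv⟩ := exists_glue hn y
  obtain ⟨hvB, hvK⟩ := mem_BStar_of_glue hn hv hy
  refine ⟨⟨v, hvB⟩, hvK, fun g => ?_⟩
  have hterm : ∀ k, ∫ x in annulus n (k + 1), v x * conj ((g : L2 n) x)
      = Λ (trunc n k (g : L2 n)) := by
    intro k
    rw [← trunc_trunc_self, hyΛ, inner_eq_integral,
      ← integral_indicator (measurableSet_annulus _)]
    refine integral_congr_ae ?_
    filter_upwards [coeFn_trunc k (g : L2 n),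
      (ae_restrict_iff' (measurableSet_annulus _)).1 (hv k)] with x h1 h2
    rw [h1]
    by_cases hx : x ∈ annulus n (k + 1)
    · rw [Set.indicator_of_mem hx, Set.indicator_of_mem hx, h2 hx]
    · rw [Set.indicator_of_notMem hx, Set.indicator_of_notMem hx, map_zero, mul_zero]
  have h1 := (hasSum_pairing hn ⟨v, hvB⟩ g).tendsto_sum_nat
  simp only [hterm] at h1
  have hsum : ∀ N, ∑ k ∈ Finset.range N, Λ (trunc n k (g : L2 n))
      = Λ g - Λ ((g : L2 n) - ∑ k ∈ Finset.range N, trunc n k (g : L2 n)) := by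
    intro N
    have hmem : ∀ N, ∑ k ∈ Finset.range N, trunc n k (g : L2 n) ∈ BSpace n := fun N =>
      sum_mem fun k _ => trunc_mem_BSpace k _
    have hΛ0 : Λ 0 = 0 := by
      have := hsmul 0 0 (zero_mem _)
      simpa using this
    have hΛsum : ∀ N, Λ (∑ k ∈ Finset.range N, trunc n k (g : L2 n))
        = ∑ k ∈ Finset.range N, Λ (trunc n k (g : L2 n)) := by
      intro N
      induction N with
      | zero => simpa using hΛ0
      | succ N ih =>
        rw [Finset.sum_range_succ, Finset.sum_range_succ,
          hadd _ (hmem N) _ (trunc_mem_BSpace N _), ih]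
    have h2 := hadd _ (sub_mem g.2 (hmem N)) _ (hmem N)
    rw [sub_add_cancel, hΛsum] at h2
    rw [h2]; ring
  simp only [hsum] at h1
  have h3 : Tendsto (fun N => Λ ((g : L2 n) - ∑ k ∈ Finset.range N, trunc n k (g : L2 n))) atTop
      (𝓝 0) := by
    refine squeeze_zero_norm (fun N => hbd _ (sub_mem g.2
      (sum_mem fun k _ => trunc_mem_BSpace k _))) ?_
    simpa using (tendsto_bReal_sub_sum g.2).const_mul K
  have h4 := (tendsto_const_nhds (x := Λ g)).sub h3
  rw [sub_zero] at h4
  exact tendsto_nhds_unique h1 h4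

lemma coeFn_mem_BStar (f : L2 n) : (f : E n →ₘ[volume] ℂ) ∈ BStar n := by
  refine ⟨fun S _ => (Lp.memLp f).restrict S, ?_⟩
  refine (bStarNorm_le_iff (K := ‖f‖) |>.2 fun k => ?_).trans_lt ENNReal.ofReal_lt_top
  refine (eLpNorm_restrict_le _ _ _ _).trans ?_
  have h1 : eLpNorm (f : E n →ₘ[volume] ℂ) 2 volume = ENNReal.ofReal ‖f‖ := by
    rw [ofReal_norm, Lp.enorm_def]
  rw [h1]
  exact ENNReal.ofReal_le_ofReal (le_mul_of_one_le_left (norm_nonneg _) (one_le_dyadicWeight k))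

end Duality

/-! ### The extended resolvent -/

section Extension

variable {n : ℕ} {s σ : ℝ} {r : E n → ℂ}

lemma bStarNorm_le_of_pairing (hn : 0 < n) {v : BStar n} {K : ℝ} (hK : 0 ≤ K)
    (hv : ∀ g : BSpace n, ‖pairing v g‖ ≤ K * bReal (g : L2 n)) :
    bStarNorm (v : E n →ₘ[volume] ℂ) ≤ ENNReal.ofReal K := by
  have hi : ∀ g ∈ BSpace n, Integrable fun x => (v : E n →ₘ[volume] ℂ) x * conj (g x) :=
    fun g hg => integrable_mul_conj_of_mem hn v.2 hg
  obtain ⟨w, hwK, hw⟩ := exists_pairing_eq hn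
    (Λ := fun g : L2 n => ∫ x, (v : E n →ₘ[volume] ℂ) x * conj (g x)) hK
    (fun f hf g hg => by
      rw [← integral_add (hi f hf) (hi g hg)]
      refine integral_congr_ae ?_
      filter_upwards [Lp.coeFn_add f g] with x hx
      rw [hx, Pi.add_apply, map_add, mul_add])
    (fun c f hf => by
      rw [← integral_const_mul]
      refine integral_congr_ae ?_
      filter_upwards [Lp.coeFn_smul c f] with x hx
      rw [hx, Pi.smul_apply, smul_eq_mul, map_mul]
      ring)
    (fun f hf => hv ⟨f, hf⟩)
  have hwv : w - v = 0 := eq_zero_of_pairing hn fun g => by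
    rw [pairing_sub_left hn, hw]
    exact sub_self _
  have hwv' : w = v := sub_eq_zero.1 hwv
  rwa [hwv'] at hwK

/-- The linear operators `B → B^*` given by the boundary form. -/
theorem exists_linearMap_pairing (hn : 0 < n) (hs : 0 < s)
    (hr : IsSymbolOfOrder s (scaledSymbol s r)) (hσ : |σ| = 1) :
    ∃ T : puncturedHalfPlane σ → (BSpace n →ₗ[ℂ] BStar n),
      ∀ (z : puncturedHalfPlane σ) (f g : BSpace n),
        pairing (T z f) g = boundaryForm σ s r f g z := by
  have hex : ∀ (z : puncturedHalfPlane σ) (f : BSpace n), ∃ v : BStar n, ∀ g : BSpace n,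
      pairing v g = boundaryForm σ s r f g z := by
    intro z f
    obtain ⟨C, hC0, hC⟩ := norm_boundaryForm_le hn hs hr hσ (norm_pos_iff.2 z.2.2)
      (abs_nonneg (z : ℂ).re)
    obtain ⟨v, -, hv⟩ := exists_pairing_eq hn (Λ := fun g => boundaryForm σ s r f g z)
      (K := C * bReal (f : L2 n)) (mul_nonneg hC0 (bReal_nonneg _))
      (fun g hg g' hg' => boundaryForm_add_right hn hs hr hσ z.2 f.2 hg hg')
      (fun c g hg => boundaryForm_smul_right hn hs hr hσ z.2 c f.2 hg)
      (fun g hg => hC z z.2 le_rfl le_rfl f f.2 g hg)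
    exact ⟨v, hv⟩
  choose v hv using hex
  have hext : ∀ w w' : BStar n, (∀ g, pairing w g = pairing w' g) → w = w' := by
    intro w w' h
    refine sub_eq_zero.1 (eq_zero_of_pairing hn fun g => ?_)
    rw [pairing_sub_left hn, h, sub_self]
  refine ⟨fun z =>
    { toFun := v z
      map_add' := fun f f' => hext _ _ fun g => by
        rw [pairing_add_left hn, hv, hv, hv, Submodule.coe_add,
          boundaryForm_add_left hn hs hr hσ z.2 f.2 f'.2 g.2]
      map_smul' := fun c f => hext _ _ fun g => by
        rw [RingHom.id_apply, pairing_smul_left, hv, hv, Submodule.coe_smul,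
          boundaryForm_smul_left hn hs hr hσ z.2 c f.2 g.2] }, fun z f g => hv z f g⟩

lemma bStarNorm_le_of_region (hn : 0 < n) (hs : 0 < s)
    (hr : IsSymbolOfOrder s (scaledSymbol s r)) (hσ : |σ| = 1)
    {T : puncturedHalfPlane σ → (BSpace n →ₗ[ℂ] BStar n)}
    (hT : ∀ (z : puncturedHalfPlane σ) (f g : BSpace n),
      pairing (T z f) g = boundaryForm σ s r f g z) {δ M : ℝ} (hδ : 0 < δ) (hM : 0 ≤ M) :
    ∃ C : ℝ≥0, ∀ z : puncturedHalfPlane σ, δ ≤ ‖(z : ℂ)‖ → |(z : ℂ).re| ≤ M → ∀ f : BSpace n,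
      bStarNorm (T z f : E n →ₘ[volume] ℂ) ≤ C * bNorm (f : E n →ₘ[volume] ℂ) := by
  obtain ⟨C, hC0, hC⟩ := norm_boundaryForm_le hn hs hr hσ hδ hM
  refine ⟨⟨C, hC0⟩, fun z hz1 hz2 f => ?_⟩
  have h := bStarNorm_le_of_pairing hn (v := T z f) (mul_nonneg hC0 (bReal_nonneg (f : L2 n)))
    fun g => by rw [hT]; exact hC z z.2 hz1 hz2 f f.2 g g.2
  refine h.trans_eq ?_
  rw [ENNReal.ofReal_mul hC0, ← bNorm_eq_ofReal f.2]
  congr 1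
  exact ENNReal.ofReal_eq_coe_nnreal hC0

lemma IsAdmissible.exists_region {K : Set ℂ} (hK : IsAdmissible σ K) :
    (∀ z ∈ K, z ∈ puncturedHalfPlane σ) ∧
      ∃ δ M : ℝ, 0 < δ ∧ 0 ≤ M ∧ ∀ z ∈ K, δ ≤ ‖z‖ ∧ |z.re| ≤ M := by
  obtain ⟨hcl, hsub, h0, hb⟩ := hK
  refine ⟨fun z hz => ⟨hsub hz, fun h => h0 (h ▸ hz)⟩, ?_⟩
  obtain ⟨δ, hδ, hball⟩ := Metric.isOpen_iff.1 hcl.isOpen_compl 0 h0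
  obtain ⟨M, hM0, hM⟩ := hb.exists_pos_norm_le
  refine ⟨δ, M, hδ, hM0.le, fun z hz => ⟨?_, hM _ ⟨z, hz, rfl⟩⟩⟩
  by_contra hcon
  exact hball (show z ∈ Metric.ball 0 δ by simpa using not_le.1 hcon) hz

/-- The complex conjugate of a Schwartz function. -/
noncomputable def conjSchwartz (φ : 𝓢(E n, ℂ)) : 𝓢(E n, ℂ) :=
  SchwartzMap.postcompCLM (𝕜 := ℝ) (Complex.conjCLE : ℂ →L[ℝ] ℂ) φ

lemma conjSchwartz_apply (φ : 𝓢(E n, ℂ)) (x : E n) : conjSchwartz φ x = conj (φ x) := rfl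

lemma conjSchwartz_conjSchwartz (φ : 𝓢(E n, ℂ)) : conjSchwartz (conjSchwartz φ) = φ := by
  ext x
  rw [conjSchwartz_apply, conjSchwartz_apply, Complex.conj_conj]

lemma conj_toLp_conjSchwartz (φ : 𝓢(E n, ℂ)) :
    (fun x => conj (((conjSchwartz φ).toLp 2 volume : L2 n) x)) =ᵐ[volume] φ := by
  filter_upwards [(conjSchwartz φ).coeFn_toLp 2 volume] with x hx
  rw [hx, conjSchwartz_apply, Complex.conj_conj]

/-- A Schwartz function as an element of `B`. -/
noncomputable def schwartzB (φ : 𝓢(E n, ℂ)) : BSpace n := ⟨φ.toLp 2 volume, toLp_mem_BSpace φ⟩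

lemma pairing_schwartzB (v : BStar n) (φ : 𝓢(E n, ℂ)) :
    pairing v (schwartzB (conjSchwartz φ)) = ∫ x, φ x * (v : E n →ₘ[volume] ℂ) x := by
  unfold pairing
  refine integral_congr_ae ?_
  filter_upwards [conj_toLp_conjSchwartz φ] with x hx
  change _ * conj (((conjSchwartz φ).toLp 2 volume : L2 n) x) = _
  rw [hx, mul_comm]

lemma integrable_schwartz_mul (hn : 0 < n) (v : BStar n) (φ : 𝓢(E n, ℂ)) :
    Integrable fun x => φ x * (v : E n →ₘ[volume] ℂ) x := by
  refine (integrable_mul_conj_of_mem hn v.2 (toLp_mem_BSpace (conjSchwartz φ))).congr ?_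
  filter_upwards [conj_toLp_conjSchwartz φ] with x hx
  rw [hx, mul_comm]

lemma integral_schwartz_mul_multL2 (z : ℂ) (f : L2 n) (φ : 𝓢(E n, ℂ)) :
    ∫ x, φ x * multL2 (resolventSymbol s r z) f x
      = sesqForm s r z f ((conjSchwartz φ).toLp 2 volume) := by
  rw [sesqForm, inner_eq_integral]
  refine integral_congr_ae ?_
  filter_upwards [conj_toLp_conjSchwartz φ] with x hx
  rw [hx, mul_comm]

/-- An element of `B^*` is determined by its pairing with Schwartz functions. -/
lemma eq_of_integral_schwartz (hn : 0 < n) {v w : BStar n}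
    (h : ∀ φ : 𝓢(E n, ℂ), ∫ x, φ x * (v : E n →ₘ[volume] ℂ) x
      = ∫ x, φ x * (w : E n →ₘ[volume] ℂ) x) : v = w := by
  refine sub_eq_zero.1 (eq_zero_of_pairing hn fun g => ?_)
  have hzero : ∀ p : 𝓢(E n, ℂ), pairing (v - w) (schwartzB p) = 0 := by
    intro p
    rw [← conjSchwartz_conjSchwartz p, pairing_sub_left hn, pairing_schwartzB, pairing_schwartzB,
      h, sub_self]
  by_contra hne
  have hpos := norm_pos_iff.2 hne
  set b := bStarReal ((v - w : BStar n) : E n →ₘ[volume] ℂ) with hb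
  have hb0 : 0 ≤ b := bStarReal_nonneg _
  obtain ⟨p, hp⟩ := exists_schwartz_bReal_sub_le g.2
    (ε := ‖pairing (v - w) g‖ / 2 / (b + 1)) (by positivity)
  have h1 := norm_pairing_le hn (v - w) (g - schwartzB p)
  rw [pairing_sub_right hn, hzero, sub_zero, ← hb] at h1
  have h2 : b * bReal ((g - schwartzB p : BSpace n) : L2 n)
      ≤ b * (‖pairing (v - w) g‖ / 2 / (b + 1)) := mul_le_mul_of_nonneg_left hp hb0
  have h3 : b * (‖pairing (v - w) g‖ / 2 / (b + 1)) ≤ ‖pairing (v - w) g‖ / 2 := by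
    rw [← mul_div_assoc, div_le_iff₀ (by positivity)]
    nlinarith
  linarith

lemma isResolventValue_of_pairing (hn : 0 < n) (hs : 0 < s)
    (hr : IsSymbolOfOrder s (scaledSymbol s r)) (hσ : |σ| = 1) {z : ℂ}
    (hz : z ∈ puncturedHalfPlane σ) {f : BSpace n} {v : BStar n}
    (hv : ∀ g : BSpace n, pairing v g = boundaryForm σ s r f g z) :
    IsResolventValue σ s r z f (v : E n →ₘ[volume] ℂ) := by
  refine ⟨fun him => ?_, fun _ φ => ?_⟩
  · have h : v = ⟨(multL2 (resolventSymbol s r z) (f : L2 n) : E n →ₘ[volume] ℂ),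
        coeFn_mem_BStar _⟩ := by
      refine sub_eq_zero.1 (eq_zero_of_pairing hn fun g => ?_)
      rw [pairing_sub_left hn, hv, boundaryForm_eq hn hs hr hσ hz f.2 g.2 him, sesqForm,
        inner_eq_integral]
      exact sub_self _
    rw [h]
  · simp only [integral_schwartz_mul_multL2]
    rw [← pairing_schwartzB, hv]
    exact (tendsto_boundaryForm hn hs hr hσ hz f.2 (toLp_mem_BSpace (conjSchwartz φ))).comp
      (tendsto_vertical hσ hz)

lemma IsResolventValue.unique (hn : 0 < n) {z : ℂ} {f : L2 n} {v w : BStar n}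
    (hv : IsResolventValue σ s r z f (v : E n →ₘ[volume] ℂ))
    (hw : IsResolventValue σ s r z f (w : E n →ₘ[volume] ℂ)) : v = w := by
  by_cases him : z.im = 0
  · exact eq_of_integral_schwartz hn fun φ => tendsto_nhds_unique (hv.2 him φ) (hw.2 him φ)
  · exact Subtype.ext ((hv.1 him).trans (hw.1 him).symm)

end Extension

/-! ### Density of band limited functions in `B` -/

section BandLimited

variable {n : ℕ}

lemma norm_sq_toLp_weight (q : 𝓢(E n, ℂ)) :
    ‖(SchwartzMap.smulLeftCLM ℂ (weight n 1) q).toLp 2 volume‖ ^ 2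
      ≤ (n + 1) * ((∫ ξ, ‖(𝓕 q : 𝓢(E n, ℂ)) ξ‖ ^ 2)
        + ∫ ξ, ‖fderiv ℝ (𝓕 q : 𝓢(E n, ℂ)) ξ‖ ^ 2) := by
  set D := ∫ ξ, ‖fderiv ℝ (𝓕 q : 𝓢(E n, ℂ)) ξ‖ ^ 2 with hD
  have hD0 : 0 ≤ D := integral_nonneg fun ξ => by positivity
  have hcoord : ∀ i, ∫ x : E n, ‖x i‖ ^ 2 * ‖q x‖ ^ 2 ≤ D := by
    intro i
    have h0 : 0 ≤ ∫ x : E n, ‖x i‖ ^ 2 * ‖q x‖ ^ 2 := integral_nonneg fun x => by positivity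
    have hpi : 1 ≤ (2 * Real.pi) ^ 2 := one_le_pow₀ (by linarith [Real.pi_gt_three])
    refine (le_mul_of_one_le_left h0 hpi).trans ?_
    rw [← integral_fderiv_fourier_sq]
    refine integral_mono (integrable_norm_sq_schwartz (SchwartzMap.evalCLM ℝ (E n) ℂ
      (EuclideanSpace.basisFun (Fin n) ℝ i) (SchwartzMap.fderivCLM ℝ (E n) ℂ (𝓕 q))))
      (isH1_schwartz (𝓕 q : 𝓢(E n, ℂ))).integrable_grad_sq fun ξ => ?_
    have h1 := (fderiv ℝ (𝓕 q : 𝓢(E n, ℂ)) ξ).le_opNorm (EuclideanSpace.basisFun (Fin n) ℝ i)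
    rw [OrthonormalBasis.norm_eq_one, mul_one] at h1
    exact pow_le_pow_left₀ (norm_nonneg _) h1 2
  have h1 : ∫ x : E n, ‖x‖ ^ 2 * ‖q x‖ ^ 2 ≤ n * D := by
    have h2 : ∫ x : E n, ‖x‖ ^ 2 * ‖q x‖ ^ 2 = ∑ i, ∫ x : E n, ‖x i‖ ^ 2 * ‖q x‖ ^ 2 := by
      rw [← integral_finsetSum _ fun i _ => integrable_coord_sq_mul q i]
      simp only [sum_coord_sq_mul]
    rw [h2]
    refine (Finset.sum_le_sum fun i _ => hcoord i).trans_eq ?_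
    simp
  rw [norm_sq_toLp]
  have h2 : ∫ x, ‖SchwartzMap.smulLeftCLM ℂ (weight n 1) q x‖ ^ 2
      = (∫ x, ‖q x‖ ^ 2) + ∫ x : E n, ‖x‖ ^ 2 * ‖q x‖ ^ 2 := by
    rw [← integral_add (integrable_norm_sq_schwartz q) (integrable_norm_sq_mul q)]
    refine integral_congr_ae (ae_of_all _ fun x => ?_)
    change ‖SchwartzMap.smulLeftCLM ℂ (weight n 1) q x‖ ^ 2 = ‖q x‖ ^ 2 + ‖x‖ ^ 2 * ‖q x‖ ^ 2
    rw [SchwartzMap.smulLeftCLM_apply_apply (hasTemperateGrowth_weight 1), norm_smul, mul_pow,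
      norm_weight, japanese_one_sq]
    ring
  rw [h2, SchwartzMap.integral_norm_sq_fourier]
  have h3 : 0 ≤ ∫ x, ‖q x‖ ^ 2 := integral_nonneg fun x => by positivity
  have h4 : 0 ≤ (n : ℝ) * ∫ x, ‖q x‖ ^ 2 := by positivity
  linarith

/-- A smooth cutoff function, equal to `1` on the ball of radius `N + 1`. -/
noncomputable def cutoff (n N : ℕ) (ξ : E n) : ℂ :=
  (((⟨1, 2, one_pos, one_lt_two⟩ : ContDiffBump (0 : E n)) ((N + 1 : ℝ)⁻¹ • ξ) : ℝ) : ℂ)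

lemma contDiff_cutoff (N : ℕ) : ContDiff ℝ ((⊤ : ℕ∞) : WithTop ℕ∞) (cutoff n N) :=
  Complex.ofRealCLM.contDiff.comp ((ContDiffBump.contDiff _).comp (contDiff_const_smul _))

lemma hasCompactSupport_cutoff (N : ℕ) : HasCompactSupport (cutoff n N) := by
  refine HasCompactSupport.intro (isCompact_closedBall (0 : E n) (2 * (N + 1))) fun ξ hξ => ?_
  unfold cutoff
  rw [ContDiffBump.zero_of_le_dist, Complex.ofReal_zero]
  have hξ' : 2 * ((N : ℝ) + 1) < ‖ξ‖ := by simpa using hξ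
  have hN : (0 : ℝ) < N + 1 := by positivity
  rw [dist_zero_right, norm_smul, norm_inv, Real.norm_of_nonneg hN.le, inv_mul_eq_div]
  change (2 : ℝ) ≤ _
  rw [le_div_iff₀ hN]
  exact hξ'.le

lemma norm_one_sub_cutoff_le (N : ℕ) (ξ : E n) : ‖1 - cutoff n N ξ‖ ≤ 1 := by
  unfold cutoff
  rw [← Complex.ofReal_one, ← Complex.ofReal_sub, Complex.norm_real, Real.norm_eq_abs, abs_le]
  constructor
  · linarith [ContDiffBump.le_one (⟨1, 2, one_pos, one_lt_two⟩ : ContDiffBump (0 : E n))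
      (x := (N + 1 : ℝ)⁻¹ • ξ)]
  · linarith [ContDiffBump.nonneg (⟨1, 2, one_pos, one_lt_two⟩ : ContDiffBump (0 : E n))
      (x := (N + 1 : ℝ)⁻¹ • ξ)]

lemma exists_norm_fderiv_cutoff_le :
    ∃ C : ℝ, 0 ≤ C ∧ ∀ (N : ℕ) (ξ : E n), ‖fderiv ℝ (cutoff n N) ξ‖ ≤ C := by
  obtain ⟨C, hC⟩ := ((hasCompactSupport_cutoff (n := n) 0).fderiv ℝ).exists_bound_of_continuous
    ((contDiff_cutoff 0).continuous_fderiv (by simp))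
  refine ⟨C, (norm_nonneg _).trans (hC 0), fun N ξ => ?_⟩
  have h1 : cutoff n N = fun ξ => cutoff n 0 ((N + 1 : ℝ)⁻¹ • ξ) := by
    ext ξ
    simp [cutoff]
  rw [h1, fderiv_comp_smul, norm_smul, norm_inv]
  refine (mul_le_of_le_one_left (norm_nonneg _) ?_).trans (hC _)
  rw [Real.norm_of_nonneg (by positivity)]
  exact inv_le_one_of_one_le₀ (by linarith [(Nat.cast_nonneg N : (0 : ℝ) ≤ N)])

lemma cutoff_eventuallyEq_one {N : ℕ} {ξ : E n} (h : ‖ξ‖ < N + 1) : cutoff n N =ᶠ[𝓝 ξ] 1 := by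
  have hN : (0 : ℝ) < N + 1 := by positivity
  have hball : ∀ᶠ η : E n in 𝓝 ξ, ‖η‖ < N + 1 := continuous_norm.continuousAt.eventually_lt_const h
  filter_upwards [hball] with η hη
  unfold cutoff
  rw [ContDiffBump.one_of_mem_closedBall, Complex.ofReal_one, Pi.one_apply]
  rw [mem_closedBall_zero_iff, norm_smul, norm_inv, Real.norm_of_nonneg hN.le, inv_mul_eq_div]
  change _ ≤ (1 : ℝ)
  rw [div_le_one hN]
  exact hη.le

/-- The high frequency part of a Schwartz function on the Fourier side. -/
noncomputable def highPart (P : 𝓢(E n, ℂ)) (N : ℕ) : 𝓢(E n, ℂ) :=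
  P - SchwartzMap.smulLeftCLM ℂ (cutoff n N) P

lemma highPart_apply (P : 𝓢(E n, ℂ)) (N : ℕ) (ξ : E n) :
    highPart P N ξ = (1 - cutoff n N ξ) * P ξ := by
  have hg : (cutoff n N).HasTemperateGrowth :=
    (hasCompactSupport_cutoff N).hasTemperateGrowth (contDiff_cutoff N)
  change P ξ - SchwartzMap.smulLeftCLM ℂ (cutoff n N) P ξ = _
  rw [SchwartzMap.smulLeftCLM_apply_apply hg, smul_eq_mul]
  ring

lemma highPart_eventuallyEq_zero (P : 𝓢(E n, ℂ)) {N : ℕ} {ξ : E n} (h : ‖ξ‖ < N + 1) :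
    (highPart P N : E n → ℂ) =ᶠ[𝓝 ξ] fun _ => 0 := by
  filter_upwards [cutoff_eventuallyEq_one h] with η hη
  rw [highPart_apply, hη, Pi.one_apply, sub_self, zero_mul]

lemma norm_highPart_le (P : 𝓢(E n, ℂ)) (N : ℕ) (ξ : E n) : ‖highPart P N ξ‖ ≤ ‖P ξ‖ := by
  rw [highPart_apply, norm_mul]
  exact mul_le_of_le_one_left (norm_nonneg _) (norm_one_sub_cutoff_le N ξ)

lemma norm_fderiv_highPart_le {C : ℝ} (hC : ∀ (N : ℕ) (ξ : E n), ‖fderiv ℝ (cutoff n N) ξ‖ ≤ C)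
    (P : 𝓢(E n, ℂ)) (N : ℕ) (ξ : E n) :
    ‖fderiv ℝ (highPart P N) ξ‖ ≤ ‖fderiv ℝ P ξ‖ + C * ‖P ξ‖ := by
  have h1 : (highPart P N : E n → ℂ) = fun ξ => (1 - cutoff n N ξ) * P ξ :=
    funext (highPart_apply P N)
  have hχ : DifferentiableAt ℝ (cutoff n N) ξ :=
    (contDiff_cutoff N).contDiffAt.differentiableAt (by simp)
  rw [h1, fderiv_fun_mul (hχ.const_sub 1) P.differentiableAt, fderiv_const_sub]
  refine (norm_add_le _ _).trans (add_le_add ?_ ?_)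
  · rw [norm_smul]
    exact mul_le_of_le_one_left (norm_nonneg _) (norm_one_sub_cutoff_le N ξ)
  · rw [norm_smul, norm_neg, mul_comm]
    exact mul_le_mul_of_nonneg_right (hC N ξ) (norm_nonneg _)

lemma tendsto_integral_highPart (P : 𝓢(E n, ℂ)) :
    Tendsto (fun N => (∫ ξ, ‖highPart P N ξ‖ ^ 2) + ∫ ξ, ‖fderiv ℝ (highPart P N) ξ‖ ^ 2) atTop
      (𝓝 0) := by
  obtain ⟨C, hC0, hC⟩ := exists_norm_fderiv_cutoff_le (n := n)
  have hev : ∀ ξ : E n, ∀ᶠ N : ℕ in atTop, ‖ξ‖ < N + 1 := fun ξ =>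
    (tendsto_atTop_add_const_right _ 1 tendsto_natCast_atTop_atTop).eventually_gt_atTop ‖ξ‖
  have h1 : Tendsto (fun N => ∫ ξ, ‖highPart P N ξ‖ ^ 2) atTop (𝓝 (∫ _ : E n, (0 : ℝ))) := by
    refine tendsto_integral_of_dominated_convergence (fun ξ => ‖P ξ‖ ^ 2)
      (fun N => (integrable_norm_sq_schwartz _).1) (integrable_norm_sq_schwartz P)
      (fun N => ae_of_all _ fun ξ => ?_) (ae_of_all _ fun ξ => ?_)
    · rw [Real.norm_of_nonneg (by positivity)]
      exact pow_le_pow_left₀ (norm_nonneg _) (norm_highPart_le P N ξ) 2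
    · refine tendsto_const_nhds.congr' ?_
      filter_upwards [hev ξ] with N hN
      rw [(highPart_eventuallyEq_zero P hN).self_of_nhds]
      simp
  have h2 : Tendsto (fun N => ∫ ξ, ‖fderiv ℝ (highPart P N) ξ‖ ^ 2) atTop
      (𝓝 (∫ _ : E n, (0 : ℝ))) := by
    refine tendsto_integral_of_dominated_convergence
      (fun ξ => 2 * ‖fderiv ℝ P ξ‖ ^ 2 + 2 * C ^ 2 * ‖P ξ‖ ^ 2)
      (fun N => (isH1_schwartz (highPart P N)).integrable_grad_sq.1)
      (((isH1_schwartz P).integrable_grad_sq.const_mul 2).add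
        ((integrable_norm_sq_schwartz P).const_mul (2 * C ^ 2)))
      (fun N => ae_of_all _ fun ξ => ?_) (ae_of_all _ fun ξ => ?_)
    · rw [Real.norm_of_nonneg (by positivity)]
      refine (pow_le_pow_left₀ (norm_nonneg _) (norm_fderiv_highPart_le hC P N ξ) 2).trans ?_
      nlinarith [sq_nonneg (‖fderiv ℝ P ξ‖ - C * ‖P ξ‖)]
    · refine tendsto_const_nhds.congr' ?_
      filter_upwards [hev ξ] with N hN
      rw [(highPart_eventuallyEq_zero P hN).fderiv_eq]
      simp
  have h3 := h1.add h2
  simpa using h3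

/-- Band limited functions are dense in `B`. -/
theorem exists_bandLimited_bReal_sub_le {f : L2 n} (hf : f ∈ BSpace n) {ε : ℝ} (hε : 0 < ε) :
    ∃ p ∈ BSpace n, IsBandLimited p ∧ bReal (f - p) ≤ ε := by
  obtain ⟨q, hq⟩ := exists_schwartz_bReal_sub_le hf (half_pos hε)
  obtain ⟨C, hC0, hC⟩ := exists_bReal_weightOp_le (n := n)
  set P : 𝓢(E n, ℂ) := 𝓕 q with hP
  have hlim := ((tendsto_integral_highPart P).const_mul ((n : ℝ) + 1)).sqrt.const_mul C
  simp only [mul_zero, Real.sqrt_zero] at hlim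
  obtain ⟨N, hN⟩ := (hlim.eventually_lt_const (half_pos hε)).exists
  set ψ := SchwartzMap.smulLeftCLM ℂ (cutoff n N) P with hψ
  have hg : (cutoff n N).HasTemperateGrowth :=
    (hasCompactSupport_cutoff N).hasTemperateGrowth (contDiff_cutoff N)
  set p : 𝓢(E n, ℂ) := 𝓕⁻ ψ with hp
  have hFp : 𝓕 p = ψ := FourierTransform.fourier_fourierInv_eq ψ
  refine ⟨p.toLp 2 volume, toLp_mem_BSpace p, ⟨ψ, ψ.smooth _, ?_, ?_⟩, ?_⟩
  · have h1 : (ψ : E n → ℂ) = fun ξ => cutoff n N ξ • P ξ := SchwartzMap.smulLeftCLM_apply hg P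
    rw [h1]
    exact (hasCompactSupport_cutoff N).smul_right
  · rw [SchwartzMap.toLp_fourier_eq, hFp]
    exact ψ.coeFn_toLp 2 volume
  · have hF : (𝓕 (q - p) : 𝓢(E n, ℂ)) = highPart P N := by
      have h0 : (𝓕 (q - p) : 𝓢(E n, ℂ)) = 𝓕 q - 𝓕 p :=
        map_sub (FourierTransform.fourierₗ ℂ 𝓢(E n, ℂ)) q p
      rw [h0, hFp]
      rfl
    have h1 := norm_sq_toLp_weight (q - p)
    rw [hF] at h1
    have h2 := Real.le_sqrt_of_sq_le h1
    have h3 : bReal (q.toLp 2 volume - p.toLp 2 volume : L2 n) ≤ ε / 2 := by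
      have h4 : (q.toLp 2 volume - p.toLp 2 volume : L2 n) = (q - p).toLp 2 volume := rfl
      rw [h4, toLp_eq_weightOp]
      exact ((hC _).trans (mul_le_mul_of_nonneg_left h2 hC0)).trans hN.le
    have h5 : f - p.toLp 2 volume = (f - q.toLp 2 volume)
        + (q.toLp 2 volume - p.toLp 2 volume) := by abel
    rw [h5]
    refine (bReal_add_le (sub_mem hf (toLp_mem_BSpace q))
      (sub_mem (toLp_mem_BSpace q) (toLp_mem_BSpace p))).trans ?_
    linarith

end BandLimited

/-! ### Elements of `B^*` as tempered distributions -/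

section Distribution

variable {n : ℕ} {s σ : ℝ}

lemma bReal_toLp_le : ∃ C : ℝ, 0 ≤ C ∧ ∀ q : 𝓢(E n, ℂ), bReal (q.toLp 2 volume)
    ≤ C * ‖(SchwartzMap.smulLeftCLM ℂ (weight n 1) q).toLp 2 volume‖ := by
  obtain ⟨C, hC0, hC⟩ := exists_bReal_weightOp_le (n := n)
  refine ⟨C, hC0, fun q => ?_⟩
  rw [toLp_eq_weightOp]
  exact hC _

/-- An element of `B^*` defines a tempered distribution. -/
lemma exists_isGivenBy (hn : 0 < n) (v : BStar n) :
    ∃ u : 𝓢'(E n, ℂ), IsGivenBy u (v : E n →ₘ[volume] ℂ) := by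
  obtain ⟨C, hC0, hC⟩ := bReal_toLp_le (n := n)
  have hi := integrable_schwartz_mul hn v
  let ℓ : 𝓢(E n, ℂ) →ₗ[ℂ] ℂ :=
    { toFun := fun φ => ∫ x, φ x * (v : E n →ₘ[volume] ℂ) x
      map_add' := fun φ ψ => by
        rw [← integral_add (hi φ) (hi ψ)]
        exact integral_congr_ae (ae_of_all _ fun x => add_mul _ _ _)
      map_smul' := fun c φ => by
        rw [RingHom.id_apply, smul_eq_mul, ← integral_const_mul]
        exact integral_congr_ae (ae_of_all _ fun x => mul_assoc _ _ _) }
  have hbound : ∀ φ, ‖ℓ φ‖ ≤ bStarReal (v : E n →ₘ[volume] ℂ) * (C *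
      ‖(SchwartzMap.smulLeftCLM ℂ (weight n 1) (conjSchwartz φ)).toLp 2 volume‖) := by
    intro φ
    have h1 : ℓ φ = pairing v (schwartzB (conjSchwartz φ)) := (pairing_schwartzB v φ).symm
    rw [h1]
    exact (norm_pairing_le hn v _).trans (mul_le_mul_of_nonneg_left (hC _) (bStarReal_nonneg _))
  have hcont : Continuous fun φ : 𝓢(E n, ℂ) => bStarReal (v : E n →ₘ[volume] ℂ) * (C *
      ‖(SchwartzMap.smulLeftCLM ℂ (weight n 1) (conjSchwartz φ)).toLp 2 volume‖) := by
    have h1 : Continuous (conjSchwartz (n := n)) :=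
      (SchwartzMap.postcompCLM (𝕜 := ℝ) (E := E n) (Complex.conjCLE : ℂ →L[ℝ] ℂ)).continuous
    have h2 := (SchwartzMap.continuous_toLp (F := ℂ) (p := 2)
      (μ := (volume : Measure (E n)))).comp
        ((SchwartzMap.smulLeftCLM ℂ (weight n 1)).continuous.comp h1)
    exact continuous_const.mul (continuous_const.mul h2.norm)
  have hℓc : Continuous ℓ := by
    refine continuous_of_continuousAt_zero ℓ.toAddMonoidHom ?_
    have h0 := hcont.tendsto 0
    have hz : (SchwartzMap.smulLeftCLM ℂ (weight n 1) (conjSchwartz (0 : 𝓢(E n, ℂ)))).toLp 2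
        volume = 0 := by
      have h1 : conjSchwartz (0 : 𝓢(E n, ℂ)) = 0 :=
        map_zero (SchwartzMap.postcompCLM (𝕜 := ℝ) (E := E n) (Complex.conjCLE : ℂ →L[ℝ] ℂ))
      rw [h1, map_zero]
      exact map_zero (SchwartzMap.toLpCLM ℂ ℂ 2 (volume : Measure (E n)))
    rw [hz, norm_zero, mul_zero, mul_zero] at h0
    have h2 : ℓ.toAddMonoidHom 0 = 0 := map_zero ℓ
    rw [ContinuousAt, h2]
    exact squeeze_zero_norm hbound h0
  exact ⟨ContinuousLinearMap.toPointwiseConvergenceCLM _ _ _ _ (⟨ℓ, hℓc⟩ : 𝓢(E n, ℂ) →L[ℂ] ℂ), fun φ => ⟨hi φ, rfl⟩⟩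

lemma fourier_conjSchwartz (φ : 𝓢(E n, ℂ)) : 𝓕 (conjSchwartz φ) = conjSchwartz (𝓕⁻ φ) := by
  ext ξ
  rw [conjSchwartz_apply, SchwartzMap.fourier_coe, SchwartzMap.fourierInv_coe, Real.fourier_eq',
    Real.fourierInv_eq', ← integral_conj]
  refine integral_congr_ae (ae_of_all _ fun x => ?_)
  change _ * conj (φ x) = conj (_ * φ x)
  rw [map_mul, ← Complex.exp_conj]
  congr 2
  simp only [map_mul, Complex.conj_ofReal, Complex.conj_I]
  push_cast
  ring

/-- The symbol of `(I - Δ)^{s/2}` in the variable dual to `x` under the kernel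
`exp(-2πi x·ξ)`. -/
noncomputable def besselSymbol (n : ℕ) (s : ℝ) (ξ : E n) : ℂ :=
  (japanese s ((2 * Real.pi) • ξ) : ℂ)

lemma hasTemperateGrowth_besselSymbol (s : ℝ) : (besselSymbol n s).HasTemperateGrowth :=
  (hasTemperateGrowth_weight (n := n) s).comp
    ((2 * Real.pi) • ContinuousLinearMap.id ℝ (E n)).hasTemperateGrowth

/-- The test function dual to `φ` under the action of the Bessel potential. -/
noncomputable def besselTest (s : ℝ) (φ : 𝓢(E n, ℂ)) : 𝓢(E n, ℂ) :=
  𝓕 (SchwartzMap.smulLeftCLM ℂ (besselSymbol n s) (𝓕⁻ φ))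

lemma bessel_apply (u : 𝓢'(E n, ℂ)) (φ : 𝓢(E n, ℂ)) : bessel n s u φ = u (besselTest s φ) :=
  rfl

lemma contDiff_japanese (s : ℝ) : ContDiff ℝ 1 fun ξ : E n => (japanese s ξ : ℂ) :=
  (hasTemperateGrowth_weight s).1.of_le (by exact_mod_cast le_top)

lemma isSymbolOfOrder_japanese (hs : 0 < s) :
    IsSymbolOfOrder s (scaledSymbol s fun ξ : E n => (japanese s ξ : ℂ)) := by
  refine isSymbolOfOrder_scaledSymbol hs (contDiff_japanese s) ⟨1, fun ξ => ?_⟩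
  rw [div_self (Complex.ofReal_ne_zero.2 (japanese_pos s ξ).ne'), norm_one]

lemma isSymbolOfOrder_one (hs : 0 < s) :
    IsSymbolOfOrder s (scaledSymbol s fun _ : E n => (1 : ℂ)) := by
  refine isSymbolOfOrder_scaledSymbol hs contDiff_const ⟨1, fun ξ => ?_⟩
  rw [norm_div, norm_one, Complex.norm_real, Real.norm_of_nonneg (japanese_pos s ξ).le,
    div_le_one (japanese_pos s ξ)]
  exact Real.one_le_rpow (by nlinarith [norm_nonneg ξ]) (by positivity)

lemma sesqForm_besselTest (hs : 0 < s) {z : ℂ} (hz : z.im ≠ 0) (f : L2 n) (φ : 𝓢(E n, ℂ)) :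
    sesqForm s (fun _ => 1) z f ((conjSchwartz (besselTest s φ)).toLp 2 volume)
      = sesqForm s (fun ξ => (japanese s ξ : ℂ)) z f ((conjSchwartz φ).toLp 2 volume) := by
  rw [sesqForm_eq_integral hs (isSymbolOfOrder_one hs) hz,
    sesqForm_eq_integral hs (isSymbolOfOrder_japanese hs) hz, SchwartzMap.toLp_fourier_eq,
    SchwartzMap.toLp_fourier_eq, fourier_conjSchwartz, fourier_conjSchwartz]
  have hinv : 𝓕⁻ (besselTest s φ) = SchwartzMap.smulLeftCLM ℂ (besselSymbol n s) (𝓕⁻ φ) :=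
    FourierTransform.fourierInv_fourier_eq _
  refine integral_congr_ae ?_
  filter_upwards [conj_toLp_conjSchwartz (𝓕⁻ (besselTest s φ)),
    conj_toLp_conjSchwartz (𝓕⁻ φ)] with ξ h1 h2
  rw [h1, h2, hinv, SchwartzMap.smulLeftCLM_apply_apply (hasTemperateGrowth_besselSymbol s)]
  unfold resolventMultiplier resolventSymbol besselSymbol
  rw [smul_eq_mul]
  ring

lemma boundaryForm_besselTest (hn : 0 < n) (hs : 0 < s) (hσ : |σ| = 1) {z : ℂ}
    (hz : z ∈ puncturedHalfPlane σ) {f : L2 n} (hf : f ∈ BSpace n) (φ : 𝓢(E n, ℂ)) :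
    boundaryForm σ s (fun _ => 1) f ((conjSchwartz (besselTest s φ)).toLp 2 volume) z
      = boundaryForm σ s (fun ξ => (japanese s ξ : ℂ)) f ((conjSchwartz φ).toLp 2 volume) z := by
  have := neBot_nhdsWithin_openHalfPlane hσ hz
  refine tendsto_nhds_unique
    (tendsto_boundaryForm hn hs (isSymbolOfOrder_one hs) hσ hz hf (toLp_mem_BSpace _))
    ((tendsto_boundaryForm hn hs (isSymbolOfOrder_japanese hs) hσ hz hf
      (toLp_mem_BSpace _)).congr' ?_)
  filter_upwards [self_mem_nhdsWithin] with w hw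
  exact (sesqForm_besselTest hs (im_ne_zero_of_mem hw) f φ).symm

end Distribution

section Main

variable {n : ℕ} {s σ : ℝ} {r : E n → ℂ}

lemma isExtension_of_pairing (hn : 0 < n) (hs : 0 < s)
    (hr : IsSymbolOfOrder s (scaledSymbol s r)) (hσ : |σ| = 1)
    {T : puncturedHalfPlane σ → (BSpace n →ₗ[ℂ] BStar n)}
    (hT : ∀ (z : puncturedHalfPlane σ) (f g : BSpace n),
      pairing (T z f) g = boundaryForm σ s r f g z) : IsExtension σ s r T where
  agrees z f _ := isResolventValue_of_pairing hn hs hr hσ z.2 (hT z f)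
  bounded z := by
    obtain ⟨C, hC⟩ := bStarNorm_le_of_region hn hs hr hσ hT (norm_pos_iff.2 z.2.2)
      (abs_nonneg (z : ℂ).re)
    exact ⟨C, hC z le_rfl le_rfl⟩
  weakStar f v := by
    simp only [hT]
    exact (continuousOn_boundaryForm hn hs hr hσ f.2 v.2).domRestrict

/-- Two extensions coincide, since band limited functions are dense in `B`. -/
lemma IsExtension.unique (hn : 0 < n) {T T' : puncturedHalfPlane σ → (BSpace n →ₗ[ℂ] BStar n)}
    (hT : IsExtension σ s r T) (hT' : IsExtension σ s r T') : T' = T := by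
  funext z
  refine LinearMap.ext fun f => ?_
  obtain ⟨C, hC⟩ := hT.bounded z
  obtain ⟨C', hC'⟩ := hT'.bounded z
  refine sub_eq_zero.1 (Subtype.ext (eq_zero_of_bStarNorm_eq_zero hn ?_))
  refine le_antisymm (ENNReal.le_of_forall_pos_le_add fun ε hε _ => ?_) zero_le
  rw [zero_add]
  obtain ⟨p, hpB, hp, hfp⟩ := exists_bandLimited_bReal_sub_le f.2
    (ε := ε / (C + C' + 1)) (by positivity)
  set q : BSpace n := ⟨p, hpB⟩ with hq
  have heq : T' z q = T z q :=
    IsResolventValue.unique hn (hT'.agrees z q hp) (hT.agrees z q hp)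
  have hdiff : T' z f - T z f = T' z (f - q) + -T z (f - q) := by
    rw [map_sub, map_sub, heq]
    abel
  have hb : bNorm ((f - q : BSpace n) : E n →ₘ[volume] ℂ) ≤ ENNReal.ofReal (ε / (C + C' + 1)) := by
    rw [bNorm_eq_ofReal (f - q).2]
    exact ENNReal.ofReal_le_ofReal hfp
  rw [hdiff]
  refine (bStarNorm_add_le _ _).trans ?_
  have h1 : bStarNorm ((-T z (f - q) : BStar n) : E n →ₘ[volume] ℂ)
      = bStarNorm (T z (f - q) : E n →ₘ[volume] ℂ) := by
    rw [Submodule.coe_neg, ← neg_one_smul ℂ, bStarNorm_smul, enorm_neg, enorm_one, one_mul]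
  rw [h1]
  calc _ ≤ C' * bNorm ((f - q : BSpace n) : E n →ₘ[volume] ℂ)
        + C * bNorm ((f - q : BSpace n) : E n →ₘ[volume] ℂ) := add_le_add (hC' _) (hC _)
    _ = ((C + C' : ℝ≥0) : ℝ≥0∞) * bNorm ((f - q : BSpace n) : E n →ₘ[volume] ℂ) := by
        rw [ENNReal.coe_add]; ring
    _ ≤ ((C + C' : ℝ≥0) : ℝ≥0∞) * ENNReal.ofReal (ε / (C + C' + 1)) := by gcongr
    _ = ENNReal.ofReal ((C + C') * (ε / (C + C' + 1))) := by
        rw [ENNReal.ofReal_mul (by positivity)]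
        congr 1
        exact (ENNReal.ofReal_coe_nnreal (p := C + C')).symm
    _ ≤ ENNReal.ofReal ε := by
        refine ENNReal.ofReal_le_ofReal ?_
        rw [← mul_div_assoc, div_le_iff₀ (by positivity)]
        nlinarith [ε.2]
    _ = ε := ENNReal.ofReal_coe_nnreal

end Main

end FracLAP

theorem theorem4p5 (n : ℕ) (hn : 0 < n) (s : ℝ) (hs : 0 < s) (σ : ℝ) (hσ : σ = 1 ∨ σ = -1) :
    (∀ r : E n → ℂ, IsMultiplierOfOrder s r →
      (∀ K : Set ℂ, IsAdmissible σ K → ∃ C : ℝ≥0, ∀ f : BSpace n,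
        IsBandLimited (f : Lp ℂ 2 (volume : Measure (E n))) → ∀ z ∈ K, ∃ g : BStar n,
          IsResolventValue σ s r z f (g : E n →ₘ[volume] ℂ) ∧
          bStarNorm (g : E n →ₘ[volume] ℂ) ≤ C * bNorm (f : E n →ₘ[volume] ℂ)) ∧
      ∃ T : puncturedHalfPlane σ → (BSpace n →ₗ[ℂ] BStar n),
        IsExtension σ s r T ∧
        (∀ T' : puncturedHalfPlane σ → (BSpace n →ₗ[ℂ] BStar n),
          IsExtension σ s r T' → T' = T) ∧
        (∀ (z : puncturedHalfPlane σ) (f : BSpace n),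
          IsResolventValue σ s r z f (T z f : E n →ₘ[volume] ℂ)) ∧
        (∀ K : Set ℂ, IsAdmissible σ K → ∃ C : ℝ≥0, ∀ z : puncturedHalfPlane σ, (z : ℂ) ∈ K →
          ∀ f : BSpace n,
            bStarNorm (T z f : E n →ₘ[volume] ℂ) ≤ C * bNorm (f : E n →ₘ[volume] ℂ))) ∧
    ∃ T : puncturedHalfPlane σ → (BSpace n →ₗ[ℂ] BStar n),
      IsExtension σ s (fun _ => 1) T ∧
      ∀ z : puncturedHalfPlane σ, ∃ C : ℝ≥0, ∀ f : BSpace n, ∃ u : 𝓢'(E n, ℂ),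
        IsGivenBy u (T z f : E n →ₘ[volume] ℂ) ∧
        BStarSNormLE s u (C * bNorm (f : E n →ₘ[volume] ℂ)) := by
  have hσ1 : |σ| = 1 := by
    rcases hσ with rfl | rfl <;> simp
  refine ⟨fun r hr => ?_, ?_⟩
  · have hsym := isSymbolOfOrder_scaledSymbol hs hr.1 hr.2.1
    obtain ⟨T, hT⟩ := exists_linearMap_pairing hn hs hsym hσ1
    have hval : ∀ (z : puncturedHalfPlane σ) (f : BSpace n),
        IsResolventValue σ s r z f (T z f : E n →ₘ[volume] ℂ) := fun z f =>
      isResolventValue_of_pairing hn hs hsym hσ1 z.2 (hT z f)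
    have hext := isExtension_of_pairing hn hs hsym hσ1 hT
    have hbd : ∀ K : Set ℂ, IsAdmissible σ K → ∃ C : ℝ≥0, ∀ z : puncturedHalfPlane σ,
        (z : ℂ) ∈ K → ∀ f : BSpace n,
          bStarNorm (T z f : E n →ₘ[volume] ℂ) ≤ C * bNorm (f : E n →ₘ[volume] ℂ) := by
      intro K hK
      obtain ⟨-, δ, M, hδ, hM, hreg⟩ := hK.exists_region
      obtain ⟨C, hC⟩ := bStarNorm_le_of_region hn hs hsym hσ1 hT hδ hM
      exact ⟨C, fun z hz f => hC z (hreg z hz).1 (hreg z hz).2 f⟩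
    refine ⟨fun K hK => ?_, T, hext, fun T' hT' => hext.unique hn hT', hval, hbd⟩
    obtain ⟨C, hC⟩ := hbd K hK
    exact ⟨C, fun f _ z hz => ⟨T ⟨z, hK.exists_region.1 z hz⟩ f,
      hval ⟨z, hK.exists_region.1 z hz⟩ f, hC ⟨z, hK.exists_region.1 z hz⟩ hz f⟩⟩
  · obtain ⟨T, hT⟩ := exists_linearMap_pairing hn hs (isSymbolOfOrder_one (n := n) hs) hσ1
    obtain ⟨S, hS⟩ := exists_linearMap_pairing hn hs (isSymbolOfOrder_japanese (n := n) hs) hσ1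
    refine ⟨T, isExtension_of_pairing hn hs (isSymbolOfOrder_one hs) hσ1 hT, fun z => ?_⟩
    obtain ⟨C, hC⟩ := bStarNorm_le_of_region hn hs (isSymbolOfOrder_japanese hs) hσ1 hS
      (norm_pos_iff.2 z.2.2) (abs_nonneg (z : ℂ).re)
    refine ⟨C, fun f => ?_⟩
    obtain ⟨u, hu⟩ := exists_isGivenBy hn (T z f)
    refine ⟨u, hu, S z f, fun φ => ⟨integrable_schwartz_mul hn (S z f) φ, ?_⟩,
      hC z le_rfl le_rfl f⟩
    rw [bessel_apply, (hu _).2, ← pairing_schwartzB, hT, ← pairing_schwartzB, hS]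
    exact boundaryForm_besselTest hn hs hσ1 z.2 f.2 φ
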